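/- Let $n,m\ge 0$ be integers. For integers $j,k$ let $\mathcal L_{j,k}$ be the complex span of the Laurent monomials $z^sw^t$ with $|s|\le j$, $|t|\le k$, and let $\mathcal P_{j,k}$ be the complex span of the monomials $z^sw^t$ with $0\le s\le j$, $0\le t\le k$ (so $\mathcal P_{j,k}=\{0\}$ if $j<0$ or $k<0$). For a Laurent polynomial $f$ put $\bar f(z,w)=\overline{f(\bar z,\bar w)}$. Let $\mathcal T:\mathcal L_{n,m}\to\mathbb C$ be a positive linear form, that is, $\mathcal T\big(f(z,w)\bar f(1/z,1/w)\big)>0$ for every nonzero $f\in\mathcal P_{n,m}$, and let $\mathcal H_{\mathcal T}$ be the finite-dimensional Hilbert space $\mathcal P_{n,m}$ with inner product $\langle f,g\rangle=\mathcal T\big(f(z,w)\bar g(1/z,1/w)\big)$. All orthogonal complements and orthogonal projections $P_{\mathcal S}$ (onto a subspace $\mathcal S$) are taken in $\mathcal H_{\mathcal T}$. For $k\le n$, $l\le m$ put $$\mathcal E^1_{k,l}=\mathcal P_{k,l}\ominus w\mathcal P_{k,l-1},\qquad \mathcal E^2_{k,l}=\mathcal P_{k,l}\ominus z\mathcal P_{k-1,l},\qquad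 \mathcal F^2_{k,l}=\mathcal P_{k,l}\ominus\mathcal P_{k-1,l}.$$ Let $M_z$ be multiplication by $z$, and define the linear operators $$A=P_{w\mathcal E^2_{n,m-1}}M_z:\mathcal E^1_{n-1,m}\to w\mathcal E^2_{n,m-1},\qquad B=P_{\mathcal E^1_{n-1,m}}:w\mathcal F^2_{n,m-1}\to\mathcal E^1_{n-1,m},\qquad T=P_{\mathcal E^1_{n-1,m}}M_z:\mathcal E^1_{n-1,m}\to\mathcal E^1_{n-1,m}.$$ Let $\mathbb T=\{|z|=1\}$ and $\overline{\mathbb D}=\{|w|\le 1\}$. Then the following are equivalent. 1. (Bernstein–Szegő condition) There is a polynomial $p\in\mathbb C[z,w]$ of degree at most $n$ in $z$ and at most $m$ in $w$, with no zeros on $\mathbb T\times\overline{\mathbb D}$, such that $$\mathcal T(z^jw^k)=\int_{\mathbb T^2}z^jw^k\,\frac{|dz|\,|dw|}{(2\pi)^2|p(z,w)|^2}\qquad\text{for all integers } |j|\le n,\ |k|\le m.$$ 2. (Split-shift orthogonality condition) There are subspaces $\mathcal K_1,\mathcal K_2\subset\mathcal H_{\mathcal T}$ such that $\mathcal E^1_{n-1,m}=\mathcal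 K_1\oplus\mathcal K_2$ (orthogonal direct sum), $\mathcal K_1\perp z\mathcal K_2$, and $\mathcal K_1,\ z\mathcal K_2\subset\mathcal E^1_{n,m}$. 3. (Matrix condition) The smallest $T$-invariant subspace containing the range of $B$ is contained in the kernel of $A$. 3'. (Matrix condition, concretely) $AT^jB=0$ for $j=0,1,\dots,n-1$. -/

import Mathlib

open scoped ComplexConjugate InnerProductSpace

noncomputable section

namespace BernsteinSzego

/-- Laurent polynomials in two variables `z, w` with complex coefficients. -/
abbrev Laurent : Type := AddMonoidAlgebra ℂ (ℤ × ℤ)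

/-- The Laurent monomial `z ^ s * w ^ t`. -/
def mono (s t : ℤ) : Laurent := AddMonoidAlgebra.single (s, t) 1

/-- The space `L_{j,k}` spanned by the monomials `z ^ s * w ^ t` with `|s| ≤ j` and `|t| ≤ k`. -/
def laurentSpace (j k : ℤ) : Submodule ℂ Laurent :=
  Submodule.span ℂ {f | ∃ s t : ℤ, |s| ≤ j ∧ |t| ≤ k ∧ f = mono s t}

/-- The space `P_{j,k}` spanned by the monomials `z ^ s * w ^ t` with `0 ≤ s ≤ j` and
`0 ≤ t ≤ k`. It is the zero space if `j` or `k` is negative. -/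
def polySpace (j k : ℤ) : Submodule ℂ Laurent :=
  Submodule.span ℂ {f | ∃ s t : ℤ, (0 ≤ s ∧ s ≤ j) ∧ (0 ≤ t ∧ t ≤ k) ∧ f = mono s t}

/-- The ring homomorphism `f ↦ f̄(1/z, 1/w)`: it conjugates the coefficients and
inverts both variables. -/
def refl : Laurent →+* Laurent :=
  (AddMonoidAlgebra.mapDomainRingHom ℂ (negAddMonoidHom : ℤ × ℤ →+ ℤ × ℤ)).comp
    (AddMonoidAlgebra.mapRingHom (ℤ × ℤ) (starRingEnd ℂ))

lemma refl_single (a : ℤ × ℤ) (c : ℂ) :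
    refl (AddMonoidAlgebra.single a c) = AddMonoidAlgebra.single (-a) (conj c) := by
  simp [refl]

lemma refl_smul (c : ℂ) (f : Laurent) : refl (c • f) = conj c • refl f := by
  have h : c • f = AddMonoidAlgebra.single (0 : ℤ × ℤ) c * f := by
    ext a; simp
  have h' : conj c • refl f = AddMonoidAlgebra.single (0 : ℤ × ℤ) (conj c) * refl f := by
    ext a; simp
  rw [h, h', map_mul, refl_single, neg_zero]

lemma mono_mul_mono (s t u v : ℤ) : mono s t * mono u v = mono (s + u) (t + v) := by
  simp [mono]

lemma refl_mono (s t : ℤ) : refl (mono s t) = mono (-s) (-t) := by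
  rw [mono, refl_single]; simp [mono]

lemma mono_mem_laurentSpace {j k s t : ℤ} (hs : |s| ≤ j) (ht : |t| ≤ k) :
    mono s t ∈ laurentSpace j k :=
  Submodule.subset_span ⟨s, t, hs, ht, rfl⟩

lemma mul_refl_mem {j k : ℤ} {f g : Laurent} (hf : f ∈ polySpace j k)
    (hg : g ∈ polySpace j k) : f * refl g ∈ laurentSpace j k := by
  induction hf using Submodule.span_induction with
  | zero => simp
  | add x y _ _ hx hy => rw [add_mul]; exact add_mem hx hy
  | smul c x _ hx => rw [smul_mul_assoc]; exact Submodule.smul_mem _ _ hx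
  | mem x hx =>
    obtain ⟨s, t, hs, ht, rfl⟩ := hx
    induction hg using Submodule.span_induction with
    | zero => simp
    | add x y _ _ hx hy => rw [map_add, mul_add]; exact add_mem hx hy
    | smul c x _ hx => rw [refl_smul, mul_smul_comm]; exact Submodule.smul_mem _ _ hx
    | mem y hy =>
      obtain ⟨u, v, hu, hv, rfl⟩ := hy
      rw [refl_mono, mono_mul_mono]
      exact mono_mem_laurentSpace (abs_le.2 ⟨by omega, by omega⟩) (abs_le.2 ⟨by omega, by omega⟩)

lemma z_mul_mem {j k : ℤ} {f : Laurent} (hf : f ∈ polySpace (j - 1) k) :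
    mono 1 0 * f ∈ polySpace j k := by
  induction hf using Submodule.span_induction with
  | zero => simp
  | add x y _ _ hx hy => rw [mul_add]; exact add_mem hx hy
  | smul c x _ hx => rw [mul_smul_comm]; exact Submodule.smul_mem _ _ hx
  | mem x hx =>
    obtain ⟨s, t, hs, ht, rfl⟩ := hx
    rw [mono_mul_mono]
    exact Submodule.subset_span ⟨1 + s, 0 + t, by omega, by omega, rfl⟩

instance (j k : ℤ) : FiniteDimensional ℂ (polySpace j k) := by
  refine FiniteDimensional.span_of_finite ℂ (Set.Finite.subset
    (((Set.finite_Icc (0 : ℤ) j).prod (Set.finite_Icc (0 : ℤ) k)).image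
      (fun a => mono a.1 a.2)) ?_)
  rintro _ ⟨s, t, hs, ht, rfl⟩
  exact ⟨(s, t), ⟨hs, ht⟩, rfl⟩

variable {n m : ℕ}

/-- The sesquilinear form `⟨f, g⟩ = 𝒯 (f(z,w) ḡ(1/z,1/w))` on `P_{n,m}`. -/
def form (𝒯 : laurentSpace n m →ₗ[ℂ] ℂ) (f g : polySpace n m) : ℂ :=
  𝒯 ⟨(f : Laurent) * refl g, mul_refl_mem f.2 g.2⟩

/-- A linear form `𝒯` on `L_{n,m}` is positive if `𝒯 (f(z,w) f̄(1/z,1/w)) > 0` (that is, it is a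
positive real number) for every nonzero `f ∈ P_{n,m}`. -/
def IsPositive (𝒯 : laurentSpace n m →ₗ[ℂ] ℂ) : Prop :=
  ∀ f : polySpace n m, f ≠ 0 → 0 < (form 𝒯 f f).re ∧ (form 𝒯 f f).im = 0

section FormLemmas

variable (𝒯 : laurentSpace n m →ₗ[ℂ] ℂ)

lemma form_add_left (f g h : polySpace n m) : form 𝒯 (f + g) h = form 𝒯 f h + form 𝒯 g h := by
  simp only [form, ← map_add]
  congr 1
  exact Subtype.ext (by simp [add_mul])

lemma form_add_right (f g h : polySpace n m) : form 𝒯 f (g + h) = form 𝒯 f g + form 𝒯 f h := by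
  simp only [form, ← map_add]
  congr 1
  exact Subtype.ext (by simp [mul_add])

lemma form_smul_left (c : ℂ) (f g : polySpace n m) : form 𝒯 (c • f) g = c * form 𝒯 f g := by
  simp only [form, ← smul_eq_mul, ← map_smul]
  congr 1
  exact Subtype.ext (by simp)

lemma form_smul_right (c : ℂ) (f g : polySpace n m) :
    form 𝒯 f (c • g) = conj c * form 𝒯 f g := by
  simp only [form, ← smul_eq_mul, ← map_smul]
  congr 1
  exact Subtype.ext (by simp [refl_smul])

variable {𝒯}

lemma form_self_im (hT : IsPositive 𝒯) (f : polySpace n m) : (form 𝒯 f f).im = 0 := by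
  by_cases hf : f = 0
  · subst hf
    have := form_smul_left 𝒯 0 0 0
    simp only [zero_smul, zero_mul] at this
    simp [this]
  · exact (hT f hf).2

lemma form_self_nonneg (hT : IsPositive 𝒯) (f : polySpace n m) : 0 ≤ (form 𝒯 f f).re := by
  by_cases hf : f = 0
  · subst hf
    have := form_smul_left 𝒯 0 0 0
    simp only [zero_smul, zero_mul] at this
    simp [this]
  · exact (hT f hf).1.le

lemma conj_form (hT : IsPositive 𝒯) (f g : polySpace n m) :
    conj (form 𝒯 f g) = form 𝒯 g f := by
  have hf := form_self_im hT f
  have hg := form_self_im hT g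
  have h1 := form_self_im hT (f + g)
  have h2 := form_self_im hT (f + Complex.I • g)
  simp only [form_add_left, form_add_right, form_smul_left, form_smul_right] at h1 h2
  simp at h1 h2
  apply Complex.ext <;> simp <;> linarith

end FormLemmas

/-- The finite dimensional Hilbert space `H_𝒯`: the space `P_{n,m}` with the inner product
`⟨f, g⟩ = 𝒯 (f(z,w) ḡ(1/z,1/w))`. -/
def HSpace (𝒯 : laurentSpace n m →ₗ[ℂ] ℂ) (_hT : IsPositive 𝒯) : Type := polySpace (n : ℤ) m

variable (𝒯 : laurentSpace n m →ₗ[ℂ] ℂ) (hT : IsPositive 𝒯)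

instance : AddCommGroup (HSpace 𝒯 hT) := inferInstanceAs (AddCommGroup (polySpace (n : ℤ) m))

instance : Module ℂ (HSpace 𝒯 hT) := inferInstanceAs (Module ℂ (polySpace (n : ℤ) m))

instance : FiniteDimensional ℂ (HSpace 𝒯 hT) :=
  inferInstanceAs (FiniteDimensional ℂ (polySpace (n : ℤ) m))

/-- The inner product of `H_𝒯`. Mathlib's inner products are conjugate linear in the
first argument, so that `inner ℂ f g` stands for `⟨g, f⟩`. -/
abbrev innerCore : InnerProductSpace.Core ℂ (HSpace 𝒯 hT) where
  inner f g := form 𝒯 g f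
  conj_inner_symm f g := conj_form hT f g
  re_inner_nonneg f := form_self_nonneg hT f
  add_left f g h := form_add_right 𝒯 h f g
  smul_left f g c := form_smul_right 𝒯 c g f
  definite f hf := by
    by_contra h
    have := (hT f h).1
    rw [hf] at this
    simp at this

instance : NormedAddCommGroup (HSpace 𝒯 hT) :=
  @InnerProductSpace.Core.toNormedAddCommGroup ℂ _ _ _ _ (innerCore 𝒯 hT)

instance : InnerProductSpace ℂ (HSpace 𝒯 hT) := InnerProductSpace.ofCore (innerCore 𝒯 hT).toCore

/-- The inclusion of `H_𝒯 = P_{n,m}` into the Laurent polynomials. -/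
def toLaurent : HSpace 𝒯 hT →ₗ[ℂ] Laurent := (polySpace (n : ℤ) m).subtype

lemma inner_eq (f g : HSpace 𝒯 hT) : ⟪g, f⟫_ℂ = form 𝒯 f g := rfl

/-- `P_{k,l}` as a subspace of `H_𝒯`, for `k ≤ n` and `l ≤ m`. -/
def P (k l : ℤ) : Submodule ℂ (HSpace 𝒯 hT) := (polySpace k l).comap (toLaurent 𝒯 hT)

/-- The subspace `z ^ s * w ^ t * S` of `H_𝒯`, for a subspace `S` of `H_𝒯` such that the products
`z ^ s * w ^ t * f` with `f ∈ S` lie in `P_{n,m}`. -/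
def shift {𝒯 : laurentSpace n m →ₗ[ℂ] ℂ} {hT : IsPositive 𝒯} (s t : ℤ)
    (S : Submodule ℂ (HSpace 𝒯 hT)) : Submodule ℂ (HSpace 𝒯 hT) :=
  ((S.map (toLaurent 𝒯 hT)).map (LinearMap.mulLeft ℂ (mono s t))).comap (toLaurent 𝒯 hT)

/-- `ℰ¹_{k,l} = P_{k,l} ⊖ w P_{k,l-1}`. -/
def E1 (k l : ℤ) : Submodule ℂ (HSpace 𝒯 hT) := P 𝒯 hT k l ⊓ (shift 0 1 (P 𝒯 hT k (l - 1)))ᗮ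

/-- `ℰ²_{k,l} = P_{k,l} ⊖ z P_{k-1,l}`. -/
def E2 (k l : ℤ) : Submodule ℂ (HSpace 𝒯 hT) := P 𝒯 hT k l ⊓ (shift 1 0 (P 𝒯 hT (k - 1) l))ᗮ

/-- `ℱ²_{k,l} = P_{k,l} ⊖ P_{k-1,l}`. -/
def F2 (k l : ℤ) : Submodule ℂ (HSpace 𝒯 hT) := P 𝒯 hT k l ⊓ (P 𝒯 hT (k - 1) l)ᗮ

/-- The split-shift orthogonality condition: there are subspaces `K₁, K₂` of `H_𝒯` such that
`ℰ¹_{n-1,m}` is the orthogonal direct sum of `K₁` and `K₂`, `K₁ ⟂ z K₂`, and both `K₁` and `z K₂`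
are contained in `ℰ¹_{n,m}`. -/
def SplitShift : Prop :=
  ∃ K₁ K₂ : Submodule ℂ (HSpace 𝒯 hT),
    (K₁ ⟂ K₂ ∧ K₁ ⊔ K₂ = E1 𝒯 hT (n - 1) m) ∧
    K₁ ⟂ shift 1 0 K₂ ∧
    K₁ ≤ E1 𝒯 hT n m ∧ shift 1 0 K₂ ≤ E1 𝒯 hT n m

/-- Multiplication by `z`, as a map from `ℰ¹_{n-1,m}` to `H_𝒯`. -/
def Mz : E1 𝒯 hT (n - 1) m →ₗ[ℂ] HSpace 𝒯 hT :=
  LinearMap.codRestrict (polySpace (n : ℤ) m)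
    (LinearMap.mulLeft ℂ (mono 1 0) ∘ₗ toLaurent 𝒯 hT ∘ₗ (E1 𝒯 hT (n - 1) m).subtype)
    (fun f => z_mul_mem f.2.1)

/-- The operator `A`: multiplication by `z` on `ℰ¹_{n-1,m}`, followed by the orthogonal projection
onto `w ℰ²_{n,m-1}`. -/
def opA : E1 𝒯 hT (n - 1) m →ₗ[ℂ] shift 0 1 (E2 𝒯 hT n (m - 1)) :=
  (shift 0 1 (E2 𝒯 hT n (m - 1))).orthogonalProjectionOnto.toLinearMap ∘ₗ Mz 𝒯 hT

/-- The operator `B`: the orthogonal projection onto `ℰ¹_{n-1,m}`, restricted to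
`w ℱ²_{n,m-1}`. -/
def opB : shift 0 1 (F2 𝒯 hT n (m - 1)) →ₗ[ℂ] E1 𝒯 hT (n - 1) m :=
  (E1 𝒯 hT (n - 1) m).orthogonalProjectionOnto.toLinearMap ∘ₗ
    (shift 0 1 (F2 𝒯 hT n (m - 1))).subtype

/-- The operator `T`: multiplication by `z` truncated to `ℰ¹_{n-1,m}`. -/
def opT : Module.End ℂ (E1 𝒯 hT (n - 1) m) :=
  (E1 𝒯 hT (n - 1) m).orthogonalProjectionOnto.toLinearMap ∘ₗ Mz 𝒯 hT

/-- The smallest `T`-invariant subspace of `ℰ¹_{n-1,m}` that contains the range of `B`. -/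
def invariantSpan : Submodule ℂ (E1 𝒯 hT (n - 1) m) :=
  sInf {W | LinearMap.range (opB 𝒯 hT) ≤ W ∧ ∀ f ∈ W, opT 𝒯 hT f ∈ W}

/-- The moment `∫_{𝕋²} z ^ j * w ^ k / ((2π)² |p(z,w)|²) |dz| |dw|`, written with
`z = exp (iθ)` and `w = exp (iφ)`. The variables `z, w` of `p` have the indices `0, 1`. -/
def bsMoment (p : MvPolynomial (Fin 2) ℂ) (j k : ℤ) : ℂ :=
  ∫ θ in (0 : ℝ)..(2 * Real.pi), ∫ φ in (0 : ℝ)..(2 * Real.pi),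
    Complex.exp (θ * Complex.I) ^ j * Complex.exp (φ * Complex.I) ^ k /
      ((2 * Real.pi) ^ 2 *
        (‖MvPolynomial.eval ![Complex.exp (θ * Complex.I), Complex.exp (φ * Complex.I)] p‖ : ℂ) ^ 2)

/-- The Bernstein–Szegő condition: for some polynomial `p` of degree at most `(n, m)` with no zeros
on `𝕋 × 𝔻̄`, the values of `𝒯` on monomials are the moments of
`|dz| |dw| / ((2π)² |p(z,w)|²)`. -/
def BernsteinSzegoCondition (𝒯 : laurentSpace n m →ₗ[ℂ] ℂ) : Prop :=
  ∃ p : MvPolynomial (Fin 2) ℂ,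
    p.degreeOf 0 ≤ n ∧ p.degreeOf 1 ≤ m ∧
    (∀ z w : ℂ, ‖z‖ = 1 → ‖w‖ ≤ 1 → MvPolynomial.eval ![z, w] p ≠ 0) ∧
    ∀ (j k : ℤ) (hj : |j| ≤ n) (hk : |k| ≤ m),
      𝒯 ⟨mono j k, mono_mem_laurentSpace hj hk⟩ = bsMoment p j k

end BernsteinSzego

end

/-!
The implications proved are (1) ⇒ (3) ⇒ (2) ⇒ (1), and (3) ⇔ (3') by the Cayley–Hamilton theorem.
`weightForm p` is the linear form `f ↦ ∫ f / |p| ^ 2` on all Laurent polynomials; with respect to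
`⟨f, g⟩ = weightForm p (f * refl g)`, orthogonality also makes sense for negative exponents.

(1) ⇒ (3). The point is `weightForm_orthogonal_of_lt`: for a Bernstein–Szegő weight, a polynomial of
degree `(n, m)` that is orthogonal to `z ^ j * w ^ k` for `0 ≤ j < n` (and all `0 ≤ k ≤ m`) is
orthogonal to these monomials for all negative `j` too. For fixed `z`, the Gohberg–Semencul formula
`sum_fiberMoment_mul_kernel` inverts the Toeplitz matrix of the weight `1 / |p(z, ·)| ^ 2` by the
coefficients of the Christoffel–Darboux kernel of `p(z, ·)`. These are Laurent polynomials in `z` of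
degree at most `n`, which yields a family of Laurent polynomials biorthogonal to the monomials
(`weightForm_mono_mul_dual`). The expansion of `f` in this family along negative powers of `z` has
small norm, because `f` has no negative powers and the moments tend to zero. Consequently the
elements of `ℰ¹_{n-1,m}` that are orthogonal to `z ^ j * w ^ k` for all `j < n` and `1 ≤ k ≤ m` form
a `T`-invariant subspace that contains the range of `B` and is annihilated by `A`.

(3) ⇒ (2). Take for `K₂` the smallest `T`-invariant subspace containing the range of `B`, and for
`K₁` its complement: `A f = 0` says that `z * f ∈ ℰ¹_{n,m}`, and being orthogonal to the range of
`B` says that `f ∈ ℰ¹_{n,m}`.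

(2) ⇒ (1). A dimension count shows that `K₁ ⊕ z K₂` has codimension one in `ℰ¹_{n,m}`; let `p` be a
unit vector in its complement. Multiplication by `z` does not change the reproducing kernel of a
subspace at a fixed `z` with `|z| = 1`, so the kernels of `ℰ¹_{n,m}` and `ℰ¹_{n-1,m}` differ by that
of `p`. Since the kernel of `P_{a,m}` is determined by that of `ℰ¹_{a,m}` (`fiberKernel_hbox_sub`),
the kernel of `ℱ²_{n,m}` is the Christoffel–Darboux kernel of `p(z, ·)`
(`exists_fiberKernel_F2_recurrence`). Two consequences follow.
A zero of `p` in `𝕋 × 𝔻̄` would be a common zero of `ℱ²_{n,m}`, hence of all of `P_{n,m}`: the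
truncation of multiplication by `z` to `P_{n-1,m}` has powers tending to zero, and it preserves the
absolute value of the evaluation at a common zero of `ℱ²_{n,m}`
(`eval_ne_zero_of_fiberKernel_recurrence`). And, again by the Gohberg–Semencul formula, an
orthonormal basis of `ℱ²_{n,m}` is orthonormal for `1 / |p(z, ·)| ^ 2` on each fibre
(`avg_mul_conj_div_of_basis`); iterating the truncated shift once more, this shows that the inner
products given by `𝒯` and by `1 / |p| ^ 2` agree (`weightForm_mul_refl_eq_inner`).
-/

open scoped ComplexConjugate InnerProductSpace

noncomputable section

namespace BernsteinSzego

/-! ### Laurent polynomials -/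

lemma single_eq_smul_mono (a : ℤ × ℤ) (c : ℂ) :
    (AddMonoidAlgebra.single a c : Laurent) = c • mono a.1 a.2 := by
  simp [mono]

lemma mono_zero_zero : mono 0 0 = 1 := rfl

/-- To prove a property of all Laurent polynomials that is stable under linear combinations,
it suffices to check the monomials. -/
lemma laurent_induction {motive : Laurent → Prop} (f : Laurent)
    (mono : ∀ s t, motive (mono s t)) (add : ∀ f g, motive f → motive g → motive (f + g))
    (smul : ∀ (c : ℂ) f, motive f → motive (c • f)) : motive f := by
  induction f using AddMonoidAlgebra.induction_linear with
  | zero => simpa using smul 0 _ (mono 0 0)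
  | add f g hf hg => exact add f g hf hg
  | single a c => rw [single_eq_smul_mono]; exact smul _ _ (mono _ _)

/-- The linear form on the Laurent polynomials with prescribed values on the monomials. -/
def linForm (φ : ℤ → ℤ → ℂ) : Laurent →ₗ[ℂ] ℂ :=
  (AddMonoidAlgebra.basis (ℤ × ℤ) ℂ).constr ℂ fun a => φ a.1 a.2

@[simp] lemma linForm_mono (φ : ℤ → ℤ → ℂ) (s t : ℤ) : linForm φ (mono s t) = φ s t :=
  (AddMonoidAlgebra.basis (ℤ × ℤ) ℂ).constr_basis ℂ (fun a => φ a.1 a.2) (s, t)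

lemma mono_mul_mono_mul (s t u v : ℤ) (f : Laurent) :
    mono s t * (mono u v * f) = mono (s + u) (t + v) * f := by
  rw [← mul_assoc, mono_mul_mono]

lemma refl_refl (f : Laurent) : refl (refl f) = f := by
  induction f using laurent_induction with
  | mono s t => simp [refl_mono]
  | add f g hf hg => rw [map_add, map_add, hf, hg]
  | smul c f hf => rw [refl_smul, refl_smul, hf, Complex.conj_conj]

/-- The value of a Laurent polynomial at a point `(z, w)` (meaningful for `z, w ≠ 0`, or as far as
no negative powers of the vanishing variable occur). -/
def eval (z w : ℂ) : Laurent →ₗ[ℂ] ℂ := linForm fun s t => z ^ s * w ^ t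

@[simp] lemma eval_mono (z w : ℂ) (s t : ℤ) : eval z w (mono s t) = z ^ s * w ^ t :=
  linForm_mono _ s t

lemma eval_mul {z w : ℂ} (hz : z ≠ 0) (hw : w ≠ 0) (f g : Laurent) :
    eval z w (f * g) = eval z w f * eval z w g := by
  induction f using laurent_induction with
  | mono s t =>
    induction g using laurent_induction with
    | mono u v => rw [mono_mul_mono]; simp [zpow_add₀ hz, zpow_add₀ hw]; ring
    | add f g hf hg => rw [mul_add, map_add, map_add, hf, hg, mul_add]
    | smul c f hf => rw [mul_smul_comm, map_smul, map_smul, hf, smul_eq_mul, smul_eq_mul]; ring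
  | add f g hf hg => rw [add_mul, map_add, map_add, hf, hg, add_mul]
  | smul c f hf => rw [smul_mul_assoc, map_smul, map_smul, hf, smul_eq_mul, smul_eq_mul]; ring

lemma conj_zpow_of_norm_eq_one {z : ℂ} (hz : ‖z‖ = 1) (s : ℤ) : conj (z ^ s) = z ^ (-s) := by
  rw [map_zpow₀, ← Complex.inv_eq_conj hz, inv_zpow, zpow_neg]

lemma eval_refl {z w : ℂ} (hz : ‖z‖ = 1) (hw : ‖w‖ = 1) (f : Laurent) :
    eval z w (refl f) = conj (eval z w f) := by
  induction f using laurent_induction with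
  | mono s t =>
    rw [refl_mono, eval_mono, eval_mono, map_mul, conj_zpow_of_norm_eq_one hz,
      conj_zpow_of_norm_eq_one hw]
  | add f g hf hg => rw [map_add, map_add, map_add, hf, hg, map_add]
  | smul c f hf => rw [refl_smul, map_smul, map_smul, hf, smul_eq_mul, smul_eq_mul, map_mul]

/-- The coefficient of `w ^ u` in `f(z, w)`, for a fixed value of `z`. -/
def fiberCoeff (z : ℂ) (u : ℤ) : Laurent →ₗ[ℂ] ℂ := linForm fun s t => if t = u then z ^ s else 0

@[simp] lemma fiberCoeff_mono (z : ℂ) (u s t : ℤ) :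
    fiberCoeff z u (mono s t) = if t = u then z ^ s else 0 :=
  linForm_mono _ s t

lemma fiberCoeff_mono_mul {z : ℂ} (hz : z ≠ 0) (u s t : ℤ) (f : Laurent) :
    fiberCoeff z u (mono s t * f) = z ^ s * fiberCoeff z (u - t) f := by
  induction f using laurent_induction with
  | mono a b =>
    rw [mono_mul_mono, fiberCoeff_mono, fiberCoeff_mono, zpow_add₀ hz]
    split_ifs <;> first | omega | simp
  | add f g hf hg => rw [mul_add, map_add, map_add, hf, hg, mul_add]
  | smul c f hf => rw [mul_smul_comm, map_smul, map_smul, hf, smul_eq_mul, smul_eq_mul]; ring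

lemma fiberCoeff_refl {z : ℂ} (hz : ‖z‖ = 1) (u : ℤ) (f : Laurent) :
    fiberCoeff z u (refl f) = conj (fiberCoeff z (-u) f) := by
  induction f using laurent_induction with
  | mono s t =>
    rw [refl_mono, fiberCoeff_mono, fiberCoeff_mono]
    split_ifs <;> first | omega | simp [conj_zpow_of_norm_eq_one hz]
  | add f g hf hg => rw [map_add, map_add, map_add, hf, hg, map_add]
  | smul c f hf => rw [refl_smul, map_smul, map_smul, hf, smul_eq_mul, smul_eq_mul, map_mul]

/-! ### The spaces of polynomials -/

lemma mono_mem_polySpace {j k s t : ℤ} (hs : 0 ≤ s ∧ s ≤ j) (ht : 0 ≤ t ∧ t ≤ k) :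
    mono s t ∈ polySpace j k :=
  Submodule.subset_span ⟨s, t, hs, ht, rfl⟩

/-- The Laurent polynomials with exponents in the rectangle `[a, b] × [c, d]`. -/
def box (a b c d : ℤ) : Submodule ℂ Laurent :=
  AddMonoidAlgebra.supported ℂ ℂ (Set.Icc a b ×ˢ Set.Icc c d)

lemma mem_box_iff {a b c d : ℤ} {f : Laurent} :
    f ∈ box a b c d ↔ ∀ s t, f.coeff (s, t) ≠ 0 → (a ≤ s ∧ s ≤ b) ∧ (c ≤ t ∧ t ≤ d) := by
  rw [box, AddMonoidAlgebra.mem_supported]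
  constructor
  · intro h s t hst
    exact h (Finsupp.mem_support_iff.2 hst)
  · rintro h ⟨s, t⟩ hst
    exact h s t (Finsupp.mem_support_iff.1 hst)

lemma polySpace_eq_box (j k : ℤ) : polySpace j k = box 0 j 0 k := by
  rw [box, AddMonoidAlgebra.supported_eq_span_single, polySpace]
  congr 1
  ext f
  simp only [Set.mem_ofPred_eq, Set.mem_image, Set.mem_prod, Set.mem_Icc, Prod.exists]
  constructor
  · rintro ⟨s, t, hs, ht, rfl⟩
    exact ⟨s, t, ⟨hs, ht⟩, rfl⟩
  · rintro ⟨s, t, ⟨hs, ht⟩, rfl⟩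
    exact ⟨s, t, hs, ht, rfl⟩

lemma mem_polySpace_iff {j k : ℤ} {f : Laurent} :
    f ∈ polySpace j k ↔
      ∀ s t, f.coeff (s, t) ≠ 0 → (0 ≤ s ∧ s ≤ j) ∧ (0 ≤ t ∧ t ≤ k) := by
  rw [polySpace_eq_box, mem_box_iff]

lemma finrank_box (a b c d : ℤ) :
    Module.finrank ℂ (box a b c d) = (b + 1 - a).toNat * (d + 1 - c).toNat := by
  rw [box, (AddMonoidAlgebra.supportedEquivFinsupp (R := ℂ) (S := ℂ) _).finrank_eq,
    Module.finrank_finsupp_self]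
  rw [← Nat.card_eq_fintype_card, Nat.card_coe_set_eq, Set.ncard_prod]
  simp [Set.ncard_eq_toFinset_card']

lemma box_mono {a b c d a' b' c' d' : ℤ} (ha : a' ≤ a) (hb : b ≤ b') (hc : c' ≤ c)
    (hd : d ≤ d') : box a b c d ≤ box a' b' c' d' := by
  intro f hf
  rw [mem_box_iff] at hf ⊢
  intro s t hst
  have := hf s t hst
  omega

lemma mono_mem_box {a b c d s t : ℤ} (hs : a ≤ s ∧ s ≤ b) (ht : c ≤ t ∧ t ≤ d) :
    mono s t ∈ box a b c d := by
  rw [mem_box_iff]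
  intro s' t' h
  rw [mono, AddMonoidAlgebra.coeff_single, Finsupp.single_apply] at h
  simp only [Prod.mk.injEq, ne_eq, ite_eq_right_iff, one_ne_zero, imp_false, not_not] at h
  omega

lemma coeff_mono_mul (s t a b : ℤ) (f : Laurent) :
    (mono s t * f).coeff (a, b) = f.coeff (a - s, b - t) := by
  rw [mono, AddMonoidAlgebra.coeff_single_mul_apply]
  simp [neg_add_eq_sub]

lemma mono_mul_mem_box_iff {s t a b c d : ℤ} {f : Laurent} :
    mono s t * f ∈ box a b c d ↔ f ∈ box (a - s) (b - s) (c - t) (d - t) := by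
  simp only [mem_box_iff, coeff_mono_mul]
  constructor
  · intro h u v huv
    have := h (u + s) (v + t) (by simpa using huv)
    omega
  · intro h u v huv
    have := h (u - s) (v - t) huv
    omega

lemma mono_mul_cancel (s t : ℤ) (f : Laurent) : mono (-s) (-t) * (mono s t * f) = f := by
  rw [mono_mul_mono_mul, neg_add_cancel, neg_add_cancel, mono_zero_zero, one_mul]

lemma mono_mul_cancel' (s t : ℤ) (f : Laurent) : mono s t * (mono (-s) (-t) * f) = f := by
  simpa using mono_mul_cancel (-s) (-t) f


/-! ### Averages over the unit circle -/

/-- The average of a function over the unit circle. -/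
abbrev avg (f : ℂ → ℂ) : ℂ := Real.circleAverage f 0 1

lemma avg_congr {f g : ℂ → ℂ} (h : ∀ w, ‖w‖ = 1 → f w = g w) : avg f = avg g :=
  Real.circleAverage_congr_sphere fun w hw => h w (by simpa using hw)

/-- Continuity on the unit circle. -/
abbrev CircleContinuous (f : ℂ → ℂ) : Prop := ContinuousOn f (Metric.sphere 0 1)

lemma CircleContinuous.integrable {f : ℂ → ℂ} (hf : CircleContinuous f) :
    CircleIntegrable f 0 1 :=
  ContinuousOn.circleIntegrable zero_le_one hf

lemma circleContinuous_zpow (k : ℤ) : CircleContinuous fun w => w ^ k :=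
  ContinuousOn.zpow₀ continuousOn_id k fun w hw => Or.inl fun h : w = 0 => by simp [h] at hw

lemma avg_add {f g : ℂ → ℂ} (hf : CircleContinuous f) (hg : CircleContinuous g) :
    avg (fun w => f w + g w) = avg f + avg g :=
  Real.circleAverage_fun_add hf.integrable hg.integrable

lemma avg_sub {f g : ℂ → ℂ} (hf : CircleContinuous f) (hg : CircleContinuous g) :
    avg (fun w => f w - g w) = avg f - avg g :=
  Real.circleAverage_fun_sub hf.integrable hg.integrable

lemma avg_const_mul (c : ℂ) (f : ℂ → ℂ) : avg (fun w => c * f w) = c * avg f :=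
  Real.circleAverage_fun_smul (a := c)

lemma avg_sum {ι : Type*} {s : Finset ι} {f : ι → ℂ → ℂ}
    (h : ∀ i ∈ s, CircleContinuous (f i)) :
    avg (fun w => ∑ i ∈ s, f i w) = ∑ i ∈ s, avg (f i) :=
  Real.circleAverage_fun_sum fun i hi => (h i hi).integrable

lemma avg_conj {f : ℂ → ℂ} (hf : CircleContinuous f) :
    avg (fun w => conj (f w)) = conj (avg f) :=
  (Complex.conjCLE.toContinuousLinearMap).circleAverage_comp_comm hf.integrable

lemma re_avg {f : ℂ → ℂ} (hf : CircleContinuous f) :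
    (avg f).re = Real.circleAverage (fun w => (f w).re) 0 1 :=
  (Complex.reCLM.circleAverage_comp_comm hf.integrable).symm

lemma re_avg_nonneg {f : ℂ → ℂ} (hf : CircleContinuous f)
    (h : ∀ w, ‖w‖ = 1 → 0 ≤ (f w).re) : 0 ≤ (avg f).re := by
  rw [re_avg hf]
  exact Real.circleAverage_nonneg_of_nonneg fun w hw => h w (by simpa using hw)

/-- The mean value property, for `w ^ r / q` with `q` zero-free on the closed disc. -/
lemma avg_zpow_div_eq_zero {q : ℂ → ℂ} (hq : Differentiable ℂ q)
    (hq0 : ∀ w, ‖w‖ ≤ 1 → q w ≠ 0) {r : ℤ} (hr : 1 ≤ r) : avg (fun w => w ^ r / q w) = 0 := by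
  obtain ⟨k, rfl⟩ : ∃ k : ℕ, r = (k + 1 : ℕ) := ⟨(r - 1).toNat, by omega⟩
  simp only [zpow_natCast]
  have h : DiffContOnCl ℂ (fun w => w ^ (k + 1) / q w) (Metric.ball 0 |1|) := by
    refine DifferentiableOn.diffContOnCl ?_
    rw [abs_one, closure_ball _ one_ne_zero]
    intro w hw
    refine ((differentiableAt_pow (k + 1)).div (hq w) (hq0 w ?_)).differentiableWithinAt
    simpa using hw
  rw [avg, h.circleAverage]
  simp

lemma avg_zpow (k : ℤ) : avg (fun w => w ^ k) = if k = 0 then 1 else 0 := by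
  have pos : ∀ r : ℤ, 1 ≤ r → avg (fun w => w ^ r) = 0 := fun r hr => by
    have := avg_zpow_div_eq_zero (q := fun _ => 1) (differentiable_const _)
      (fun _ _ => one_ne_zero) hr
    simpa using this
  rcases lt_trichotomy k 0 with hk | rfl | hk
  · rw [if_neg hk.ne, avg_congr (g := fun w => conj (w ^ (-k)))
      (fun w hw => by rw [conj_zpow_of_norm_eq_one hw, neg_neg]),
      avg_conj (circleContinuous_zpow _), pos _ (by omega), map_zero]
  · simpa using Real.circleAverage_const (1 : ℂ) 0 1
  · rw [if_neg hk.ne', pos _ (by omega)]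

/-! ### The inverse of the Toeplitz matrix of a Bernstein–Szegő weight -/

/-- The `k`-th moment of the weight `1 / |q| ^ 2` on the unit circle. -/
def fiberMoment (q : ℂ → ℂ) (k : ℤ) : ℂ := avg fun w => w ^ k / (‖q w‖ : ℂ) ^ 2

lemma ofReal_norm_sq (c : ℂ) : (‖c‖ : ℂ) ^ 2 = c * conj c := (Complex.mul_conj' c).symm

section GohbergSemencul

variable {M : ℕ} {c : ℤ → ℂ} {q : ℂ → ℂ}

/-- The reversed polynomial of `q = ∑ c j * w ^ j` is `w ^ M * conj q` on the unit circle. -/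
lemma sum_conj_reverse (hq : ∀ w, q w = ∑ j ∈ Finset.range (M + 1), c j * w ^ j) {w : ℂ}
    (hw : ‖w‖ = 1) :
    ∑ u ∈ Finset.range (M + 1), conj (c (M - u)) * w ^ u = w ^ M * conj (q w) := by
  rw [hq, map_sum, Finset.mul_sum, ← Finset.sum_range_reflect]
  refine Finset.sum_congr rfl fun u hu => ?_
  have hu' : u ≤ M := Nat.lt_succ_iff.1 (Finset.mem_range.1 hu)
  have hw0 : w ≠ 0 := norm_ne_zero_iff.1 (by simp [hw])
  have h1 : M + 1 - 1 - u = M - u := by omega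
  have h2 : conj (w ^ u) = (w ^ u)⁻¹ := by
    rw [← Complex.inv_eq_conj (by simp [hw])]
  rw [map_mul, h1, h2, pow_sub₀ w hw0 hu', Nat.cast_sub hu']
  ring_nf

variable (hq : ∀ w, q w = ∑ j ∈ Finset.range (M + 1), c j * w ^ j)
  (hq0 : ∀ w, ‖w‖ ≤ 1 → q w ≠ 0)
  {κ : ℤ → ℤ → ℂ}
  (hκM : ∀ k, κ M k = 0) (hκneg : ∀ k, κ (-1) k = 0) (hκneg' : ∀ u, κ u (-1) = 0)
  (hκ : ∀ u k : ℤ, 0 ≤ u → u ≤ M → 0 ≤ k → k < M →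
    κ u k = κ (u - 1) (k - 1) + c u * conj (c k) - conj (c (M - u)) * c (M - k))

include hq hκM hκneg hκ in
/-- The recurrence for the coefficients `κ` of the Christoffel–Darboux kernel, in terms of
generating functions. -/
lemma kernel_generating {k : ℤ} (hk : 0 ≤ k) (hkM : k < M) {w : ℂ} (hw : ‖w‖ = 1) :
    ∑ u ∈ Finset.range M, κ u k * w ^ u =
      w * ∑ u ∈ Finset.range M, κ u (k - 1) * w ^ u + q w * conj (c k) -
        w ^ M * conj (q w) * c (M - k) := by
  have h1 : ∑ u ∈ Finset.range M, κ u k * w ^ u = ∑ u ∈ Finset.range (M + 1), κ u k * w ^ u := by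
    rw [Finset.sum_range_succ, hκM, zero_mul, add_zero]
  have h2 : w * ∑ u ∈ Finset.range M, κ u (k - 1) * w ^ u =
      ∑ u ∈ Finset.range (M + 1), κ (u - 1) (k - 1) * w ^ u := by
    rw [Finset.sum_range_succ', Finset.mul_sum]
    simp only [Nat.cast_zero, zero_sub, hκneg, zero_mul, add_zero]
    refine Finset.sum_congr rfl fun u _ => ?_
    push_cast
    rw [add_sub_cancel_right, pow_succ]
    ring
  rw [h1, h2, ← sum_conj_reverse hq hw, hq, Finset.sum_mul, Finset.sum_mul,
    ← Finset.sum_add_distrib, ← Finset.sum_sub_distrib]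
  refine Finset.sum_congr rfl fun u hu => ?_
  rw [hκ u k (by omega) (by have := Finset.mem_range.1 hu; omega) hk hkM]
  ring

include hq in
lemma differentiable_of_eq_sum : Differentiable ℂ q := by
  have : q = fun w => ∑ j ∈ Finset.range (M + 1), c j * w ^ j := funext hq
  rw [this]
  fun_prop

include hq hq0 hκM hκneg hκneg' hκ in
/-- **Gohberg–Semencul formula.** If `q` is a polynomial of degree at most `M` without zeros on the
closed disc, then the coefficients `κ` of the Christoffel–Darboux kernel
`(q(w) conj q(η) - q^♯(w) conj q^♯(η)) / (1 - w conj η)`, where `q^♯ = w ^ M * conj q(1 / conj w)`,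
form the inverse of the Toeplitz matrix of the weight `1 / |q| ^ 2`. The kernel enters only through
its recurrence and its boundary values. -/
theorem sum_fiberMoment_mul_kernel {t k : ℕ} (ht : t < M) (hk : k < M) :
    ∑ u ∈ Finset.range M, fiberMoment q (t - u) * conj (κ u k) = if t = k then 1 else 0 := by
  have hd : Differentiable ℂ q := differentiable_of_eq_sum hq
  have hqc : CircleContinuous q := hd.continuous.continuousOn
  have hqs : ∀ w ∈ Metric.sphere (0 : ℂ) 1, q w ≠ 0 := fun w hw => hq0 w (by simp_all)
  have hqs' : ∀ w : ℂ, ‖w‖ = 1 → q w ≠ 0 := fun w hw => hq0 w hw.le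
  have hz : ∀ w : ℂ, ‖w‖ = 1 → w ≠ 0 := fun w hw => norm_ne_zero_iff.1 (by simp [hw])
  have hnc : CircleContinuous fun w => (‖q w‖ : ℂ) ^ 2 :=
    (Complex.continuous_ofReal.comp_continuousOn hqc.norm).pow 2
  have hns : ∀ w ∈ Metric.sphere (0 : ℂ) 1, (‖q w‖ : ℂ) ^ 2 ≠ 0 := fun w hw => by
    simpa using hqs w hw
  set a : ℤ → ℂ := fun r => avg fun w => w ^ r / q w with ha
  have hac : ∀ r : ℤ, CircleContinuous fun w => w ^ r / q w := fun r =>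
    (circleContinuous_zpow r).div hqc hqs
  have ha0 : ∀ r : ℤ, 1 ≤ r → a r = 0 := fun r hr => avg_zpow_div_eq_zero hd hq0 hr
  set K : ℤ → ℂ → ℂ := fun k w => ∑ u ∈ Finset.range M, κ u k * w ^ u with hK
  have hKc : ∀ k, CircleContinuous (K k) := fun k => by
    refine Continuous.continuousOn ?_
    simp only [hK]
    fun_prop
  set I : ℤ → ℤ → ℂ := fun t k => avg fun w => w ^ t * conj (K k w) / (‖q w‖ : ℂ) ^ 2 with hI
  have hIc : ∀ t k : ℤ, CircleContinuous fun w => w ^ t * conj (K k w) / (‖q w‖ : ℂ) ^ 2 :=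
    fun t k => ((circleContinuous_zpow t).mul
      (Complex.continuous_conj.comp_continuousOn (hKc k))).div hnc hns
  -- one step of the recurrence, integrated against the weight
  have hstep : ∀ t k : ℤ, t < M → 0 ≤ k → k < M → I t k = I (t - 1) (k - 1) + c k * a t := by
    intro t k ht hk hkM
    have e : I t k = avg fun w => (w ^ (t - 1) * conj (K (k - 1) w) / (‖q w‖ : ℂ) ^ 2 +
        c k * (w ^ t / q w)) - conj (c (M - k)) * conj (w ^ (M - t) / q w) := by
      refine avg_congr fun w hw => ?_
      have hw0 := hz w hw
      have hqw := hqs' w hw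
      have hqw' : conj (q w) ≠ 0 := by simpa using hqw
      simp only [hK]
      rw [kernel_generating hq hκM hκneg hκ hk hkM hw, ofReal_norm_sq]
      have e1 : conj w = w⁻¹ := (Complex.inv_eq_conj hw).symm
      have e2 : conj (w ^ ((M : ℤ) - t)) = w ^ t * (w ^ M)⁻¹ := by
        rw [conj_zpow_of_norm_eq_one hw, neg_sub, zpow_sub₀ hw0, zpow_natCast, div_eq_mul_inv]
      have e3 : w ^ (t - 1) = w ^ t * w⁻¹ := by rw [zpow_sub₀ hw0, zpow_one, div_eq_mul_inv]
      rw [map_div₀, e2, e3]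
      simp only [map_sub, map_add, map_mul, map_pow, Complex.conj_conj, e1, inv_pow]
      field_simp
    have h1 := hIc (t - 1) (k - 1)
    have h2 : CircleContinuous fun w => c k * (w ^ t / q w) := continuousOn_const.mul (hac t)
    have h3 : CircleContinuous fun w => conj (w ^ ((M : ℤ) - t) / q w) :=
      Complex.continuous_conj.comp_continuousOn (hac _)
    have h4 : CircleContinuous fun w => w ^ (t - 1) * conj (K (k - 1) w) / (‖q w‖ : ℂ) ^ 2 +
        c k * (w ^ t / q w) := h1.add h2
    have h5 : CircleContinuous fun w => conj (c (M - k)) * conj (w ^ ((M : ℤ) - t) / q w) :=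
      continuousOn_const.mul h3
    rw [e, avg_sub h4 h5, avg_add h1 h2, avg_const_mul, avg_const_mul, avg_conj (hac _)]
    have h0 := ha0 (M - t) (by omega)
    simp only [ha] at h0
    rw [h0]
    simp [hI, ha]
  -- the recurrence ends with `I _ (-1) = 0`
  have hIsum : ∀ k : ℕ, k ≤ M → ∀ t : ℤ, t < M →
      I t (k - 1) = ∑ j ∈ Finset.range k, c j * a (t - (k - 1) + j) := by
    intro k
    induction k with
    | zero =>
      intro _ t _
      simp [hI, hK, hκneg', Real.circleAverage_const]
    | succ k ih =>
      intro hk t ht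
      rw [Finset.sum_range_succ, hstep _ _ ht (by omega) (by omega)]
      have := ih (by omega) (t - 1) (by omega)
      push_cast
      rw [add_sub_cancel_right, this]
      congr 1
      · refine Finset.sum_congr rfl fun j _ => ?_
        congr 2
        ring
      · congr 2
        ring
  have hsum : ∑ u ∈ Finset.range M, fiberMoment q (t - u) * conj (κ u k) = I t k := by
    have e : I t k = avg fun w => ∑ u ∈ Finset.range M,
        conj (κ u k) * (w ^ ((t : ℤ) - u) / (‖q w‖ : ℂ) ^ 2) := by
      refine avg_congr fun w hw => ?_
      simp only [hK, map_sum, Finset.mul_sum, Finset.sum_div]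
      refine Finset.sum_congr rfl fun u _ => ?_
      rw [map_mul, map_pow, ← Complex.inv_eq_conj hw, zpow_sub₀ (hz w hw), zpow_natCast,
        zpow_natCast]
      ring
    have hc : ∀ u ∈ Finset.range M, CircleContinuous fun w =>
        conj (κ u k) * (w ^ ((t : ℤ) - u) / (‖q w‖ : ℂ) ^ 2) := fun u _ =>
      continuousOn_const.mul ((circleContinuous_zpow _).div hnc hns)
    rw [e, avg_sum hc]
    refine Finset.sum_congr rfl fun u _ => ?_
    rw [avg_const_mul, fiberMoment, mul_comm]
  have h := hIsum (k + 1) (by omega) t (by omega)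
  push_cast at h
  rw [add_sub_cancel_right] at h
  rw [hsum, h]
  -- the additional terms vanish, and the sum over all coefficients of `q` cancels the denominator
  have hext : ∑ j ∈ Finset.range (k + 1), c j * a ((t : ℤ) - k + j) =
      ∑ j ∈ Finset.range (M + 1), c j * a ((t : ℤ) - k + j) := by
    refine Finset.sum_subset (Finset.range_mono (by omega)) fun j _ hj => ?_
    rw [ha0, mul_zero]
    have := Finset.mem_range.not.1 hj
    omega
  rw [hext]
  have e : ∑ j ∈ Finset.range (M + 1), c j * a ((t : ℤ) - k + j) =
      avg fun w => w ^ ((t : ℤ) - k) := by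
    have hc : ∀ j ∈ Finset.range (M + 1), CircleContinuous fun w =>
        c j * (w ^ ((t : ℤ) - k + j) / q w) := fun j _ => continuousOn_const.mul (hac _)
    simp only [ha]
    rw [← Finset.sum_congr rfl fun (j : ℕ) _ => avg_const_mul (c j) _, ← avg_sum hc]
    refine avg_congr fun w hw => ?_
    have hqw := hqs' w hw
    rw [eq_comm, ← mul_div_cancel_right₀ (w ^ ((t : ℤ) - k)) hqw]
    nth_rw 1 [hq w]
    rw [Finset.mul_sum, Finset.sum_div]
    refine Finset.sum_congr rfl fun j _ => ?_
    rw [zpow_add₀ (hz w hw), zpow_natCast]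
    ring
  rw [e, avg_zpow]
  simp [sub_eq_zero]

end GohbergSemencul


/-- The **Riemann–Lebesgue lemma** on the unit circle. -/
lemma tendsto_avg_zpow_mul (g : ℂ → ℂ) :
    Filter.Tendsto (fun j : ℤ => avg fun z => z ^ j * g z) Filter.cofinite (nhds 0) := by
  have h := Real.tendsto_integral_exp_smul_cocompact
    (Set.indicator (Set.Ioc 0 (2 * Real.pi)) fun θ : ℝ => g (circleMap 0 1 θ))
  have hc : Filter.Tendsto (fun j : ℤ => -((2 * Real.pi)⁻¹ * (j : ℝ))) Filter.cofinite
      (Filter.cocompact ℝ) := by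
    have h1 : Filter.Tendsto (fun j : ℤ => (j : ℝ)) Filter.cofinite (Filter.cocompact ℝ) :=
      Int.tendsto_coe_cofinite
    have h2 : (2 * Real.pi)⁻¹ ≠ 0 := inv_ne_zero Real.two_pi_pos.ne'
    exact ((Homeomorph.neg ℝ).isClosedEmbedding.tendsto_cocompact).comp
      (((Homeomorph.mulLeft₀ _ h2).isClosedEmbedding.tendsto_cocompact).comp h1)
  have h2 := (h.comp hc).const_smul ((2 * Real.pi)⁻¹ : ℝ)
  rw [smul_zero] at h2
  refine h2.congr fun j => ?_
  rw [avg, Real.circleAverage, intervalIntegral.integral_of_le Real.two_pi_pos.le,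
    ← MeasureTheory.integral_indicator measurableSet_Ioc]
  congr 1
  refine MeasureTheory.integral_congr_ae (Filter.Eventually.of_forall fun θ => ?_)
  simp only [Set.indicator_apply]
  split_ifs with hθ
  · rw [Circle.smul_def, Real.fourierChar_apply, smul_eq_mul]
    congr 1
    rw [circleMap_zero, Complex.ofReal_one, one_mul, ← Complex.exp_int_mul]
    congr 1
    push_cast
    have : (Real.pi : ℂ) ≠ 0 := Complex.ofReal_ne_zero.2 Real.pi_ne_zero
    field_simp
  · simp

/-! ### Averages over the torus -/

/-- Continuity on the torus `𝕋²`. -/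
abbrev TorusContinuous (G : ℂ → ℂ → ℂ) : Prop :=
  ContinuousOn (Function.uncurry G) (Metric.sphere 0 1 ×ˢ Metric.sphere 0 1)

/-- The average of a function over the torus `𝕋²`. -/
def torusAvg (G : ℂ → ℂ → ℂ) : ℂ := avg fun z => avg (G z)

lemma TorusContinuous.fiber {G : ℂ → ℂ → ℂ} (hG : TorusContinuous G) {z : ℂ} (hz : ‖z‖ = 1) :
    CircleContinuous (G z) :=
  hG.comp (f := fun w => (z, w)) (by fun_prop) fun w hw => ⟨by simpa using hz, hw⟩

lemma TorusContinuous.avg {G : ℂ → ℂ → ℂ} (hG : TorusContinuous G) :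
    CircleContinuous fun z => avg (G z) := by
  rw [CircleContinuous, continuousOn_iff_continuous_domRestrict]
  refine (intervalIntegral.continuous_parametric_intervalIntegral_of_continuous' ?_ _ _).const_smul
    ((2 * Real.pi)⁻¹ : ℝ)
  refine hG.comp_continuous
    (f := fun x : Metric.sphere (0 : ℂ) 1 × ℝ => ((x.1 : ℂ), circleMap 0 1 x.2)) (by fun_prop) ?_
  rintro ⟨z, φ⟩
  exact ⟨z.2, circleMap_mem_sphere _ zero_le_one _⟩

lemma torusAvg_congr {G G' : ℂ → ℂ → ℂ} (h : ∀ z w, ‖z‖ = 1 → ‖w‖ = 1 → G z w = G' z w) :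
    torusAvg G = torusAvg G' :=
  avg_congr fun z hz => avg_congr fun w hw => h z w hz hw

lemma torusAvg_add {G G' : ℂ → ℂ → ℂ} (hG : TorusContinuous G) (hG' : TorusContinuous G') :
    torusAvg (fun z w => G z w + G' z w) = torusAvg G + torusAvg G' := by
  rw [torusAvg, torusAvg, torusAvg, ← avg_add hG.avg hG'.avg]
  exact avg_congr fun z hz => avg_add (hG.fiber hz) (hG'.fiber hz)

lemma torusAvg_const_mul (c : ℂ) (G : ℂ → ℂ → ℂ) :
    torusAvg (fun z w => c * G z w) = c * torusAvg G := by
  rw [torusAvg, torusAvg, ← avg_const_mul]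
  exact avg_congr fun z _ => avg_const_mul c _

lemma torusAvg_conj {G : ℂ → ℂ → ℂ} (hG : TorusContinuous G) :
    torusAvg (fun z w => conj (G z w)) = conj (torusAvg G) := by
  rw [torusAvg, torusAvg, ← avg_conj hG.avg]
  exact avg_congr fun z hz => avg_conj (hG.fiber hz)

lemma re_torusAvg_nonneg {G : ℂ → ℂ → ℂ} (hG : TorusContinuous G)
    (h : ∀ z w, ‖z‖ = 1 → ‖w‖ = 1 → 0 ≤ (G z w).re) : 0 ≤ (torusAvg G).re :=
  re_avg_nonneg hG.avg fun z hz => re_avg_nonneg (hG.fiber hz) fun w hw => h z w hz hw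

lemma torusContinuous_eval (f : Laurent) : TorusContinuous fun z w => eval z w f := by
  induction f using laurent_induction with
  | mono s t =>
    simp only [eval_mono]
    refine ContinuousOn.mul ?_ ?_
    · exact (circleContinuous_zpow s).comp continuousOn_fst fun x hx => hx.1
    · exact (circleContinuous_zpow t).comp continuousOn_snd fun x hx => hx.2
  | add f g hf hg => simp only [map_add]; exact hf.add hg
  | smul c f hf => simp only [map_smul]; exact hf.const_smul c

/-! ### Bernstein–Szegő weights -/

/-- The moments of the weight `1 / |p| ^ 2` on the torus, for a Laurent polynomial `p`. -/
def weightMoment (p : Laurent) (j k : ℤ) : ℂ :=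
  torusAvg fun z w => z ^ j * w ^ k / (‖eval z w p‖ : ℂ) ^ 2

/-- The linear form `f ↦ ∫ f / |p| ^ 2` (normalized Lebesgue measure on the torus). -/
def weightForm (p : Laurent) : Laurent →ₗ[ℂ] ℂ := linForm (weightMoment p)

lemma weightForm_mono (p : Laurent) (j k : ℤ) : weightForm p (mono j k) = weightMoment p j k :=
  linForm_mono _ _ _

lemma weightMoment_eq_avg (p : Laurent) (j k : ℤ) :
    weightMoment p j k = avg fun z => z ^ j * fiberMoment (fun w => eval z w p) k := by
  rw [weightMoment, torusAvg]
  refine avg_congr fun z _ => ?_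
  rw [fiberMoment, ← avg_const_mul]
  exact avg_congr fun w _ => by ring

lemma tendsto_weightMoment (p : Laurent) (k : ℤ) :
    Filter.Tendsto (fun j : ℤ => weightMoment p j k) Filter.cofinite (nhds 0) := by
  simp only [weightMoment_eq_avg]
  exact tendsto_avg_zpow_mul _

section Weight

variable {p : Laurent} (hp : ∀ z w, ‖z‖ = 1 → ‖w‖ = 1 → eval z w p ≠ 0)

include hp in
lemma torusContinuous_div (f : Laurent) :
    TorusContinuous fun z w => eval z w f / (‖eval z w p‖ : ℂ) ^ 2 := by
  refine (torusContinuous_eval f).div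
    ((Complex.continuous_ofReal.comp_continuousOn (torusContinuous_eval p).norm).pow 2) ?_
  rintro ⟨z, w⟩ ⟨hz, hw⟩
  simpa using hp z w (by simpa using hz) (by simpa using hw)

include hp in
lemma weightForm_eq (f : Laurent) :
    weightForm p f = torusAvg fun z w => eval z w f / (‖eval z w p‖ : ℂ) ^ 2 := by
  induction f using laurent_induction with
  | mono s t => simp only [weightForm_mono, weightMoment, eval_mono]
  | add f g hf hg =>
    rw [map_add, hf, hg, ← torusAvg_add (torusContinuous_div hp f) (torusContinuous_div hp g)]
    simp only [map_add, add_div]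
  | smul c f hf =>
    rw [map_smul, hf, smul_eq_mul, ← torusAvg_const_mul]
    simp only [map_smul, smul_eq_mul, mul_div_assoc]

include hp in
lemma weightForm_refl (f : Laurent) : weightForm p (refl f) = conj (weightForm p f) := by
  rw [weightForm_eq hp, weightForm_eq hp, ← torusAvg_conj (torusContinuous_div hp f)]
  refine torusAvg_congr fun z w hz hw => ?_
  rw [eval_refl hz hw, map_div₀, map_pow, Complex.conj_ofReal]

include hp in
lemma re_weightForm_nonneg (f : Laurent) : 0 ≤ (weightForm p (f * refl f)).re := by
  rw [weightForm_eq hp]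
  refine re_torusAvg_nonneg (torusContinuous_div hp _) fun z w hz hw => ?_
  rw [eval_mul (norm_ne_zero_iff.1 (by simp [hz])) (norm_ne_zero_iff.1 (by simp [hw])),
    eval_refl hz hw, Complex.mul_conj']
  rw [← Complex.ofReal_pow, ← Complex.ofReal_pow, ← Complex.ofReal_div, Complex.ofReal_re]
  positivity

include hp in
/-- The Cauchy–Schwarz inequality for the form `⟨f, g⟩ = ∫ f ḡ / |p| ^ 2`. -/
lemma norm_weightForm_sq_le (f g : Laurent) :
    ‖weightForm p (f * refl g)‖ ^ 2 ≤
      (weightForm p (f * refl f)).re * (weightForm p (g * refl g)).re := by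
  let core : PreInnerProductSpace.Core ℂ Laurent :=
    { inner f g := weightForm p (g * refl f)
      conj_inner_symm f g := by
        rw [← weightForm_refl hp, map_mul, refl_refl, mul_comm]
      re_inner_nonneg f := re_weightForm_nonneg hp f
      add_left f g h := by rw [map_add, mul_add, map_add]
      smul_left f g c := by rw [refl_smul, mul_smul_comm, map_smul, smul_eq_mul] }
  have h := @InnerProductSpace.Core.inner_mul_inner_self_le ℂ Laurent _ _ _ core g f
  have e : weightForm p (g * refl f) = conj (weightForm p (f * refl g)) := by
    rw [← weightForm_refl hp, map_mul refl, refl_refl, mul_comm]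
  change ‖weightForm p (f * refl g)‖ * ‖weightForm p (g * refl f)‖ ≤
    (weightForm p (g * refl g)).re * (weightForm p (f * refl f)).re at h
  rw [e, RCLike.norm_conj] at h
  rw [sq, mul_comm (weightForm p (f * refl f)).re]
  exact h

end Weight

lemma map_mul_refl_eq_sum (φ : Laurent →ₗ[ℂ] ℂ) (f g : Laurent) :
    φ (f * refl g) = g.coeff.sum fun a c => conj c * φ (f * refl (mono a.1 a.2)) := by
  conv_lhs => rw [← AddMonoidAlgebra.sum_coeff_single g]
  rw [Finsupp.sum, Finsupp.sum, map_sum, Finset.mul_sum, map_sum]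
  refine Finset.sum_congr rfl fun a _ => ?_
  rw [single_eq_smul_mono, refl_smul, mul_smul_comm, map_smul, smul_eq_mul]

lemma tendsto_weightForm (p f : Laurent) (t : ℤ) :
    Filter.Tendsto (fun j : ℤ => weightForm p (f * refl (mono j t))) Filter.cofinite
      (nhds 0) := by
  induction f using laurent_induction with
  | mono a b =>
    simp only [refl_mono, mono_mul_mono, weightForm_mono]
    exact (tendsto_weightMoment p _).comp
      (Function.Injective.tendsto_cofinite fun i j h => by simpa using h)
  | add f g hf hg => simpa only [add_mul, map_add, add_zero] using hf.add hg
  | smul c f hf => simpa only [smul_mul_assoc, map_smul, smul_zero] using hf.const_smul c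


/-! ### The family dual to the monomials -/

/-- The coefficient of `w ^ u` of a Laurent polynomial, as a Laurent polynomial in `z`. -/
def wCoeff (u : ℤ) : Laurent →ₗ[ℂ] Laurent :=
  (AddMonoidAlgebra.basis (ℤ × ℤ) ℂ).constr ℂ fun a => if a.2 = u then mono a.1 0 else 0

lemma wCoeff_mono (u s t : ℤ) : wCoeff u (mono s t) = if t = u then mono s 0 else 0 :=
  (AddMonoidAlgebra.basis (ℤ × ℤ) ℂ).constr_basis ℂ
    (fun a => if a.2 = u then mono a.1 0 else 0) (s, t)

lemma eval_wCoeff (z w : ℂ) (u : ℤ) (f : Laurent) : eval z w (wCoeff u f) = fiberCoeff z u f := by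
  induction f using laurent_induction with
  | mono s t =>
    rw [wCoeff_mono, fiberCoeff_mono]
    split_ifs <;> simp
  | add f g hf hg => simp only [map_add, hf, hg]
  | smul c f hf => simp only [map_smul, hf]

lemma wCoeff_mem {j k u : ℤ} {f : Laurent} (hf : f ∈ polySpace j k) :
    wCoeff u f ∈ polySpace j 0 := by
  induction hf using Submodule.span_induction with
  | zero => simp
  | add x y _ _ hx hy => rw [map_add]; exact add_mem hx hy
  | smul c x _ hx => rw [map_smul]; exact Submodule.smul_mem _ _ hx
  | mem x hx =>
    obtain ⟨s, t, hs, ht, rfl⟩ := hx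
    rw [wCoeff_mono]
    split_ifs
    · exact mono_mem_polySpace hs (by omega)
    · exact zero_mem _

lemma fiberCoeff_eq_zero {j k u : ℤ} {f : Laurent} (hf : f ∈ polySpace j k)
    (hu : u < 0 ∨ k < u) (z : ℂ) : fiberCoeff z u f = 0 := by
  induction hf using Submodule.span_induction with
  | zero => simp
  | add x y _ _ hx hy => rw [map_add, hx, hy, add_zero]
  | smul c x _ hx => rw [map_smul, hx, smul_zero]
  | mem x hx =>
    obtain ⟨s, t, hs, ht, rfl⟩ := hx
    rw [fiberCoeff_mono, if_neg (by omega)]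

/-- For fixed `z`, a polynomial is the sum of its terms `fiberCoeff z u f * w ^ u`. -/
lemma eval_eq_sum_fiberCoeff {j : ℤ} {L : ℕ} {f : Laurent} (hf : f ∈ polySpace j (L - 1))
    (z w : ℂ) : eval z w f = ∑ u ∈ Finset.range L, fiberCoeff z u f * w ^ u := by
  induction hf using Submodule.span_induction with
  | zero => simp
  | add x y _ _ hx hy => simp only [map_add, add_mul, Finset.sum_add_distrib, hx, hy]
  | smul c x _ hx => simp only [map_smul, hx, Finset.mul_sum, smul_eq_mul, mul_assoc]
  | mem x hx =>
    obtain ⟨s, t, hs, ht, rfl⟩ := hx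
    obtain ⟨t, rfl⟩ := Int.eq_ofNat_of_zero_le ht.1
    simp [show t < L by omega]

lemma mem_laurentSpace_iff {j k : ℤ} {f : Laurent} :
    f ∈ laurentSpace j k ↔ ∀ s t, f.coeff (s, t) ≠ 0 → |s| ≤ j ∧ |t| ≤ k := by
  have : laurentSpace j k = AddMonoidAlgebra.supported ℂ ℂ {a : ℤ × ℤ | |a.1| ≤ j ∧ |a.2| ≤ k} := by
    rw [AddMonoidAlgebra.supported_eq_span_single, laurentSpace]
    congr 1
    ext f
    simp only [Set.mem_ofPred_eq, Set.mem_image, Prod.exists]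
    constructor
    · rintro ⟨s, t, hs, ht, rfl⟩
      exact ⟨s, t, ⟨hs, ht⟩, rfl⟩
    · rintro ⟨s, t, ⟨hs, ht⟩, rfl⟩
      exact ⟨s, t, hs, ht, rfl⟩
  rw [this, AddMonoidAlgebra.mem_supported]
  constructor
  · intro h s t hst
    exact h (Finsupp.mem_support_iff.2 hst)
  · rintro h ⟨s, t⟩ hst
    exact h s t (Finsupp.mem_support_iff.1 hst)

/-- For `p` of degree at most `M` in `w`, the Laurent polynomials
`g_k = ∑ u, κ_{u,k}(z) * w ^ u`, `k < M`, where `κ` are the coefficients of the Christoffel–Darboux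
kernel of `p(z, ·)`. They are biorthogonal to the monomials (`weightForm_mono_mul_dual`). -/
def dualFamily (p : Laurent) (M k : ℕ) : Laurent :=
  ∑ u ∈ Finset.range M, mono 0 u * ∑ s ∈ Finset.range (k + 1),
    (wCoeff (u - s) p * refl (wCoeff (k - s) p) -
      wCoeff (M - k + s) p * refl (wCoeff (M - u + s) p))

lemma dualFamily_coeff_ne_zero {n M k : ℕ} {p : Laurent} (hp : p ∈ polySpace n M) {s u : ℤ}
    (h : (dualFamily p M k).coeff (s, u) ≠ 0) : |s| ≤ n ∧ 0 ≤ u ∧ u < M := by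
  rw [dualFamily, AddMonoidAlgebra.coeff_sum, Finsupp.finsetSum_apply] at h
  obtain ⟨v, hv, h⟩ := Finset.exists_ne_zero_of_sum_ne_zero h
  rw [coeff_mono_mul] at h
  have hm : ∑ s ∈ Finset.range (k + 1), (wCoeff (v - s) p * refl (wCoeff (k - s) p) -
      wCoeff (M - k + s) p * refl (wCoeff (M - v + s) p)) ∈ laurentSpace n 0 :=
    Submodule.sum_mem _ fun s _ => Submodule.sub_mem _
      (mul_refl_mem (wCoeff_mem hp) (wCoeff_mem hp)) (mul_refl_mem (wCoeff_mem hp) (wCoeff_mem hp))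
  obtain ⟨hs, hu⟩ := mem_laurentSpace_iff.1 hm _ _ h
  have hu := abs_le.1 hu
  have hv := Finset.mem_range.1 hv
  exact ⟨by simpa using hs, by omega, by omega⟩

section Dual

variable {n M : ℕ} {p : Laurent} (hpm : p ∈ polySpace n M)
  (hp : ∀ z w, ‖z‖ = 1 → ‖w‖ ≤ 1 → eval z w p ≠ 0)

include hpm in
lemma fiberCoeff_outside {u : ℤ} (hu : u < 0 ∨ M < u) (z : ℂ) : fiberCoeff z u p = 0 :=
  fiberCoeff_eq_zero hpm hu z

/-- The coefficients of the Christoffel–Darboux kernel of `p(z, ·)`, obtained by solving the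
recurrence `cdCoeff_recurrence` along the diagonals, and set to zero outside `0 ≤ u < M`. -/
def cdCoeff (p : Laurent) (M : ℕ) (z : ℂ) (u k : ℤ) : ℂ :=
  if 0 ≤ u ∧ u < M then
    ∑ s ∈ Finset.range (k + 1).toNat, (fiberCoeff z (u - s) p * conj (fiberCoeff z (k - s) p) -
      conj (fiberCoeff z (M - u + s) p) * fiberCoeff z (M - k + s) p)
  else 0

include hpm in
lemma cdCoeff_recurrence (z : ℂ) {u k : ℤ} (hu : 0 ≤ u) (huM : u ≤ M) (hk : 0 ≤ k) (hkM : k < M) :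
    cdCoeff p M z u k = cdCoeff p M z (u - 1) (k - 1) +
      fiberCoeff z u p * conj (fiberCoeff z k p) -
      conj (fiberCoeff z (M - u) p) * fiberCoeff z (M - k) p := by
  obtain ⟨k, rfl⟩ := Int.eq_ofNat_of_zero_le hk
  -- the sum without the cut-off in `u` satisfies the recurrence
  set S : ℤ → ℕ → ℂ := fun u k => ∑ s ∈ Finset.range k,
    (fiberCoeff z (u - s) p * conj (fiberCoeff z ((k : ℤ) - 1 - s) p) -
      conj (fiberCoeff z (M - u + s) p) * fiberCoeff z (M - ((k : ℤ) - 1) + s) p) with hS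
  have hrec : S u (k + 1) = S (u - 1) k + fiberCoeff z u p * conj (fiberCoeff z k p) -
      conj (fiberCoeff z (M - u) p) * fiberCoeff z (M - k) p := by
    simp only [hS]
    rw [Finset.sum_range_succ', add_sub_assoc]
    congr 1
    · refine Finset.sum_congr rfl fun s _ => ?_
      push_cast
      ring_nf
    · push_cast
      ring_nf
  have e1 : ∀ v : ℤ, 0 ≤ v → v < M → cdCoeff p M z v k = S v (k + 1) := fun v h0 h1 => by
    rw [cdCoeff, if_pos ⟨h0, h1⟩]
    simp only [hS]
    push_cast
    rw [add_sub_cancel_right]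
    rfl
  have e2 : ∀ v : ℤ, 0 ≤ v → v < M → cdCoeff p M z v (k - 1) = S v k := fun v h0 h1 => by
    rw [cdCoeff, if_pos ⟨h0, h1⟩, sub_add_cancel]
    rfl
  have hl : cdCoeff p M z u k = S u (k + 1) := by
    rcases huM.lt_or_eq with h | rfl
    · exact e1 u hu h
    · -- for `u = M` the two sums cancel
      rw [cdCoeff, if_neg (by omega), eq_comm]
      simp only [hS]
      rw [Finset.sum_sub_distrib, sub_eq_zero, ← Finset.sum_range_reflect]
      refine Finset.sum_congr rfl fun s hs => ?_
      have hs' := Finset.mem_range.1 hs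
      have h1 : ((k + 1 - 1 - s : ℕ) : ℤ) = k - s := by omega
      rw [h1, mul_comm]
      push_cast
      ring_nf
  have hr : cdCoeff p M z (u - 1) (k - 1) = S (u - 1) k := by
    rcases hu.lt_or_eq with h | rfl
    · exact e2 _ (by omega) (by omega)
    · rw [cdCoeff, if_neg (by omega), eq_comm]
      refine Finset.sum_eq_zero fun s _ => ?_
      rw [fiberCoeff_outside hpm (u := 0 - 1 - s) (Or.inl (by omega)),
        fiberCoeff_outside hpm (u := M - (0 - 1) + s) (Or.inr (by omega))]
      simp
  rw [hl, hr, hrec]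

lemma eval_dualFamily {z w : ℂ} (hz : ‖z‖ = 1) (hw : ‖w‖ = 1) (k : ℕ) :
    eval z w (dualFamily p M k) = ∑ u ∈ Finset.range M, cdCoeff p M z u k * w ^ u := by
  have hz0 : z ≠ 0 := norm_ne_zero_iff.1 (by simp [hz])
  have hw0 : w ≠ 0 := norm_ne_zero_iff.1 (by simp [hw])
  rw [dualFamily, map_sum]
  refine Finset.sum_congr rfl fun u hu => ?_
  rw [eval_mul hz0 hw0, map_sum, cdCoeff, if_pos ⟨by omega, by simpa using hu⟩, eval_mono,
    zpow_zero, one_mul, zpow_natCast, mul_comm]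
  congr 1
  refine Finset.sum_congr (by congr 1) fun s _ => ?_
  rw [map_sub, eval_mul hz0 hw0, eval_mul hz0 hw0, eval_refl hz hw, eval_refl hz hw]
  simp only [eval_wCoeff]
  ring

include hpm hp in
/-- The families `z ^ j * w ^ t` and `z ^ i * g_k` are biorthogonal with respect to the weight
`1 / |p| ^ 2`. -/
lemma weightForm_mono_mul_dual (i j : ℤ) {t k : ℕ} (ht : t < M) (hk : k < M) :
    weightForm p (mono j t * refl (mono i 0 * dualFamily p M k)) =
      if j = i ∧ t = k then 1 else 0 := by
  have hp1 : ∀ z w, ‖z‖ = 1 → ‖w‖ = 1 → eval z w p ≠ 0 := fun z w hz hw => hp z w hz hw.le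
  have hinner : ∀ z, ‖z‖ = 1 → avg (fun w =>
      eval z w (mono j t * refl (mono i 0 * dualFamily p M k)) / (‖eval z w p‖ : ℂ) ^ 2) =
      z ^ (j - i) * if t = k then 1 else 0 := by
    intro z hz
    have hz0 : z ≠ 0 := norm_ne_zero_iff.1 (by simp [hz])
    have hq : ∀ w, eval z w p = ∑ u ∈ Finset.range (M + 1), fiberCoeff z u p * w ^ u :=
      eval_eq_sum_fiberCoeff (by simpa using hpm) z
    have hgs := sum_fiberMoment_mul_kernel (c := fun u => fiberCoeff z u p)
      (κ := cdCoeff p M z) hq (fun w hw => hp z w hz hw)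
      (fun k => by simp [cdCoeff]) (fun k => by simp [cdCoeff]) (fun u => by simp [cdCoeff])
      (fun u k hu huM hk hkM => cdCoeff_recurrence hpm z hu huM hk hkM) ht hk
    rw [← hgs, Finset.mul_sum]
    have e : ∀ u ∈ Finset.range M, z ^ (j - i) * (fiberMoment (fun w => eval z w p) (t - u) *
        conj (cdCoeff p M z u k)) = avg fun w => z ^ (j - i) * conj (cdCoeff p M z u k) *
          (w ^ ((t : ℤ) - u) / (‖eval z w p‖ : ℂ) ^ 2) := fun u _ => by
      rw [avg_const_mul, fiberMoment]
      ring
    have hc : ∀ u ∈ Finset.range M, CircleContinuous fun w => z ^ (j - i) *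
        conj (cdCoeff p M z u k) * (w ^ ((t : ℤ) - u) / (‖eval z w p‖ : ℂ) ^ 2) := fun u _ => by
      refine continuousOn_const.mul ?_
      have := (torusContinuous_div hp1 (mono 0 (t - u))).fiber hz
      simpa only [eval_mono, zpow_zero, one_mul] using this
    rw [Finset.sum_congr rfl e, ← avg_sum hc]
    refine avg_congr fun w hw => ?_
    have hw0 : w ≠ 0 := norm_ne_zero_iff.1 (by simp [hw])
    rw [eval_mul hz0 hw0, eval_refl hz hw, eval_mul hz0 hw0, eval_dualFamily hz hw, eval_mono,
      eval_mono, map_mul, map_sum, zpow_zero, mul_one, conj_zpow_of_norm_eq_one hz, zpow_sub₀ hz0,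
      Finset.mul_sum, Finset.mul_sum, Finset.sum_div]
    refine Finset.sum_congr rfl fun u _ => ?_
    rw [map_mul, map_pow, ← Complex.inv_eq_conj hw, zpow_sub₀ hw0, zpow_neg]
    simp only [zpow_natCast]
    ring
  rw [weightForm_eq hp1, torusAvg, avg_congr hinner]
  simp only [mul_comm (_ ^ (j - i))]
  rw [avg_const_mul, avg_zpow]
  simp only [sub_eq_zero]
  split_ifs <;> simp_all

include hpm hp in
/-- Pairing with `z ^ i * g_k` extracts a coefficient. -/
lemma weightForm_mul_dual {j : ℤ} {f : Laurent} (hf : f ∈ polySpace j (M - 1)) (i : ℤ) {k : ℕ}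
    (hk : k < M) :
    weightForm p (f * refl (mono i 0 * dualFamily p M k)) = f.coeff (i, k) := by
  induction hf using Submodule.span_induction with
  | zero => simp
  | add x y _ _ hx hy => rw [add_mul, map_add, hx, hy]; rfl
  | smul c x _ hx => rw [smul_mul_assoc, map_smul, hx]; rfl
  | mem x hx =>
    obtain ⟨s, t, hs, ht, rfl⟩ := hx
    obtain ⟨t, rfl⟩ := Int.eq_ofNat_of_zero_le ht.1
    have := weightForm_mono_mul_dual hpm hp i s (t := t) (by omega) hk
    rw [this, mono, AddMonoidAlgebra.coeff_single, Finsupp.single_apply]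
    simp

end Dual


/-! ### Orthogonality to negative powers -/

section Orthogonality

variable {n M : ℕ} {p : Laurent} (hpm : p ∈ polySpace n M)
  (hp : ∀ z w, ‖z‖ = 1 → ‖w‖ ≤ 1 → eval z w p ≠ 0)

include hp in
lemma weightForm_dual_mul_mono (hpm : p ∈ polySpace n M) (i j : ℤ) {t k : ℕ} (ht : t < M)
    (hk : k < M) : weightForm p (mono i 0 * dualFamily p M k * refl (mono j t)) =
      if j = i ∧ t = k then 1 else 0 := by
  have hp1 : ∀ z w, ‖z‖ = 1 → ‖w‖ = 1 → eval z w p ≠ 0 := fun z w hz hw => hp z w hz hw.le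
  have h := congrArg conj (weightForm_mono_mul_dual hpm hp i j ht hk)
  rw [← weightForm_refl hp1, map_mul refl, refl_refl, mul_comm] at h
  rw [h]
  split_ifs <;> simp

/-- The truncated expansion, in the family dual to the monomials, of the component of `f` along
negative powers of `z`. -/
def negPart (p : Laurent) (M N : ℕ) (f : Laurent) : Laurent :=
  ∑ i ∈ Finset.Icc 1 N, ∑ k ∈ Finset.range M,
    weightForm p (f * refl (mono (-i) k)) • (mono (-i) 0 * dualFamily p M k)

include hpm hp in
lemma weightForm_negPart (N : ℕ) (f : Laurent) (j : ℤ) {t : ℕ} (ht : t < M) :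
    weightForm p (negPart p M N f * refl (mono j t)) =
      if -N ≤ j ∧ j ≤ -1 then weightForm p (f * refl (mono j t)) else 0 := by
  simp only [negPart, Finset.sum_mul, map_sum, smul_mul_assoc, map_smul, smul_eq_mul]
  have : ∀ i ∈ Finset.Icc 1 N, ∑ k ∈ Finset.range M, weightForm p (f * refl (mono (-i) k)) *
      weightForm p (mono (-i) 0 * dualFamily p M k * refl (mono j t)) =
      if (i : ℤ) = -j then weightForm p (f * refl (mono j t)) else 0 := by
    intro i _
    rw [Finset.sum_congr rfl fun k hk => by
      rw [weightForm_dual_mul_mono hp hpm (-i) j ht (Finset.mem_range.1 hk)]]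
    by_cases hij : (i : ℤ) = -j
    · simp [hij, ht]
    · rw [if_neg hij]
      exact Finset.sum_eq_zero fun k _ => by rw [if_neg (by omega), mul_zero]
  rw [Finset.sum_congr rfl this]
  split_ifs with h
  · rw [Finset.sum_eq_single_of_mem (-j).toNat (Finset.mem_Icc.2 (by omega)), if_pos (by omega)]
    intro i _ hi
    rw [if_neg (by omega)]
  · refine Finset.sum_eq_zero fun i hi => if_neg fun hij => h ?_
    have := Finset.mem_Icc.1 hi
    omega

include hpm hp in
/-- For a polynomial `f` that is orthogonal to `z ^ j * w ^ k` for `0 ≤ j < n`, the pairings of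
`negPart p M N f` with the dual family vanish, apart from those near the point of truncation, which
are small. -/
lemma norm_weightForm_negPart_dual_le {f : Laurent} (hf : f ∈ polySpace n (M - 1))
    (horth : ∀ j k : ℤ, 0 ≤ j → j < n → 0 ≤ k → k < M → weightForm p (f * refl (mono j k)) = 0)
    {N : ℕ} {ε : ℝ} (hε : 0 ≤ ε)
    (hN : ∀ j : ℤ, j < -N → ∀ u : ℕ, u < M → ‖weightForm p (f * refl (mono j u))‖ ≤ ε)
    {i k : ℕ} (hi : 1 ≤ i) (hk : k < M) :
    ‖weightForm p (negPart p M N f * refl (mono (-i) 0 * dualFamily p M k))‖ ≤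
      if N < i + n then (∑ a ∈ (dualFamily p M k).coeff.support, ‖(dualFamily p M k).coeff a‖) * ε
      else 0 := by
  -- `f` itself is orthogonal to `z ^ (-i) * g_k`, since `f` has no negative powers of `z`
  have h0 : weightForm p (f * refl (mono (-i) 0 * dualFamily p M k)) = 0 := by
    rw [weightForm_mul_dual hpm hp hf (-i) hk]
    by_contra h
    have := (mem_polySpace_iff.1 hf _ _ h).1.1
    omega
  have h1 : weightForm p (negPart p M N f * refl (mono (-i) 0 * dualFamily p M k)) =
      ∑ a ∈ (dualFamily p M k).coeff.support, conj ((dualFamily p M k).coeff a) *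
        weightForm p ((negPart p M N f - f) * refl (mono (a.1 - i) a.2)) := by
    have e : weightForm p (negPart p M N f * refl (mono (-i) 0 * dualFamily p M k)) =
        weightForm p ((negPart p M N f - f) * refl (mono (-i) 0) * refl (dualFamily p M k)) := by
      rw [mul_assoc, ← map_mul refl, sub_mul, map_sub, h0, sub_zero]
    rw [e, map_mul_refl_eq_sum, Finsupp.sum]
    refine Finset.sum_congr rfl fun a _ => ?_
    rw [mul_assoc, ← map_mul refl, mono_mul_mono, zero_add, neg_add_eq_sub]
  have h2 : ∀ a ∈ (dualFamily p M k).coeff.support,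
      ‖weightForm p ((negPart p M N f - f) * refl (mono (a.1 - i) a.2))‖ ≤
        if N < i + n then ε else 0 := by
    rintro ⟨s, u⟩ ha
    obtain ⟨hs, hu, huM⟩ := dualFamily_coeff_ne_zero hpm (Finsupp.mem_support_iff.1 ha)
    have hs := abs_le.1 hs
    obtain ⟨u, rfl⟩ := Int.eq_ofNat_of_zero_le hu
    have hu' : u < M := by omega
    simp only [sub_mul, map_sub]
    rw [weightForm_negPart hpm hp N f _ hu']
    by_cases hc : -(N : ℤ) ≤ s - i
    · have : (if -(N : ℤ) ≤ s - i ∧ s - i ≤ -1 then weightForm p (f * refl (mono (s - i) u))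
          else 0) - weightForm p (f * refl (mono (s - i) u)) = 0 := by
        split_ifs with h
        · exact sub_self _
        · rw [horth (s - i) u (by omega) (by omega) hu huM, sub_zero]
      rw [this, norm_zero]
      split_ifs <;> simp [hε]
    · rw [if_neg (by omega), if_pos (by omega), zero_sub, norm_neg]
      exact hN _ (by omega) u hu'
  rw [h1]
  calc _ ≤ ∑ a ∈ (dualFamily p M k).coeff.support, ‖(dualFamily p M k).coeff a‖ *
        (if N < i + n then ε else 0) := by
        refine (norm_sum_le _ _).trans (Finset.sum_le_sum fun a ha => ?_)
        rw [norm_mul, RCLike.norm_conj]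
        exact mul_le_mul_of_nonneg_left (h2 a ha) (norm_nonneg _)
    _ = _ := by
        rw [← Finset.sum_mul]
        split_ifs <;> simp

include hpm hp in
/-- The norm of `negPart p M N f` tends to zero: only the `n` values of `i` next to the point of
truncation contribute, and both factors of their contributions are of order `ε`. -/
lemma exists_norm_weightForm_negPart_le {f : Laurent} (hf : f ∈ polySpace n (M - 1))
    (horth : ∀ j k : ℤ, 0 ≤ j → j < n → 0 ≤ k → k < M → weightForm p (f * refl (mono j k)) = 0) :
    ∃ C : ℝ, ∀ ε : ℝ, 0 < ε → ∃ N₀ : ℕ, ∀ N ≥ N₀,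
      (weightForm p (negPart p M N f * refl (negPart p M N f))).re ≤ C * ε ^ 2 := by
  set G : ℕ → ℝ := fun k =>
    ∑ a ∈ (dualFamily p M k).coeff.support, ‖(dualFamily p M k).coeff a‖ with hG
  refine ⟨n * ∑ k ∈ Finset.range M, G k, fun ε hε => ?_⟩
  obtain ⟨N₁, hN₁⟩ : ∃ N₁ : ℕ, ∀ j : ℤ, j < -N₁ → ∀ u : ℕ, u < M →
      ‖weightForm p (f * refl (mono j u))‖ ≤ ε := by
    have h : ∀ᶠ j : ℤ in Filter.atBot, ∀ u ∈ Finset.range M,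
        ‖weightForm p (f * refl (mono j u))‖ ≤ ε := by
      rw [Filter.eventually_all_finset]
      intro u _
      have := (tendsto_weightForm p f u).mono_left
        (le_sup_left.trans Int.cofinite_eq.ge : Filter.atBot ≤ Filter.cofinite)
      filter_upwards [this.norm.eventually_le_const (by simpa using hε)] with j hj using hj
    obtain ⟨b, hb⟩ := Filter.eventually_atBot.1 h
    exact ⟨(-b).toNat, fun j hj u hu => hb j (by omega) u (Finset.mem_range.2 hu)⟩
  refine ⟨N₁ + n, fun N hN => ?_⟩
  refine (Complex.re_le_norm _).trans ?_
  have hterm : ∀ i ∈ Finset.Icc 1 N, ∀ k ∈ Finset.range M,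
      ‖weightForm p (negPart p M N f *
        refl (weightForm p (f * refl (mono (-i) k)) • (mono (-i) 0 * dualFamily p M k)))‖ ≤
      if N < i + n then G k * ε ^ 2 else 0 := by
    intro i hi k hk
    have hle := norm_weightForm_negPart_dual_le hpm hp hf horth hε.le
      (fun j hj => hN₁ j (by omega)) (N := N) (Finset.mem_Icc.1 hi).1 (Finset.mem_range.1 hk)
    rw [refl_smul, mul_smul_comm, map_smul, norm_smul, RCLike.norm_conj]
    split_ifs with h
    · rw [if_pos h] at hle
      calc _ ≤ ε * (G k * ε) := mul_le_mul (hN₁ _ (by omega) k (Finset.mem_range.1 hk)) hle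
            (norm_nonneg _) hε.le
        _ = _ := by ring
    · rw [if_neg h] at hle
      rw [le_antisymm hle (norm_nonneg _), mul_zero]
  have hcard : ((Finset.Icc 1 N).filter fun i => N < i + n).card ≤ n := by
    refine (Finset.card_le_card (t := Finset.Ioc (N - n) N) fun i hi => ?_).trans ?_
    · simp only [Finset.mem_filter, Finset.mem_Icc, Finset.mem_Ioc] at hi ⊢
      omega
    · rw [Nat.card_Ioc]
      omega
  have hG0 : 0 ≤ ∑ k ∈ Finset.range M, G k :=
    Finset.sum_nonneg fun k _ => Finset.sum_nonneg fun a _ => norm_nonneg _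
  have hexpand : ∀ g, weightForm p (g * refl (negPart p M N f)) =
      ∑ i ∈ Finset.Icc 1 N, ∑ k ∈ Finset.range M, weightForm p (g *
        refl (weightForm p (f * refl (mono (-i) k)) • (mono (-i) 0 * dualFamily p M k))) := by
    intro g
    simp only [negPart, map_sum, Finset.mul_sum]
  calc _ = ‖∑ i ∈ Finset.Icc 1 N, ∑ k ∈ Finset.range M, weightForm p (negPart p M N f *
        refl (weightForm p (f * refl (mono (-i) k)) • (mono (-i) 0 * dualFamily p M k)))‖ := by
        rw [← hexpand]
    _ ≤ ∑ i ∈ Finset.Icc 1 N, ∑ k ∈ Finset.range M, if N < i + n then G k * ε ^ 2 else 0 :=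
        (norm_sum_le _ _).trans (Finset.sum_le_sum fun i hi =>
          (norm_sum_le _ _).trans (Finset.sum_le_sum fun k hk => hterm i hi k hk))
    _ = ((Finset.Icc 1 N).filter fun i => N < i + n).card *
          ((∑ k ∈ Finset.range M, G k) * ε ^ 2) := by
        rw [← nsmul_eq_mul, ← Finset.sum_const, Finset.sum_filter, Finset.sum_mul]
        refine Finset.sum_congr rfl fun i _ => ?_
        split_ifs <;> simp
    _ ≤ n * ((∑ k ∈ Finset.range M, G k) * ε ^ 2) := by gcongr
    _ = _ := by ring

include hpm hp in
/-- Let `p` have degree at most `(n, M)` and no zeros on `𝕋 × 𝔻̄`. If a polynomial `f` of degree at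
most `(n, M - 1)` is orthogonal, with respect to `1 / |p| ^ 2`, to `z ^ j * w ^ k` for `0 ≤ j < n`
and `0 ≤ k < M`, then the same holds for all negative `j`.

For large `N`, the pairing of `f` with `z ^ j * w ^ k` equals that of `negPart p M N f`, whose norm
tends to zero. -/
theorem weightForm_orthogonal_of_lt {f : Laurent} (hf : f ∈ polySpace n (M - 1))
    (horth : ∀ j k : ℤ, 0 ≤ j → j < n → 0 ≤ k → k < M → weightForm p (f * refl (mono j k)) = 0)
    {j k : ℤ} (hj : j < n) (hk : 0 ≤ k) (hkM : k < M) :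
    weightForm p (f * refl (mono j k)) = 0 := by
  rcases le_or_gt 0 j with h0 | h0
  · exact horth j k h0 hj hk hkM
  have hp1 : ∀ z w, ‖z‖ = 1 → ‖w‖ = 1 → eval z w p ≠ 0 := fun z w hz hw => hp z w hz hw.le
  obtain ⟨k, rfl⟩ := Int.eq_ofNat_of_zero_le hk
  obtain ⟨C, hC⟩ := exists_norm_weightForm_negPart_le hpm hp hf horth
  set D := (weightForm p (mono j k * refl (mono j k))).re with hD
  have hD0 : 0 ≤ D := re_weightForm_nonneg hp1 _
  have hle : ∀ ε : ℝ, 0 < ε → ‖weightForm p (f * refl (mono j k))‖ ^ 2 ≤ C * ε ^ 2 * D := by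
    intro ε hε
    obtain ⟨N₀, hN₀⟩ := hC ε hε
    set N := max N₀ (-j).toNat with hN
    have h1 := norm_weightForm_sq_le hp1 (negPart p M N f) (mono j k)
    rw [weightForm_negPart hpm hp N f j (by omega), if_pos (by omega)] at h1
    exact h1.trans (mul_le_mul_of_nonneg_right (hN₀ N (le_max_left _ _)) hD0)
  have hlim : Filter.Tendsto (fun ε : ℝ => C * ε ^ 2 * D) (nhdsWithin 0 (Set.Ioi 0)) (nhds 0) := by
    have : Continuous fun ε : ℝ => C * ε ^ 2 * D := by fun_prop
    have h := this.tendsto 0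
    simp only [ne_eq, OfNat.ofNat_ne_zero, not_false_eq_true, zero_pow, mul_zero, zero_mul] at h
    exact h.mono_left nhdsWithin_le_nhds
  have := ge_of_tendsto hlim (Filter.eventually_of_mem self_mem_nhdsWithin fun ε hε => hle ε hε)
  have h2 : ‖weightForm p (f * refl (mono j k))‖ = 0 := by
    have := le_antisymm this (sq_nonneg _)
    simpa using this
  exact norm_eq_zero.1 h2

end Orthogonality


/-! ### Rectangles of exponents in the Hilbert space -/

section Geometry

variable {n m : ℕ} (𝒯 : laurentSpace n m →ₗ[ℂ] ℂ) (hT : IsPositive 𝒯)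

lemma toLaurent_injective : Function.Injective (toLaurent 𝒯 hT) := Subtype.val_injective

lemma toLaurent_mem (f : HSpace 𝒯 hT) : toLaurent 𝒯 hT f ∈ polySpace (n : ℤ) m := f.2

variable {𝒯}

lemma exists_toLaurent_eq {f : Laurent} (hf : f ∈ polySpace (n : ℤ) m) :
    ∃ g, toLaurent 𝒯 hT g = f := ⟨⟨f, hf⟩, rfl⟩

variable {hT}

/-- The inner product depends only on the Laurent polynomial `f * refl g`. In particular it is
invariant under multiplication of both arguments by a monomial. -/
lemma inner_congr {f g f' g' : HSpace 𝒯 hT}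
    (h : toLaurent 𝒯 hT f * refl (toLaurent 𝒯 hT g) =
      toLaurent 𝒯 hT f' * refl (toLaurent 𝒯 hT g')) : ⟪g, f⟫_ℂ = ⟪g', f'⟫_ℂ := by
  rw [inner_eq, inner_eq]
  exact congrArg 𝒯 (Subtype.ext h)

lemma inner_shift {f g f' g' : HSpace 𝒯 hT} {s t : ℤ}
    (hf : toLaurent 𝒯 hT f' = mono s t * toLaurent 𝒯 hT f)
    (hg : toLaurent 𝒯 hT g' = mono s t * toLaurent 𝒯 hT g) : ⟪g', f'⟫_ℂ = ⟪g, f⟫_ℂ := by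
  refine inner_congr ?_
  rw [hf, hg, map_mul, refl_mono, mul_mul_mul_comm, mono_mul_mono, add_neg_cancel, add_neg_cancel,
    mono_zero_zero, one_mul]

variable (𝒯 hT)

/-- The elements of `H_𝒯` with exponents in the rectangle `[a, b] × [c, d]`. -/
def hbox (a b c d : ℤ) : Submodule ℂ (HSpace 𝒯 hT) := (box a b c d).comap (toLaurent 𝒯 hT)

variable {𝒯 hT}

lemma mem_hbox {a b c d : ℤ} {f : HSpace 𝒯 hT} :
    f ∈ hbox 𝒯 hT a b c d ↔ toLaurent 𝒯 hT f ∈ box a b c d := Iff.rfl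

lemma P_eq_hbox (k l : ℤ) : P 𝒯 hT k l = hbox 𝒯 hT 0 k 0 l := by
  rw [P, polySpace_eq_box, hbox]

lemma hbox_mono {a b c d a' b' c' d' : ℤ} (ha : a' ≤ a) (hb : b ≤ b') (hc : c' ≤ c)
    (hd : d ≤ d') : hbox 𝒯 hT a b c d ≤ hbox 𝒯 hT a' b' c' d' :=
  Submodule.comap_mono (box_mono ha hb hc hd)

lemma hbox_eq_top : hbox 𝒯 hT 0 n 0 m = ⊤ := by
  refine eq_top_iff.2 fun f _ => ?_
  rw [mem_hbox, ← polySpace_eq_box]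
  exact toLaurent_mem 𝒯 hT f

lemma mem_shift {s t : ℤ} {S : Submodule ℂ (HSpace 𝒯 hT)} {f : HSpace 𝒯 hT} :
    f ∈ shift s t S ↔ ∃ g ∈ S, mono s t * toLaurent 𝒯 hT g = toLaurent 𝒯 hT f := by
  simp only [shift, Submodule.mem_comap, Submodule.mem_map, LinearMap.mulLeft_apply]
  constructor
  · rintro ⟨_, ⟨g, hg, rfl⟩, h⟩
    exact ⟨g, hg, h⟩
  · rintro ⟨g, hg, h⟩
    exact ⟨_, ⟨g, hg, rfl⟩, h⟩

/-- An element of a rectangle can be divided by a monomial if the shifted rectangle still lies in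
`[0, n] × [0, m]`. -/
lemma exists_eq_mono_mul {a b c d s t : ℤ} (ha : s ≤ a) (hb : b ≤ n + s) (hc : t ≤ c)
    (hd : d ≤ m + t) {f : HSpace 𝒯 hT} (hf : f ∈ hbox 𝒯 hT a b c d) :
    ∃ g ∈ hbox 𝒯 hT (a - s) (b - s) (c - t) (d - t),
      toLaurent 𝒯 hT f = mono s t * toLaurent 𝒯 hT g := by
  have h : mono (-s) (-t) * toLaurent 𝒯 hT f ∈ box (a - s) (b - s) (c - t) (d - t) := by
    rw [mono_mul_mem_box_iff]
    simpa [mem_hbox] using hf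
  obtain ⟨g, hg⟩ := exists_toLaurent_eq (𝒯 := 𝒯) hT (polySpace_eq_box _ _ ▸
    box_mono (by omega) (by omega) (by omega) (by omega) h)
  exact ⟨g, by rwa [mem_hbox, hg], by rw [hg, mono_mul_cancel']⟩

lemma shift_P {k l s t : ℤ} (hs : 0 ≤ s) (hk : k + s ≤ n) (ht : 0 ≤ t) (hl : l + t ≤ m) :
    shift s t (P 𝒯 hT k l) = hbox 𝒯 hT s (k + s) t (l + t) := by
  ext f
  rw [mem_shift, P_eq_hbox]
  constructor
  · rintro ⟨g, hg, h⟩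
    rw [mem_hbox, ← h, mono_mul_mem_box_iff]
    simpa [mem_hbox] using hg
  · intro hf
    obtain ⟨g, hg, h⟩ := exists_eq_mono_mul le_rfl (by omega) le_rfl (by omega) hf
    exact ⟨g, by simpa using hg, h.symm⟩

lemma E1_eq {k l : ℤ} (hk : k ≤ n) (hl : l ≤ m) :
    E1 𝒯 hT k l = hbox 𝒯 hT 0 k 0 l ⊓ (hbox 𝒯 hT 0 k 1 l)ᗮ := by
  rw [E1, shift_P le_rfl (by omega) zero_le_one (by omega), P_eq_hbox, add_zero, sub_add_cancel]

lemma F2_eq {k l : ℤ} :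
    F2 𝒯 hT k l = hbox 𝒯 hT 0 k 0 l ⊓ (hbox 𝒯 hT 0 (k - 1) 0 l)ᗮ := by
  rw [F2, P_eq_hbox, P_eq_hbox]

/-- Multiplication by a monomial preserves orthogonality of rectangles. -/
lemma mem_orthogonal_of_mono_mul {a b c d s t : ℤ} (ha : s ≤ a) (hb : b ≤ n + s) (hc : t ≤ c)
    (hd : d ≤ m + t) {f g : HSpace 𝒯 hT} (h : toLaurent 𝒯 hT g = mono s t * toLaurent 𝒯 hT f)
    (hf : f ∈ (hbox 𝒯 hT (a - s) (b - s) (c - t) (d - t))ᗮ) : g ∈ (hbox 𝒯 hT a b c d)ᗮ := by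
  rw [Submodule.mem_orthogonal] at hf ⊢
  intro u hu
  obtain ⟨v, hv, hu⟩ := exists_eq_mono_mul ha hb hc hd hu
  rw [inner_shift h hu]
  exact hf v hv

lemma finrank_hbox {a b c d : ℤ} (ha : 0 ≤ a) (hb : b ≤ n) (hc : 0 ≤ c) (hd : d ≤ m) :
    Module.finrank ℂ (hbox 𝒯 hT a b c d) = (b + 1 - a).toNat * (d + 1 - c).toNat := by
  rw [← finrank_box]
  exact (Submodule.comapSubtypeEquivOfLe
    (polySpace_eq_box _ _ ▸ box_mono ha hb hc hd : box a b c d ≤ polySpace n m)).finrank_eq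

lemma finrank_E1 {k : ℤ} (hk : k ≤ n) (hk0 : -1 ≤ k) :
    Module.finrank ℂ (E1 𝒯 hT k m) = (k + 1).toNat := by
  have h := Submodule.finrank_add_inf_finrank_orthogonal
    (hbox_mono le_rfl le_rfl zero_le_one le_rfl :
      hbox 𝒯 hT 0 k 1 m ≤ hbox 𝒯 hT 0 k 0 m)
  rw [finrank_hbox le_rfl hk zero_le_one le_rfl, finrank_hbox le_rfl hk le_rfl le_rfl] at h
  rw [E1_eq hk le_rfl, inf_comm]
  obtain ⟨k', hk'⟩ : ∃ k' : ℕ, k + 1 = k' := Int.eq_ofNat_of_zero_le (by omega)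
  simp only [hk', sub_zero, add_sub_cancel_right, Int.toNat_natCast] at h ⊢
  have h2 : ((m : ℤ) + 1).toNat = m + 1 := by omega
  rw [h2, mul_add, mul_one] at h
  omega

lemma finrank_F2 : Module.finrank ℂ (F2 𝒯 hT n m) = m + 1 := by
  have h := Submodule.finrank_add_inf_finrank_orthogonal
    (hbox_mono le_rfl (by omega) le_rfl le_rfl :
      hbox 𝒯 hT 0 (n - 1) 0 m ≤ hbox 𝒯 hT 0 n 0 m)
  rw [finrank_hbox le_rfl (by omega) le_rfl le_rfl, finrank_hbox le_rfl le_rfl le_rfl le_rfl] at h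
  rw [F2_eq, inf_comm]
  have h2 : ((m : ℤ) + 1 - 0).toNat = m + 1 := by omega
  have h3 : ((n : ℤ) + 1 - 0).toNat = n + 1 := by omega
  have h4 : ((n : ℤ) - 1 + 1 - 0).toNat = n := by omega
  rw [h2, h3, h4, add_mul, one_mul] at h
  omega

/-! ### Split-shift orthogonality and the operators `A`, `B`, `T` -/

lemma E1_le : E1 𝒯 hT (n - 1) m ≤ hbox 𝒯 hT 0 (n - 1) 0 m := by
  rw [E1_eq (by omega) le_rfl]
  exact inf_le_left

lemma E1_le_orthogonal : E1 𝒯 hT (n - 1) m ≤ (hbox 𝒯 hT 0 (n - 1) 1 m)ᗮ := by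
  rw [E1_eq (by omega) le_rfl]
  exact inf_le_right

lemma toLaurent_Mz (f : E1 𝒯 hT (n - 1) m) :
    toLaurent 𝒯 hT (Mz 𝒯 hT f) = mono 1 0 * toLaurent 𝒯 hT f := rfl

lemma mem_E1_top_iff {f : HSpace 𝒯 hT} : f ∈ E1 𝒯 hT n m ↔ f ∈ (hbox 𝒯 hT 0 n 1 m)ᗮ := by
  rw [E1_eq le_rfl le_rfl, hbox_eq_top, top_inf_eq]

lemma mem_shift_E2_iff {f : HSpace 𝒯 hT} :
    f ∈ shift 0 1 (E2 𝒯 hT n (m - 1)) ↔ f ∈ hbox 𝒯 hT 0 n 1 m ⊓ (hbox 𝒯 hT 1 n 1 m)ᗮ := by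
  rw [mem_shift, E2, shift_P zero_le_one (by omega) le_rfl (by omega), P_eq_hbox, sub_add_cancel,
    add_zero, Submodule.mem_inf]
  constructor
  · rintro ⟨g, ⟨hg, hg'⟩, h⟩
    refine ⟨?_, mem_orthogonal_of_mono_mul (by omega) (by omega) (by omega) (by omega) h.symm
      (by simpa using hg')⟩
    rw [mem_hbox, ← h, mono_mul_mem_box_iff]
    simpa [mem_hbox] using hg
  · rintro ⟨hf, hf'⟩
    obtain ⟨g, hg, h⟩ := exists_eq_mono_mul (s := 0) (t := 1) (by omega) (by omega) (by omega)
      (by omega) hf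
    refine ⟨g, ⟨by simpa using hg, ?_⟩, h.symm⟩
    have h' : toLaurent 𝒯 hT g = mono 0 (-1) * toLaurent 𝒯 hT f := by
      rw [h]; exact (mono_mul_cancel 0 1 _).symm
    exact mem_orthogonal_of_mono_mul (by omega) (by omega) (by omega) (by omega) h'
      (by simpa using hf')

lemma mem_shift_F2_iff {f : HSpace 𝒯 hT} :
    f ∈ shift 0 1 (F2 𝒯 hT n (m - 1)) ↔ f ∈ hbox 𝒯 hT 0 n 1 m ⊓ (hbox 𝒯 hT 0 (n - 1) 1 m)ᗮ := by
  rw [mem_shift, F2_eq, Submodule.mem_inf]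
  constructor
  · rintro ⟨g, ⟨hg, hg'⟩, h⟩
    refine ⟨?_, mem_orthogonal_of_mono_mul (by omega) (by omega) (by omega) (by omega) h.symm
      (by simpa using hg')⟩
    rw [mem_hbox, ← h, mono_mul_mem_box_iff]
    simpa [mem_hbox] using hg
  · rintro ⟨hf, hf'⟩
    obtain ⟨g, hg, h⟩ := exists_eq_mono_mul (s := 0) (t := 1) (by omega) (by omega) (by omega)
      (by omega) hf
    refine ⟨g, ⟨by simpa using hg, ?_⟩, h.symm⟩
    have h' : toLaurent 𝒯 hT g = mono 0 (-1) * toLaurent 𝒯 hT f := by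
      rw [h]; exact (mono_mul_cancel 0 1 _).symm
    exact mem_orthogonal_of_mono_mul (by omega) (by omega) (by omega) (by omega) h'
      (by simpa using hf')

/-- If `U ≤ V`, then a vector orthogonal to `U` and to `V ⊖ U` is orthogonal to `V`. -/
lemma mem_orthogonal_of_mem_inf {E : Type*} [NormedAddCommGroup E] [InnerProductSpace ℂ E]
    {U V : Submodule ℂ E} [U.HasOrthogonalProjection] (h : U ≤ V) {f : E} (hU : f ∈ Uᗮ)
    (hV : f ∈ (V ⊓ Uᗮ)ᗮ) : f ∈ Vᗮ := by
  rw [← Submodule.sup_orthogonal_inf_of_hasOrthogonalProjection h, ← Submodule.inf_orthogonal,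
    inf_comm Uᗮ V]
  exact ⟨hU, hV⟩

/-- The kernel of `A` consists of the `f` with `z * f ∈ ℰ¹_{n,m}`. -/
lemma opA_eq_zero_iff (f : E1 𝒯 hT (n - 1) m) :
    opA 𝒯 hT f = 0 ↔ Mz 𝒯 hT f ∈ E1 𝒯 hT n m := by
  have hE : shift 0 1 (E2 𝒯 hT n (m - 1)) = hbox 𝒯 hT 0 n 1 m ⊓ (hbox 𝒯 hT 1 n 1 m)ᗮ :=
    Submodule.ext fun _ => mem_shift_E2_iff
  rw [mem_E1_top_iff]
  refine (Submodule.orthogonalProjectionOnto_eq_zero_iff (v := Mz 𝒯 hT f)).trans ?_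
  rw [hE]
  have hf := E1_le_orthogonal f.2
  constructor
  · refine mem_orthogonal_of_mem_inf (hbox_mono (by omega) le_rfl le_rfl le_rfl) ?_
    exact mem_orthogonal_of_mono_mul (s := 1) (t := 0) (by omega) (by omega) (by omega) (by omega)
      (toLaurent_Mz f) (by simpa using hf)
  · exact fun h => Submodule.orthogonal_le inf_le_left h

/-- The orthogonal complement of the range of `B` consists of the `f` in `ℰ¹_{n,m}`. -/
lemma forall_inner_opB_eq_zero_iff (f : E1 𝒯 hT (n - 1) m) :
    (∀ x, ⟪opB 𝒯 hT x, f⟫_ℂ = 0) ↔ (f : HSpace 𝒯 hT) ∈ E1 𝒯 hT n m := by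
  have hF : shift 0 1 (F2 𝒯 hT n (m - 1)) =
      hbox 𝒯 hT 0 n 1 m ⊓ (hbox 𝒯 hT 0 (n - 1) 1 m)ᗮ :=
    Submodule.ext fun _ => mem_shift_F2_iff
  have hf := E1_le_orthogonal f.2
  have e : ∀ x, ⟪opB 𝒯 hT x, f⟫_ℂ = ⟪(x : HSpace 𝒯 hT), f⟫_ℂ := fun x =>
    (E1 𝒯 hT (n - 1) m).inner_orthogonalProjectionOnto_eq_of_mem_right f x
  rw [mem_E1_top_iff]
  simp only [e]
  constructor
  · intro h
    refine mem_orthogonal_of_mem_inf (hbox_mono le_rfl (by omega) le_rfl le_rfl) hf ?_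
    rw [← hF, Submodule.mem_orthogonal]
    exact fun u hu => h ⟨u, hu⟩
  · rintro h ⟨x, hx⟩
    exact h x (hF ▸ hx).1

lemma inner_opT (u : E1 𝒯 hT (n - 1) m) (f : E1 𝒯 hT (n - 1) m) :
    ⟪u, opT 𝒯 hT f⟫_ℂ = ⟪(u : HSpace 𝒯 hT), Mz 𝒯 hT f⟫_ℂ :=
  (E1 𝒯 hT (n - 1) m).inner_orthogonalProjectionOnto_eq_of_mem_left u _

lemma mem_of_mem_sup_of_orthogonal {E : Type*} [NormedAddCommGroup E] [InnerProductSpace ℂ E]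
    {U V : Submodule ℂ E} (h : U ⟂ V) {f : E} (hf : f ∈ U ⊔ V) (hU : ∀ u ∈ U, ⟪u, f⟫_ℂ = 0) :
    f ∈ V := by
  obtain ⟨u, hu, v, hv, rfl⟩ := Submodule.mem_sup.1 hf
  have h1 := hU u hu
  rw [inner_add_right, Submodule.isOrtho_iff_inner_eq.1 h u hu v hv, add_zero,
    inner_self_eq_zero] at h1
  rwa [h1, zero_add]

lemma range_opB_le_invariantSpan : LinearMap.range (opB 𝒯 hT) ≤ invariantSpan 𝒯 hT :=
  le_sInf fun _ hW => hW.1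

lemma opT_mem_invariantSpan {f : E1 𝒯 hT (n - 1) m} (hf : f ∈ invariantSpan 𝒯 hT) :
    opT 𝒯 hT f ∈ invariantSpan 𝒯 hT := by
  rw [invariantSpan, Submodule.mem_sInf] at hf ⊢
  exact fun W hW => hW.2 f (hf W hW)

/-- `K₂` is the smallest `T`-invariant subspace containing the range of `B`, and `K₁` is its
orthogonal complement in `ℰ¹_{n-1,m}`. -/
theorem splitShift_of_invariantSpan_le_ker
    (h : invariantSpan 𝒯 hT ≤ LinearMap.ker (opA 𝒯 hT)) : SplitShift 𝒯 hT := by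
  set K₂ := (invariantSpan 𝒯 hT).map (E1 𝒯 hT (n - 1) m).subtype with hK2
  have hle : K₂ ≤ E1 𝒯 hT (n - 1) m := Submodule.map_subtype_le _ _
  have hshift : ∀ f ∈ shift 1 0 K₂, ∃ g ∈ invariantSpan 𝒯 hT, f = Mz 𝒯 hT g := by
    intro f hf
    obtain ⟨_, ⟨g, hg, rfl⟩, hf⟩ := mem_shift.1 hf
    exact ⟨g, hg, toLaurent_injective 𝒯 hT hf.symm⟩
  refine ⟨E1 𝒯 hT (n - 1) m ⊓ K₂ᗮ, K₂, ⟨?_, ?_⟩, ?_, ?_, ?_⟩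
  · exact (Submodule.isOrtho_orthogonal_left K₂).mono_left inf_le_right
  · rw [sup_comm, inf_comm]
    exact Submodule.sup_orthogonal_inf_of_hasOrthogonalProjection hle
  · rw [Submodule.isOrtho_iff_inner_eq]
    intro u hu f hf
    obtain ⟨g, hg, rfl⟩ := hshift f hf
    refine (inner_opT ⟨u, hu.1⟩ g).symm.trans ?_
    exact inner_eq_zero_symm.1 (hu.2 _ (Submodule.mem_map_of_mem (opT_mem_invariantSpan hg)))
  · intro u hu
    refine (forall_inner_opB_eq_zero_iff ⟨u, hu.1⟩).1 fun x => ?_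
    exact hu.2 _ (Submodule.mem_map_of_mem (range_opB_le_invariantSpan ⟨x, rfl⟩))
  · intro f hf
    obtain ⟨g, hg, rfl⟩ := hshift f hf
    exact (opA_eq_zero_iff g).1 (h hg)

/-- By the Cayley–Hamilton theorem it suffices to test the powers of `T` up to the dimension
`n` of `ℰ¹_{n-1,m}`. -/
theorem opA_comp_pow_comp_opB
    (h : ∀ j : ℕ, j < n → opA 𝒯 hT ∘ₗ (opT 𝒯 hT ^ j) ∘ₗ opB 𝒯 hT = 0) (j : ℕ) :
    opA 𝒯 hT ∘ₗ (opT 𝒯 hT ^ j) ∘ₗ opB 𝒯 hT = 0 := by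
  have hfr : Module.finrank ℂ (E1 𝒯 hT (n - 1) m) = n := by
    rw [finrank_E1 (by omega) (by omega)]
    omega
  rcases Nat.eq_zero_or_pos n with hn | hn
  · have : Subsingleton (E1 𝒯 hT (n - 1) m) :=
      Module.finrank_zero_iff.1 (hfr.trans hn)
    ext x
    have : opB 𝒯 hT x = 0 := Subsingleton.elim _ _
    simp [this]
  have hdeg : (Polynomial.X ^ j %ₘ (opT 𝒯 hT).charpoly).natDegree < n := by
    conv_rhs => rw [← hfr, ← LinearMap.charpoly_natDegree (opT 𝒯 hT)]
    refine Polynomial.natDegree_modByMonic_lt _ (LinearMap.charpoly_monic _) fun h1 => ?_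
    have := LinearMap.charpoly_natDegree (opT 𝒯 hT)
    rw [h1, Polynomial.natDegree_one, hfr] at this
    omega
  ext1 x
  rw [LinearMap.pow_eq_aeval_mod_charpoly, Polynomial.aeval_eq_sum_range' hdeg]
  simp only [LinearMap.comp_apply, LinearMap.sum_apply, map_sum, LinearMap.smul_apply, map_smul,
    LinearMap.zero_apply]
  refine Finset.sum_eq_zero fun i hi => ?_
  have := LinearMap.congr_fun (h i (Finset.mem_range.1 hi)) x
  simp only [LinearMap.comp_apply, LinearMap.zero_apply] at this
  rw [this, smul_zero]

theorem invariantSpan_le_ker_iff :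
    invariantSpan 𝒯 hT ≤ LinearMap.ker (opA 𝒯 hT) ↔
      ∀ j : ℕ, j < n → opA 𝒯 hT ∘ₗ (opT 𝒯 hT ^ j) ∘ₗ opB 𝒯 hT = 0 := by
  constructor
  · intro h j hj
    clear hj
    ext1 x
    refine h ?_
    induction j with
    | zero => exact range_opB_le_invariantSpan ⟨x, rfl⟩
    | succ j ih =>
      rw [LinearMap.comp_apply, pow_succ', Module.End.mul_apply]
      exact opT_mem_invariantSpan ih
  · intro h
    -- the largest `T`-invariant subspace of the kernel of `A`
    have : invariantSpan 𝒯 hT ≤ ⨅ j : ℕ, LinearMap.ker (opA 𝒯 hT ∘ₗ (opT 𝒯 hT ^ j)) := by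
      refine sInf_le ⟨?_, fun f hf => ?_⟩
      · rintro _ ⟨x, rfl⟩
        rw [Submodule.mem_iInf]
        exact fun j => LinearMap.congr_fun (opA_comp_pow_comp_opB h j) x
      · rw [Submodule.mem_iInf] at hf ⊢
        intro j
        have := hf (j + 1)
        rwa [LinearMap.mem_ker, LinearMap.comp_apply, pow_succ, Module.End.mul_apply] at this
    exact this.trans (iInf_le _ 0)

end Geometry


/-! ### The Bernstein–Szegő condition in terms of Laurent polynomials -/

lemma exists_laurent_of_mvPolynomial (q : MvPolynomial (Fin 2) ℂ) {n m : ℕ}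
    (hn : q.degreeOf 0 ≤ n) (hm : q.degreeOf 1 ≤ m) :
    ∃ p ∈ polySpace (n : ℤ) m, ∀ z w, eval z w p = MvPolynomial.eval ![z, w] q := by
  refine ⟨∑ d ∈ q.support, q.coeff d • mono (d 0) (d 1), ?_, fun z w => ?_⟩
  · refine Submodule.sum_mem _ fun d hd => Submodule.smul_mem _ _ (mono_mem_polySpace ?_ ?_)
    · have := MvPolynomial.degreeOf_le_iff.1 hn d hd
      omega
    · have := MvPolynomial.degreeOf_le_iff.1 hm d hd
      omega
  · rw [MvPolynomial.eval_eq', map_sum]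
    refine Finset.sum_congr rfl fun d _ => ?_
    simp [Fin.prod_univ_two]

lemma exists_mvPolynomial_of_laurent {n m : ℕ} {p : Laurent} (hp : p ∈ polySpace (n : ℤ) m) :
    ∃ q : MvPolynomial (Fin 2) ℂ, q.degreeOf 0 ≤ n ∧ q.degreeOf 1 ≤ m ∧
      ∀ z w, eval z w p = MvPolynomial.eval ![z, w] q := by
  induction hp using Submodule.span_induction with
  | zero => exact ⟨0, by simp, by simp, by simp⟩
  | add x y _ _ hx hy =>
    obtain ⟨q, hq0, hq1, hq⟩ := hx
    obtain ⟨r, hr0, hr1, hr⟩ := hy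
    exact ⟨q + r, (MvPolynomial.degreeOf_add_le _ _ _).trans (max_le hq0 hr0),
      (MvPolynomial.degreeOf_add_le _ _ _).trans (max_le hq1 hr1), by simp [hq, hr]⟩
  | smul c x _ hx =>
    obtain ⟨q, hq0, hq1, hq⟩ := hx
    exact ⟨MvPolynomial.C c * q, (MvPolynomial.degreeOf_C_mul_le _ _ _).trans hq0,
      (MvPolynomial.degreeOf_C_mul_le _ _ _).trans hq1, by simp [hq]⟩
  | mem x hx =>
    obtain ⟨s, t, hs, ht, rfl⟩ := hx
    obtain ⟨s, rfl⟩ := Int.eq_ofNat_of_zero_le hs.1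
    obtain ⟨t, rfl⟩ := Int.eq_ofNat_of_zero_le ht.1
    refine ⟨MvPolynomial.X 0 ^ s * MvPolynomial.X 1 ^ t, ?_, ?_, by simp⟩
    · refine (MvPolynomial.degreeOf_mul_le _ _ _).trans ?_
      refine (add_le_add (MvPolynomial.degreeOf_pow_le _ _ _)
        (MvPolynomial.degreeOf_pow_le _ _ _)).trans ?_
      simp [MvPolynomial.degreeOf_X]
      omega
    · refine (MvPolynomial.degreeOf_mul_le _ _ _).trans ?_
      refine (add_le_add (MvPolynomial.degreeOf_pow_le _ _ _)
        (MvPolynomial.degreeOf_pow_le _ _ _)).trans ?_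
      simp [MvPolynomial.degreeOf_X]
      omega

lemma bsMoment_eq_weightMoment {q : MvPolynomial (Fin 2) ℂ} {p : Laurent}
    (h : ∀ z w, eval z w p = MvPolynomial.eval ![z, w] q) (j k : ℤ) :
    bsMoment q j k = weightMoment p j k := by
  rw [bsMoment, weightMoment, torusAvg]
  simp only [avg, Real.circleAverage, circleMap_zero, Complex.ofReal_one, one_mul, h,
    ← intervalIntegral.integral_smul]
  refine intervalIntegral.integral_congr fun θ _ => intervalIntegral.integral_congr fun φ _ => ?_
  simp only [Complex.real_smul]
  push_cast
  field_simp

section Condition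

variable {n m : ℕ} {𝒯 : laurentSpace n m →ₗ[ℂ] ℂ} {hT : IsPositive 𝒯}

/-- Two linear forms on `L_{n,m}` that agree on the monomials are equal. -/
lemma eq_weightForm_iff {p : Laurent} : (∀ f : laurentSpace n m, 𝒯 f = weightForm p f) ↔
    ∀ (j k : ℤ) (hj : |j| ≤ n) (hk : |k| ≤ m),
      𝒯 ⟨mono j k, mono_mem_laurentSpace hj hk⟩ = weightMoment p j k := by
  constructor
  · intro h j k hj hk
    rw [h, weightForm_mono]
  · rintro h ⟨f, hf⟩
    suffices H : ∃ hf' : f ∈ laurentSpace (n : ℤ) m, 𝒯 ⟨f, hf'⟩ = weightForm p f from H.2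
    induction hf using Submodule.span_induction with
    | zero => exact ⟨zero_mem _, by rw [map_zero]; exact map_zero 𝒯⟩
    | add x y _ _ hx hy =>
      obtain ⟨hx', hx⟩ := hx
      obtain ⟨hy', hy⟩ := hy
      exact ⟨add_mem hx' hy', by rw [map_add, ← hx, ← hy, ← map_add]; rfl⟩
    | smul c x _ hx =>
      obtain ⟨hx', hx⟩ := hx
      exact ⟨Submodule.smul_mem _ c hx', by rw [map_smul, ← hx, ← map_smul]; rfl⟩
    | mem x hx =>
      obtain ⟨s, t, hs, ht, rfl⟩ := hx
      exact ⟨mono_mem_laurentSpace hs ht, by rw [h s t hs ht, weightForm_mono]⟩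

lemma bernsteinSzegoCondition_iff : BernsteinSzegoCondition 𝒯 ↔
    ∃ p ∈ polySpace (n : ℤ) m, (∀ z w, ‖z‖ = 1 → ‖w‖ ≤ 1 → eval z w p ≠ 0) ∧
      ∀ f : laurentSpace n m, 𝒯 f = weightForm p f := by
  constructor
  · rintro ⟨q, hn, hm, hq, hmom⟩
    obtain ⟨p, hp, h⟩ := exists_laurent_of_mvPolynomial q hn hm
    refine ⟨p, hp, fun z w hz hw => by rw [h]; exact hq z w hz hw,
      eq_weightForm_iff.2 fun j k hj hk => ?_⟩
    rw [hmom j k hj hk, bsMoment_eq_weightMoment h]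
  · rintro ⟨p, hp, hp0, hmom⟩
    obtain ⟨q, hn, hm, h⟩ := exists_mvPolynomial_of_laurent hp
    refine ⟨q, hn, hm, fun z w hz hw => by rw [← h]; exact hp0 z w hz hw, fun j k hj hk => ?_⟩
    rw [eq_weightForm_iff.1 hmom j k hj hk, bsMoment_eq_weightMoment h]

/-! ### From the Bernstein–Szegő condition to the matrix condition -/

variable {p : Laurent} (hpm : p ∈ polySpace (n : ℤ) m)
  (hp : ∀ z w, ‖z‖ = 1 → ‖w‖ ≤ 1 → eval z w p ≠ 0)
  (h𝒯 : ∀ f : laurentSpace n m, 𝒯 f = weightForm p f)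

include h𝒯 in
lemma inner_eq_weightForm (f g : HSpace 𝒯 hT) :
    ⟪g, f⟫_ℂ = weightForm p (toLaurent 𝒯 hT f * refl (toLaurent 𝒯 hT g)) := by
  rw [inner_eq]
  exact h𝒯 _

include h𝒯 in
lemma mem_hbox_orthogonal_iff {a b c d : ℤ} (ha : 0 ≤ a) (hb : b ≤ n) (hc : 0 ≤ c) (hd : d ≤ m)
    {f : HSpace 𝒯 hT} : f ∈ (hbox 𝒯 hT a b c d)ᗮ ↔
      ∀ j k, a ≤ j → j ≤ b → c ≤ k → k ≤ d →
        weightForm p (toLaurent 𝒯 hT f * refl (mono j k)) = 0 := by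
  rw [Submodule.mem_orthogonal]
  constructor
  · intro h j k haj hjb hck hkd
    obtain ⟨g, hg⟩ := exists_toLaurent_eq (𝒯 := 𝒯) hT
      (mono_mem_polySpace (j := n) (k := m) (s := j) (t := k) (by omega) (by omega))
    have := h g (by rw [mem_hbox, hg]; exact mono_mem_box (by omega) (by omega))
    rwa [inner_eq_weightForm h𝒯, hg] at this
  · intro h u hu
    rw [inner_eq_weightForm h𝒯, map_mul_refl_eq_sum]
    refine Finset.sum_eq_zero fun a ha => ?_
    have := mem_box_iff.1 (mem_hbox.1 hu) a.1 a.2 (Finsupp.mem_support_iff.1 ha)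
    simp only
    rw [h _ _ this.1.1 this.1.2 this.2.1 this.2.2, mul_zero]

variable (𝒯 hT p) in
/-- The elements of `ℰ¹_{n-1,m}` that are orthogonal to `z ^ j * w ^ k` for all `j < n` and
`1 ≤ k ≤ m`, with respect to `1 / |p| ^ 2`. -/
def lowerOrthogonal : Submodule ℂ (E1 𝒯 hT (n - 1) m) where
  carrier := {f | ∀ j k : ℤ, j < n → 1 ≤ k → k ≤ m →
    weightForm p (toLaurent 𝒯 hT f * refl (mono j k)) = 0}
  zero_mem' := fun j k _ _ _ => by simp
  add_mem' := fun {f g} hf hg j k hj hk hkm => by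
    rw [Submodule.coe_add, map_add, add_mul, map_add, hf j k hj hk hkm, hg j k hj hk hkm, add_zero]
  smul_mem' := fun c f hf j k hj hk hkm => by
    rw [Submodule.coe_smul, map_smul, smul_mul_assoc, map_smul, hf j k hj hk hkm, smul_zero]

include hpm hp h𝒯 in
/-- If `y ∈ H_𝒯` is orthogonal to `z ^ j * w ^ k` for all `j < n` and `1 ≤ k ≤ m`, then so is its
projection to `ℰ¹_{n-1,m}`: the difference lies in `ℱ²_{n,m}`, hence is orthogonal to all
`z ^ j * w ^ k` with `j < n` and `0 ≤ k ≤ m`. -/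
lemma projection_mem_lowerOrthogonal {y : HSpace 𝒯 hT}
    (hy : ∀ j k : ℤ, j < n → 1 ≤ k → k ≤ m →
      weightForm p (toLaurent 𝒯 hT y * refl (mono j k)) = 0) :
    (E1 𝒯 hT (n - 1) m).orthogonalProjectionOnto y ∈ lowerOrthogonal 𝒯 hT p := by
  set x := (E1 𝒯 hT (n - 1) m).orthogonalProjectionOnto y with hx
  have h1 : y - x ∈ (hbox 𝒯 hT 0 (n - 1) 0 m)ᗮ := by
    refine mem_orthogonal_of_mem_inf
      (hbox_mono (by omega) le_rfl zero_le_one le_rfl :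
        hbox 𝒯 hT 0 (n - 1) 1 m ≤ hbox 𝒯 hT 0 (n - 1) 0 m) ?_ ?_
    · refine Submodule.sub_mem _ ?_ (E1_le_orthogonal x.2)
      rw [mem_hbox_orthogonal_iff h𝒯 le_rfl (by omega) zero_le_one le_rfl]
      exact fun j k _ hj hk hkm => hy j k (by omega) hk hkm
    · rw [← E1_eq (by omega) le_rfl]
      exact Submodule.sub_starProjection_mem_orthogonal y
  rw [mem_hbox_orthogonal_iff h𝒯 le_rfl (by omega) le_rfl le_rfl] at h1
  intro j k hj hk hkm
  have hpm' : p ∈ polySpace (n : ℤ) ((m + 1 : ℕ) : ℤ) := by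
    rw [polySpace_eq_box] at hpm ⊢
    exact box_mono le_rfl le_rfl le_rfl (by omega) hpm
  have h2 := weightForm_orthogonal_of_lt hpm' hp (f := toLaurent 𝒯 hT (y - x))
    (by simpa using toLaurent_mem 𝒯 hT (y - x))
    (fun j k hj hjn hk hkm => h1 j k hj (by omega) hk (by omega)) hj (k := k) (by omega) (by omega)
  rw [map_sub, sub_mul, map_sub, hy j k hj hk hkm, zero_sub, neg_eq_zero] at h2
  exact h2

include hpm hp h𝒯 in
/-- The space `lowerOrthogonal` is `T`-invariant, contains the range of `B`, and is annihilated by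
`A`. -/
theorem invariantSpan_le_ker_of_weight : invariantSpan 𝒯 hT ≤ LinearMap.ker (opA 𝒯 hT) := by
  have hle : invariantSpan 𝒯 hT ≤ lowerOrthogonal 𝒯 hT p := by
    refine sInf_le ⟨?_, fun f hf => ?_⟩
    · rintro _ ⟨⟨x, hx⟩, rfl⟩
      refine projection_mem_lowerOrthogonal hpm hp h𝒯 fun j k hj hk hkm => ?_
      obtain ⟨hx1, hx2⟩ := Submodule.mem_inf.1 (mem_shift_F2_iff.1 hx)
      obtain ⟨f, hf, hxf⟩ := exists_eq_mono_mul (s := 0) (t := 1) (by omega) (by omega) (by omega)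
        (by omega) hx1
      rw [mem_hbox_orthogonal_iff h𝒯 le_rfl (by omega) zero_le_one le_rfl] at hx2
      have e : ∀ j k : ℤ, toLaurent 𝒯 hT x * refl (mono j k) =
          toLaurent 𝒯 hT f * refl (mono j (k - 1)) := by
        intro j k
        rw [hxf, mul_comm (mono 0 1), mul_assoc, refl_mono, refl_mono, mono_mul_mono]
        congr 2 <;> ring
      have hf' : toLaurent 𝒯 hT f ∈ polySpace (n : ℤ) (m - 1) := by
        rw [polySpace_eq_box]
        simpa [mem_hbox] using hf
      change weightForm p (toLaurent 𝒯 hT x * _) = 0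
      rw [e]
      refine weightForm_orthogonal_of_lt hpm hp hf' (fun j k hj hjn hk hkm => ?_) hj (by omega)
        (by omega)
      have := hx2 j (k + 1) hj (by omega) (by omega) (by omega)
      rwa [e, add_sub_cancel_right] at this
    · refine projection_mem_lowerOrthogonal hpm hp h𝒯 fun j k hj hk hkm => ?_
      have := hf (j - 1) k (by omega) hk hkm
      rw [toLaurent_Mz, mul_comm (mono 1 0), mul_assoc, refl_mono, mono_mul_mono]
      rw [refl_mono] at this
      convert this using 4 <;> ring
  intro f hf
  rw [LinearMap.mem_ker, opA_eq_zero_iff, mem_E1_top_iff,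
    mem_hbox_orthogonal_iff h𝒯 le_rfl le_rfl zero_le_one le_rfl]
  intro j k _ hj hk hkm
  have := hle hf (j - 1) k (by omega) hk hkm
  rw [toLaurent_Mz, mul_comm (mono 1 0), mul_assoc, refl_mono, mono_mul_mono]
  rw [refl_mono] at this
  convert this using 4 <;> ring

end Condition


/-! ### Kernels of subspaces -/

section Kernel

lemma sup_inf_orthogonal_of_isOrtho {E : Type*} [NormedAddCommGroup E]
    [InnerProductSpace ℂ E] {U V : Submodule ℂ E} (h : U ⟂ V) : (U ⊔ V) ⊓ Uᗮ = V := by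
  refine le_antisymm (fun f hf => ?_) (le_inf le_sup_right h.symm.le)
  exact mem_of_mem_sup_of_orthogonal h hf.1 hf.2

variable {E : Type*} [NormedAddCommGroup E] [InnerProductSpace ℂ E] [FiniteDimensional ℂ E]

/-- The kernel of a subspace `S`, evaluated at two linear forms: `∑ i, φ (b i) * conj (ψ (b i))` for
any orthonormal basis `b` of `S` (`subspaceKernel_eq_sum`). -/
def subspaceKernel (S : Submodule ℂ E) (φ ψ : E →ₗ[ℂ] ℂ) : ℂ :=
  φ (S.starProjection ((InnerProductSpace.toDual ℂ E).symm (LinearMap.toContinuousLinearMap ψ)))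

lemma subspaceKernel_eq_sum {S : Submodule ℂ E} {ι : Type*} [Fintype ι]
    (b : OrthonormalBasis ι ℂ S) (φ ψ : E →ₗ[ℂ] ℂ) :
    subspaceKernel S φ ψ = ∑ i, φ (b i) * conj (ψ (b i)) := by
  have h : ∀ i, conj (ψ (b i)) =
      ⟪(b i : E), (InnerProductSpace.toDual ℂ E).symm (LinearMap.toContinuousLinearMap ψ)⟫_ℂ := by
    intro i
    rw [← inner_conj_symm, InnerProductSpace.toDual_symm_apply]
    rfl
  rw [subspaceKernel, Submodule.starProjection_apply, b.orthogonalProjectionOnto_apply_eq_sum]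
  simp only [h, Submodule.coe_sum, Submodule.coe_smul, map_sum, map_smul, smul_eq_mul, mul_comm]

lemma subspaceKernel_smul (S : Submodule ℂ E) (φ ψ : E →ₗ[ℂ] ℂ) {c : ℂ} (hc : ‖c‖ = 1) :
    subspaceKernel S (c • φ) (c • ψ) = subspaceKernel S φ ψ := by
  rw [subspaceKernel_eq_sum (stdOrthonormalBasis ℂ S),
    subspaceKernel_eq_sum (stdOrthonormalBasis ℂ S)]
  refine Finset.sum_congr rfl fun i _ => ?_
  simp only [LinearMap.smul_apply, smul_eq_mul, map_mul]
  rw [mul_mul_mul_comm, Complex.mul_conj', hc]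
  simp

lemma subspaceKernel_add_inf_orthogonal {U V : Submodule ℂ E} (h : U ≤ V) (φ ψ : E →ₗ[ℂ] ℂ) :
    subspaceKernel V φ ψ = subspaceKernel U φ ψ + subspaceKernel (V ⊓ Uᗮ) φ ψ := by
  rw [subspaceKernel, subspaceKernel, subspaceKernel, ← map_add]
  congr 1
  set x := (InnerProductSpace.toDual ℂ E).symm (LinearMap.toContinuousLinearMap ψ)
  have h1 : V.starProjection x = U.starProjection x + (V ⊓ Uᗮ).starProjection x := by
    refine Submodule.eq_starProjection_of_mem_orthogonal (Submodule.add_mem _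
      (h (Submodule.starProjection_apply_mem _ _))
      (Submodule.starProjection_apply_mem (V ⊓ Uᗮ) x).1) ?_
    refine mem_orthogonal_of_mem_inf h ?_ ?_
    · rw [← sub_sub]
      exact Submodule.sub_mem _ (Submodule.sub_starProjection_mem_orthogonal x)
        (Submodule.starProjection_apply_mem (V ⊓ Uᗮ) x).2
    · rw [add_comm, ← sub_sub]
      refine Submodule.sub_mem _ (Submodule.sub_starProjection_mem_orthogonal x) ?_
      exact Submodule.orthogonal_le inf_le_right
        (Submodule.le_orthogonal_orthogonal _ (Submodule.starProjection_apply_mem _ _))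
  exact h1

lemma subspaceKernel_sup {U V : Submodule ℂ E} (h : U ⟂ V) (φ ψ : E →ₗ[ℂ] ℂ) :
    subspaceKernel (U ⊔ V) φ ψ = subspaceKernel U φ ψ + subspaceKernel V φ ψ := by
  rw [subspaceKernel_add_inf_orthogonal (le_sup_left : U ≤ U ⊔ V),
    sup_inf_orthogonal_of_isOrtho h]

lemma finrank_sup_of_isOrtho {U V : Submodule ℂ E} (h : U ⟂ V) :
    Module.finrank ℂ (U ⊔ V : Submodule ℂ E) = Module.finrank ℂ U + Module.finrank ℂ V := by
  rw [← Submodule.finrank_add_inf_finrank_orthogonal (le_sup_left : U ≤ U ⊔ V), inf_comm,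
    sup_inf_orthogonal_of_isOrtho h]

lemma subspaceKernel_range {S : Submodule ℂ E} (V : S →ₗᵢ[ℂ] E) {φ ψ φ' ψ' : E →ₗ[ℂ] ℂ}
    (hφ : ∀ x, φ (V x) = φ' x) (hψ : ∀ x, ψ (V x) = ψ' x) :
    subspaceKernel (LinearMap.range V.toLinearMap) φ ψ = subspaceKernel S φ' ψ' := by
  rw [subspaceKernel_eq_sum ((stdOrthonormalBasis ℂ S).map V.equivRange),
    subspaceKernel_eq_sum (stdOrthonormalBasis ℂ S)]
  refine Finset.sum_congr rfl fun i _ => ?_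
  rw [← hφ, ← hψ]
  rfl

/-- A conjugate linear isometry of `S` onto itself interchanges the arguments of the kernel. -/
lemma subspaceKernel_conj {S : Submodule ℂ E} (R : S → S)
    (hR : ∀ x y, ⟪R x, R y⟫_ℂ = ⟪y, x⟫_ℂ) {φ ψ φ' ψ' : E →ₗ[ℂ] ℂ}
    (hφ : ∀ x, φ (R x) = conj (φ' x)) (hψ : ∀ x, ψ (R x) = conj (ψ' x)) :
    subspaceKernel S φ ψ = subspaceKernel S ψ' φ' := by
  set b := stdOrthonormalBasis ℂ S with hb
  have ho : Orthonormal ℂ fun i => R (b i) := by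
    rw [orthonormal_iff_ite]
    intro i j
    rw [hR, orthonormal_iff_ite.1 b.orthonormal]
    simp only [eq_comm]
  have hspan : ⊤ ≤ Submodule.span ℂ (Set.range fun i => R (b i)) := by
    refine (LinearIndependent.span_eq_top_of_card_eq_finrank' ho.linearIndependent ?_).ge
    simp
  rw [subspaceKernel_eq_sum (OrthonormalBasis.mk ho hspan), subspaceKernel_eq_sum b]
  refine Finset.sum_congr rfl fun i _ => ?_
  rw [OrthonormalBasis.coe_mk, hφ, hψ, Complex.conj_conj, mul_comm]

end Kernel

/-! ### The kernel of `ℱ²_{n,m}` -/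

section SplitShiftKernel

variable {n m : ℕ} {𝒯 : laurentSpace n m →ₗ[ℂ] ℂ} {hT : IsPositive 𝒯}

/-- Multiplication by a monomial, as an isometry on a subspace where it stays in `P_{n,m}`. -/
def shiftIsometry (s t : ℤ) (S : Submodule ℂ (HSpace 𝒯 hT))
    (hS : ∀ f ∈ S, mono s t * toLaurent 𝒯 hT f ∈ polySpace (n : ℤ) m) :
    S →ₗᵢ[ℂ] HSpace 𝒯 hT :=
  LinearMap.isometryOfInner
    (LinearMap.codRestrict (polySpace (n : ℤ) m)
      (LinearMap.mulLeft ℂ (mono s t) ∘ₗ toLaurent 𝒯 hT ∘ₗ S.subtype) fun f => hS f f.2 :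
        S →ₗ[ℂ] HSpace 𝒯 hT)
    fun f g => inner_shift (f := (g : HSpace 𝒯 hT)) (g := (f : HSpace 𝒯 hT)) (s := s) (t := t)
      rfl rfl

lemma toLaurent_shiftIsometry {s t : ℤ} {S : Submodule ℂ (HSpace 𝒯 hT)}
    (hS : ∀ f ∈ S, mono s t * toLaurent 𝒯 hT f ∈ polySpace (n : ℤ) m) (f : S) :
    toLaurent 𝒯 hT (shiftIsometry s t S hS f) = mono s t * toLaurent 𝒯 hT f := rfl

lemma range_shiftIsometry {s t : ℤ} {S : Submodule ℂ (HSpace 𝒯 hT)}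
    (hS : ∀ f ∈ S, mono s t * toLaurent 𝒯 hT f ∈ polySpace (n : ℤ) m) :
    LinearMap.range (shiftIsometry s t S hS).toLinearMap = shift s t S := by
  ext f
  rw [mem_shift, LinearMap.mem_range]
  constructor
  · rintro ⟨g, rfl⟩
    exact ⟨g, g.2, rfl⟩
  · rintro ⟨g, hg, h⟩
    exact ⟨⟨g, hg⟩, toLaurent_injective 𝒯 hT h⟩

lemma finrank_shift {s t : ℤ} {S : Submodule ℂ (HSpace 𝒯 hT)}
    (hS : ∀ f ∈ S, mono s t * toLaurent 𝒯 hT f ∈ polySpace (n : ℤ) m) :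
    Module.finrank ℂ (shift s t S) = Module.finrank ℂ S := by
  rw [← range_shiftIsometry hS]
  exact (shiftIsometry s t S hS).equivRange.toLinearEquiv.finrank_eq.symm

variable (𝒯 hT) in
/-- The kernel of a subspace of `H_𝒯`, evaluated at the coefficients of `w ^ u` and `w ^ k` at a
fixed value of `z`. -/
def fiberKernel (S : Submodule ℂ (HSpace 𝒯 hT)) (z : ℂ) (u k : ℤ) : ℂ :=
  subspaceKernel S (fiberCoeff z u ∘ₗ toLaurent 𝒯 hT) (fiberCoeff z k ∘ₗ toLaurent 𝒯 hT)

/-- On `|z| = 1`, multiplication by `z` does not affect the kernel, and multiplication by `w` moves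
the indices. -/
lemma fiberKernel_shift {s t : ℤ} {S : Submodule ℂ (HSpace 𝒯 hT)}
    (hS : ∀ f ∈ S, mono s t * toLaurent 𝒯 hT f ∈ polySpace (n : ℤ) m) {z : ℂ} (hz : ‖z‖ = 1)
    (u k : ℤ) : fiberKernel 𝒯 hT (shift s t S) z u k = fiberKernel 𝒯 hT S z (u - t) (k - t) := by
  have hz0 : z ≠ 0 := norm_ne_zero_iff.1 (by simp [hz])
  rw [← range_shiftIsometry hS, fiberKernel, fiberKernel,
    ← subspaceKernel_smul S _ _ (c := z ^ s) (by simp [hz])]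
  refine subspaceKernel_range _ (fun x => ?_) (fun x => ?_) <;>
  · rw [LinearMap.comp_apply, toLaurent_shiftIsometry, fiberCoeff_mono_mul hz0]
    rfl

lemma refl_mem_box {a b c d : ℤ} {f : Laurent} (hf : f ∈ box a b c d) :
    refl f ∈ box (-b) (-a) (-d) (-c) := by
  have e : refl f = f.coeff.sum fun x r => conj r • mono (-x.1) (-x.2) := by
    conv_lhs => rw [← AddMonoidAlgebra.sum_coeff_single f]
    rw [Finsupp.sum, Finsupp.sum, map_sum]
    refine Finset.sum_congr rfl fun x _ => ?_
    rw [single_eq_smul_mono, refl_smul, refl_mono]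
  rw [e]
  refine Submodule.sum_mem _ fun x hx => Submodule.smul_mem _ _ (mono_mem_box ?_ ?_)
  · have := (mem_box_iff.1 hf _ _ (Finsupp.mem_support_iff.1 hx)).1
    omega
  · have := (mem_box_iff.1 hf _ _ (Finsupp.mem_support_iff.1 hx)).2
    omega

/-- The reflection `f ↦ z ^ a * w ^ b * f̄(1/z, 1/w)` of `P_{a,b}` yields a symmetry of its
kernel. -/
lemma fiberKernel_hbox_reflect {a b : ℤ} (ha : a ≤ n) (hb : b ≤ m) {z : ℂ} (hz : ‖z‖ = 1)
    (u k : ℤ) : fiberKernel 𝒯 hT (hbox 𝒯 hT 0 a 0 b) z u k =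
      fiberKernel 𝒯 hT (hbox 𝒯 hT 0 a 0 b) z (b - k) (b - u) := by
  have hz0 : z ≠ 0 := norm_ne_zero_iff.1 (by simp [hz])
  have hmem : ∀ f : hbox 𝒯 hT 0 a 0 b,
      mono a b * refl (toLaurent 𝒯 hT f) ∈ box 0 a 0 b := fun f => by
    rw [mono_mul_mem_box_iff]
    simpa using refl_mem_box (mem_hbox.1 f.2)
  have hex : ∀ f : hbox 𝒯 hT 0 a 0 b, ∃ g : hbox 𝒯 hT 0 a 0 b,
      toLaurent 𝒯 hT g = mono a b * refl (toLaurent 𝒯 hT f) := fun f => by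
    obtain ⟨g, hg⟩ := exists_toLaurent_eq (𝒯 := 𝒯) hT (polySpace_eq_box _ _ ▸
      box_mono le_rfl ha le_rfl hb (hmem f))
    exact ⟨⟨g, by rw [mem_hbox, hg]; exact hmem f⟩, hg⟩
  choose R hR using hex
  have hinner : ∀ x y, ⟪R x, R y⟫_ℂ = ⟪y, x⟫_ℂ := fun x y => by
    refine inner_congr ?_
    change toLaurent 𝒯 hT (R y : HSpace 𝒯 hT) * refl (toLaurent 𝒯 hT (R x : HSpace 𝒯 hT)) =
      toLaurent 𝒯 hT (x : HSpace 𝒯 hT) * refl (toLaurent 𝒯 hT (y : HSpace 𝒯 hT))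
    rw [hR, hR, map_mul, refl_refl, refl_mono, mul_mul_mul_comm, mono_mul_mono, add_neg_cancel,
      add_neg_cancel, mono_zero_zero, one_mul, mul_comm]
  have hcoeff : ∀ v x, (fiberCoeff z v ∘ₗ toLaurent 𝒯 hT) (R x) =
      conj ((z ^ (-a) • (fiberCoeff z (b - v) ∘ₗ toLaurent 𝒯 hT)) x) := fun v x => by
    rw [LinearMap.comp_apply, hR, fiberCoeff_mono_mul hz0, fiberCoeff_refl hz, LinearMap.smul_apply,
      smul_eq_mul, map_mul, conj_zpow_of_norm_eq_one hz, neg_neg, neg_sub]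
    rfl
  rw [fiberKernel, subspaceKernel_conj R hinner (hcoeff u) (hcoeff k),
    subspaceKernel_smul _ _ _ (by simp [hz])]
  rfl

/-- The Christoffel–Darboux formula in `w`: the kernel of `P_{a,m}` is expressed through that of
`ℰ¹_{a,m}`. -/
lemma fiberKernel_hbox_sub {a : ℤ} (ha : a ≤ n) {z : ℂ} (hz : ‖z‖ = 1) (u k : ℤ) :
    fiberKernel 𝒯 hT (hbox 𝒯 hT 0 a 0 m) z u k -
        fiberKernel 𝒯 hT (hbox 𝒯 hT 0 a 0 m) z (u - 1) (k - 1) =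
      fiberKernel 𝒯 hT (E1 𝒯 hT a m) z u k -
        fiberKernel 𝒯 hT (E1 𝒯 hT a m) z (m + 1 - k) (m + 1 - u) := by
  have hE : ∀ u k, fiberKernel 𝒯 hT (hbox 𝒯 hT 0 a 0 m) z u k =
      fiberKernel 𝒯 hT (hbox 𝒯 hT 0 a 0 (m - 1)) z (u - 1) (k - 1) +
        fiberKernel 𝒯 hT (E1 𝒯 hT a m) z u k := fun u k => by
    have hs : hbox 𝒯 hT 0 a 1 m = shift 0 1 (hbox 𝒯 hT 0 a 0 (m - 1)) := by
      rw [← P_eq_hbox, shift_P le_rfl (by omega) zero_le_one (by omega), add_zero, sub_add_cancel]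
    rw [fiberKernel, subspaceKernel_add_inf_orthogonal
      (hbox_mono le_rfl le_rfl zero_le_one le_rfl : hbox 𝒯 hT 0 a 1 m ≤ _), ← E1_eq ha le_rfl, hs]
    congr 1
    refine fiberKernel_shift (fun f hf => ?_) hz u k
    rw [polySpace_eq_box, mono_mul_mem_box_iff]
    exact box_mono (by omega) (by omega) (by omega) (by omega) hf
  rw [fiberKernel_hbox_reflect ha le_rfl hz (u - 1) (k - 1), hE u k,
    show (m : ℤ) - (k - 1) = m + 1 - k by ring, show (m : ℤ) - (u - 1) = m + 1 - u by ring,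
    hE (m + 1 - k), fiberKernel_hbox_reflect ha (by omega) hz (u - 1) (k - 1),
    show (m : ℤ) - 1 - (k - 1) = m + 1 - k - 1 by ring,
    show (m : ℤ) - 1 - (u - 1) = m + 1 - u - 1 by ring]
  ring

/-- Split-shift orthogonality produces a polynomial `p`, which spans the orthogonal complement of
`K₁ ⊕ z K₂` in `ℰ¹_{n,m}`, such that the kernel of `ℱ²_{n,m}` is, for `|z| = 1`, the
Christoffel–Darboux kernel of `p(z, ·)`. -/
theorem exists_fiberKernel_F2_recurrence (h : SplitShift 𝒯 hT) :
    ∃ p ∈ polySpace (n : ℤ) m, ∀ z : ℂ, ‖z‖ = 1 → ∀ u k : ℤ,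
      fiberKernel 𝒯 hT (F2 𝒯 hT n m) z u k =
        fiberKernel 𝒯 hT (F2 𝒯 hT n m) z (u - 1) (k - 1) +
          fiberCoeff z u p * conj (fiberCoeff z k p) -
          conj (fiberCoeff z (m + 1 - u) p) * fiberCoeff z (m + 1 - k) p := by
  obtain ⟨K₁, K₂, ⟨h12, hsup⟩, hz, h1, h2⟩ := h
  have hK2 : ∀ f ∈ K₂, mono 1 0 * toLaurent 𝒯 hT f ∈ polySpace (n : ℤ) m := fun f hf => by
    have := E1_le (hsup ▸ Submodule.mem_sup_right hf)
    rw [polySpace_eq_box, mono_mul_mem_box_iff]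
    exact box_mono (by omega) (by omega) (by omega) (by omega) this
  have hU : K₁ ⊔ shift 1 0 K₂ ≤ E1 𝒯 hT n m := sup_le h1 h2
  have hfr1 : Module.finrank ℂ (K₁ ⊔ shift 1 0 K₂ : Submodule ℂ (HSpace 𝒯 hT)) = n := by
    rw [finrank_sup_of_isOrtho hz, finrank_shift hK2, ← finrank_sup_of_isOrtho h12, hsup,
      finrank_E1 (by omega) (by omega)]
    omega
  have hfr : Module.finrank ℂ
      (E1 𝒯 hT n m ⊓ (K₁ ⊔ shift 1 0 K₂)ᗮ : Submodule ℂ (HSpace 𝒯 hT)) = 1 := by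
    have := Submodule.finrank_add_inf_finrank_orthogonal hU
    rw [hfr1, finrank_E1 le_rfl (by omega), inf_comm] at this
    omega
  set b := (stdOrthonormalBasis ℂ
    (E1 𝒯 hT n m ⊓ (K₁ ⊔ shift 1 0 K₂)ᗮ : Submodule ℂ (HSpace 𝒯 hT))).reindex
      (finCongr hfr) with hb
  refine ⟨toLaurent 𝒯 hT (b 0), toLaurent_mem 𝒯 hT _, fun z hz1 => ?_⟩
  have hF : ∀ u k, fiberKernel 𝒯 hT (hbox 𝒯 hT 0 n 0 m) z u k =
      fiberKernel 𝒯 hT (hbox 𝒯 hT 0 (n - 1) 0 m) z u k +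
        fiberKernel 𝒯 hT (F2 𝒯 hT n m) z u k := fun u k => by
    rw [F2_eq]
    exact subspaceKernel_add_inf_orthogonal (hbox_mono le_rfl (by omega) le_rfl le_rfl) _ _
  have hE : ∀ u k, fiberKernel 𝒯 hT (E1 𝒯 hT n m) z u k =
      fiberKernel 𝒯 hT (E1 𝒯 hT (n - 1) m) z u k +
        fiberCoeff z u (toLaurent 𝒯 hT (b 0)) *
          conj (fiberCoeff z k (toLaurent 𝒯 hT (b 0))) := fun u k => by
    rw [fiberKernel, subspaceKernel_add_inf_orthogonal hU, subspaceKernel_sup hz,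
      subspaceKernel_eq_sum b, Fin.sum_univ_one, fiberKernel, ← hsup, subspaceKernel_sup h12]
    congr 2
    -- `K₂` and `z K₂` have the same kernel
    have := fiberKernel_shift hK2 hz1 u k
    rw [sub_zero, sub_zero] at this
    exact this
  intro u k
  have e1 := fiberKernel_hbox_sub (𝒯 := 𝒯) (hT := hT) (a := n) le_rfl hz1 u k
  have e2 := fiberKernel_hbox_sub (𝒯 := 𝒯) (hT := hT) (a := n - 1) (by omega) hz1 u k
  rw [hF, hF, hE, hE] at e1
  linear_combination e1 - e2

end SplitShiftKernel


/-! ### The truncated shift on `P_{n-1,m}` -/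

/-- If all eigenvalues of an operator on a finite dimensional space have absolute value less than
`1`, its powers tend to zero, by Gelfand's formula for the spectral radius. -/
lemma tendsto_pow_apply_of_eigenvalue_lt {V : Type*} [NormedAddCommGroup V] [NormedSpace ℂ V]
    [FiniteDimensional ℂ V] (C : V →L[ℂ] V)
    (h : ∀ (c : ℂ) (v : V), C v = c • v → v ≠ 0 → ‖c‖ < 1) (v : V) :
    Filter.Tendsto (fun N : ℕ => (C ^ N) v) Filter.atTop (nhds 0) := by
  rcases subsingleton_or_nontrivial V with hV | hV
  · simp only [Subsingleton.elim _ (0 : V)]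
    exact tendsto_const_nhds
  have : CompleteSpace V := FiniteDimensional.complete ℂ V
  have hr : spectralRadius ℂ C < (1 : NNReal) := by
    refine spectrum.spectralRadius_lt_of_forall_lt C fun c hc => ?_
    have hc' : c ∈ spectrum ℂ (C : V →ₗ[ℂ] V) := by
      rwa [← AlgEquiv.spectrum_eq (Module.End.toContinuousLinearMap V) (C : V →ₗ[ℂ] V)]
    obtain ⟨v, hv⟩ := (Module.End.hasEigenvalue_iff_mem_spectrum.2 hc').exists_hasEigenvector
    exact h c v hv.apply_eq_smul hv.2
  obtain ⟨r, hr1, hr2⟩ := ENNReal.lt_iff_exists_nnreal_btwn.1 hr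
  have hlim := spectrum.pow_nnnorm_pow_one_div_tendsto_nhds_spectralRadius C
  have hev : ∀ᶠ N : ℕ in Filter.atTop, ‖(C ^ N) v‖ ≤ (r : ℝ) ^ N * ‖v‖ := by
    filter_upwards [hlim.eventually_lt_const hr1, Filter.eventually_gt_atTop 0] with N hN hN0
    refine ((C ^ N).le_opNorm v).trans (mul_le_mul_of_nonneg_right ?_ (norm_nonneg v))
    rw [one_div, ENNReal.rpow_inv_lt_iff (by exact_mod_cast hN0), ENNReal.rpow_natCast] at hN
    exact_mod_cast hN.le
  refine squeeze_zero_norm' hev ?_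
  have := (tendsto_pow_atTop_nhds_zero_of_lt_one r.2 (by exact_mod_cast hr2)).mul_const ‖v‖
  simpa using this

/-- The compression of an isometry `Z : V → E` to `V` is a contraction, and an eigenvector for an
eigenvalue of absolute value at least `1` would be an eigenvector of `Z` itself. If there are none,
the powers of the compression tend to zero. -/
lemma tendsto_compression_pow {E : Type*} [NormedAddCommGroup E] [InnerProductSpace ℂ E]
    [FiniteDimensional ℂ E] {V : Submodule ℂ E} (Z : V →ₗᵢ[ℂ] E)
    (hZ : ∀ (c : ℂ) (v : V), Z v = c • (v : E) → v = 0) (v : V) :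
    Filter.Tendsto (fun N : ℕ => ((V.orthogonalProjectionOnto ∘L Z.toContinuousLinearMap) ^ N) v)
      Filter.atTop (nhds 0) := by
  refine tendsto_pow_apply_of_eigenvalue_lt _ (fun c v hv hv0 => ?_) v
  by_contra! hc
  refine hv0 (hZ c v ?_)
  have e : V.starProjection (Z v) = c • (v : E) := congrArg Subtype.val hv
  have hle : ‖c • (v : E)‖ ≤ ‖Z v‖ := e ▸ V.norm_starProjection_apply_le (Z v)
  have hge : ‖Z v‖ ≤ ‖c • (v : E)‖ := by
    rw [Z.norm_map, norm_smul]
    exact le_mul_of_one_le_left (norm_nonneg _) hc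
  rw [← e]
  refine ((Submodule.starProjection_eq_self_iff).2 ?_).symm
  exact (V.mem_iff_norm_starProjection (Z v)).2 (e ▸ le_antisymm hle hge)

section TruncatedShift

variable {n m : ℕ} {𝒯 : laurentSpace n m →ₗ[ℂ] ℂ} {hT : IsPositive 𝒯}

lemma mono_mul_mem_of_mem_hbox (f : HSpace 𝒯 hT) (hf : f ∈ hbox 𝒯 hT 0 (n - 1) 0 m) :
    mono 1 0 * toLaurent 𝒯 hT f ∈ polySpace (n : ℤ) m := by
  rw [polySpace_eq_box, mono_mul_mem_box_iff]
  exact box_mono (by omega) (by omega) (by omega) (by omega) hf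

variable (𝒯 hT) in
/-- Multiplication by `z` on `P_{n-1,m}`, followed by the orthogonal projection back onto
`P_{n-1,m}`. -/
def truncatedShift : hbox 𝒯 hT 0 (n - 1) 0 m →L[ℂ] hbox 𝒯 hT 0 (n - 1) 0 m :=
  (hbox 𝒯 hT 0 (n - 1) 0 m).orthogonalProjectionOnto ∘L
    (shiftIsometry 1 0 (hbox 𝒯 hT 0 (n - 1) 0 m) mono_mul_mem_of_mem_hbox).toContinuousLinearMap

lemma F2_top_eq : F2 𝒯 hT n m = (hbox 𝒯 hT 0 (n - 1) 0 m)ᗮ := by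
  rw [F2_eq, hbox_eq_top, top_inf_eq]

/-- `z * g` is the sum of its truncation and an element of `ℱ²_{n,m}`. -/
lemma exists_eq_add_truncatedShift (g : hbox 𝒯 hT 0 (n - 1) 0 m) :
    ∃ f ∈ F2 𝒯 hT n m, mono 1 0 * toLaurent 𝒯 hT g =
      toLaurent 𝒯 hT f + toLaurent 𝒯 hT (truncatedShift 𝒯 hT g) := by
  have e : (truncatedShift 𝒯 hT g : HSpace 𝒯 hT) = (hbox 𝒯 hT 0 (n - 1) 0 m).starProjection
      (shiftIsometry 1 0 (hbox 𝒯 hT 0 (n - 1) 0 m) mono_mul_mem_of_mem_hbox g) := rfl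
  refine ⟨shiftIsometry 1 0 (hbox 𝒯 hT 0 (n - 1) 0 m) mono_mul_mem_of_mem_hbox g -
    truncatedShift 𝒯 hT g, ?_, ?_⟩
  · rw [F2_top_eq, e]
    exact Submodule.sub_starProjection_mem_orthogonal _
  · rw [← map_add, ← toLaurent_shiftIsometry mono_mul_mem_of_mem_hbox g]
    exact congrArg _ (sub_add_cancel _ _).symm

lemma tendsto_truncatedShift_pow (g : hbox 𝒯 hT 0 (n - 1) 0 m) :
    Filter.Tendsto (fun N : ℕ => (truncatedShift 𝒯 hT ^ N) g) Filter.atTop (nhds 0) := by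
  refine tendsto_compression_pow
    (shiftIsometry 1 0 (hbox 𝒯 hT 0 (n - 1) 0 m) mono_mul_mem_of_mem_hbox) (fun c v hv => ?_) g
  have h : ∀ s t, (toLaurent 𝒯 hT v).coeff (s - 1, t) = c * (toLaurent 𝒯 hT v).coeff (s, t) := by
    intro s t
    have := congrArg (fun f => (toLaurent 𝒯 hT f).coeff (s, t)) hv
    simp only [toLaurent_shiftIsometry, coeff_mono_mul, sub_zero, map_smul] at this
    simpa using this
  -- a nonzero coefficient would propagate to all higher powers of `z`
  have h0 : ∀ s t, (toLaurent 𝒯 hT v).coeff (s, t) = 0 := by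
    intro s t
    by_contra hne
    have hall : ∀ k : ℕ, (toLaurent 𝒯 hT v).coeff (s + k, t) ≠ 0 := by
      intro k
      induction k with
      | zero => simpa using hne
      | succ k ih =>
        intro h1
        have := h (s + (k + 1 : ℕ)) t
        rw [h1, mul_zero] at this
        refine ih ?_
        convert this using 3
        push_cast
        ring
    have h1 := mem_polySpace_iff.1 (toLaurent_mem 𝒯 hT v) _ _ (hall 0)
    have h2 := mem_polySpace_iff.1 (toLaurent_mem 𝒯 hT v) _ _ (hall (n + 1))
    omega
  refine Subtype.ext (toLaurent_injective 𝒯 hT ?_)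
  rw [Submodule.coe_zero, map_zero]
  ext a
  exact h0 a.1 a.2

lemma exists_eq_add_of_hbox (f : HSpace 𝒯 hT) :
    ∃ g : hbox 𝒯 hT 0 (n - 1) 0 m, ∃ f' ∈ F2 𝒯 hT n m, f = g + f' := by
  rw [F2_top_eq]
  exact ⟨(hbox 𝒯 hT 0 (n - 1) 0 m).orthogonalProjectionOnto f, _,
    Submodule.sub_starProjection_mem_orthogonal f, (add_sub_cancel _ _).symm⟩

/-- A linear form for which multiplication by `z` amounts to multiplication by a number of absolute
value `1` vanishes as soon as it vanishes on `ℱ²_{n,m}`: its absolute value on `P_{n-1,m}` is then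
invariant under the truncated shift. -/
lemma eq_zero_of_forall_F2 {φ : Laurent →ₗ[ℂ] ℂ} {z : ℂ} (hz : ‖z‖ = 1)
    (hφ : ∀ f, φ (mono 1 0 * f) = z * φ f) (h : ∀ f ∈ F2 𝒯 hT n m, φ (toLaurent 𝒯 hT f) = 0)
    (f : HSpace 𝒯 hT) : φ (toLaurent 𝒯 hT f) = 0 := by
  obtain ⟨g, f', hf', rfl⟩ := exists_eq_add_of_hbox f
  rw [map_add, map_add, h f' hf', add_zero]
  have hC : ∀ g : hbox 𝒯 hT 0 (n - 1) 0 m,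
      ‖φ (toLaurent 𝒯 hT (truncatedShift 𝒯 hT g))‖ = ‖φ (toLaurent 𝒯 hT g)‖ := fun g => by
    obtain ⟨f, hf, e⟩ := exists_eq_add_truncatedShift g
    have := congrArg (fun x => ‖φ x‖) e
    simp only [hφ, map_add, h f hf, zero_add, norm_mul, hz, one_mul] at this
    exact this.symm
  have hN : ∀ N : ℕ, ‖φ (toLaurent 𝒯 hT ((truncatedShift 𝒯 hT ^ N) g))‖ =
      ‖φ (toLaurent 𝒯 hT g)‖ := fun N => by
    induction N with
    | zero => rfl
    | succ N ih =>
      rw [pow_succ']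
      exact (hC _).trans ih
  have hlim : Filter.Tendsto
      (fun N : ℕ => ‖φ (toLaurent 𝒯 hT ((truncatedShift 𝒯 hT ^ N) g))‖) Filter.atTop (nhds 0) := by
    have hc : Continuous (φ ∘ₗ toLaurent 𝒯 hT ∘ₗ (hbox 𝒯 hT 0 (n - 1) 0 m).subtype) :=
      LinearMap.continuous_of_finiteDimensional _
    have := ((hc.tendsto 0).comp (tendsto_truncatedShift_pow g)).norm
    rwa [map_zero, norm_zero] at this
  simp only [hN] at hlim
  exact norm_eq_zero.1 (tendsto_nhds_unique tendsto_const_nhds hlim)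

/-! ### The polynomial `p` has no zeros on `𝕋 × 𝔻̄` -/

lemma eval_mono_mul {z : ℂ} (hz : z ≠ 0) (w : ℂ) (f : Laurent) :
    eval z w (mono 1 0 * f) = z * eval z w f := by
  induction f using laurent_induction with
  | mono s t =>
    rw [mono_mul_mono, eval_mono, eval_mono, zero_add, zpow_add₀ hz, zpow_one, mul_assoc]
  | add f g hf hg => rw [mul_add, map_add, map_add, hf, hg, mul_add]
  | smul c f hf => rw [mul_smul_comm, map_smul, map_smul, hf, smul_eq_mul, smul_eq_mul]; ring

lemma continuous_eval {j : ℤ} {L : ℕ} {f : Laurent} (hf : f ∈ polySpace j L) (z : ℂ) :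
    Continuous fun w => eval z w f := by
  have : ∀ w, eval z w f = ∑ u ∈ Finset.range (L + 1), fiberCoeff z u f * w ^ u :=
    eval_eq_sum_fiberCoeff (j := j) (by simpa using hf) z
  simp only [this]
  fun_prop

variable {p : Laurent} (hpm : p ∈ polySpace (n : ℤ) m) {z : ℂ} (hz : ‖z‖ = 1)
  (hκ : ∀ u k : ℤ, fiberKernel 𝒯 hT (F2 𝒯 hT n m) z u k =
    fiberKernel 𝒯 hT (F2 𝒯 hT n m) z (u - 1) (k - 1) +
      fiberCoeff z u p * conj (fiberCoeff z k p) -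
      conj (fiberCoeff z (m + 1 - u) p) * fiberCoeff z (m + 1 - k) p)

lemma fiberKernel_eq_zero {S : Submodule ℂ (HSpace 𝒯 hT)} {u k : ℤ}
    (h : u < 0 ∨ (m : ℤ) < u ∨ k < 0 ∨ (m : ℤ) < k) (z : ℂ) : fiberKernel 𝒯 hT S z u k = 0 := by
  rw [fiberKernel, subspaceKernel_eq_sum (stdOrthonormalBasis ℂ S)]
  refine Finset.sum_eq_zero fun i _ => ?_
  simp only [LinearMap.comp_apply]
  rcases or_assoc.2 h with h | h
  · rw [fiberCoeff_eq_zero (toLaurent_mem 𝒯 hT _) h, zero_mul]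
  · rw [fiberCoeff_eq_zero (toLaurent_mem 𝒯 hT _) h, map_zero, mul_zero]

lemma subspaceKernel_eval (S : Submodule ℂ (HSpace 𝒯 hT)) (z w η : ℂ) :
    subspaceKernel S (eval z w ∘ₗ toLaurent 𝒯 hT) (eval z η ∘ₗ toLaurent 𝒯 hT) =
      ∑ u ∈ Finset.range (m + 1), ∑ k ∈ Finset.range (m + 1),
        fiberKernel 𝒯 hT S z u k * (w ^ u * conj η ^ k) := by
  have hev : ∀ (w : ℂ) (f : HSpace 𝒯 hT), eval z w (toLaurent 𝒯 hT f) =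
      ∑ u ∈ Finset.range (m + 1), fiberCoeff z u (toLaurent 𝒯 hT f) * w ^ u := fun w f =>
    eval_eq_sum_fiberCoeff (j := n) (by simpa using toLaurent_mem 𝒯 hT f) z w
  simp only [fiberKernel, subspaceKernel_eq_sum (stdOrthonormalBasis ℂ S), LinearMap.comp_apply,
    hev, map_sum, map_mul, map_pow, Finset.sum_mul, Finset.mul_sum]
  conv_rhs => rw [Finset.sum_comm]
  rw [Finset.sum_comm]
  refine Finset.sum_congr rfl fun u _ => ?_
  rw [Finset.sum_comm]
  exact Finset.sum_congr rfl fun k _ => Finset.sum_congr rfl fun i _ => by ring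

include hpm hκ in
/-- The Christoffel–Darboux formula for the kernel of `ℱ²_{n,m}`. -/
lemma one_sub_mul_subspaceKernel_F2 (w η : ℂ) :
    (1 - w * conj η) * subspaceKernel (F2 𝒯 hT n m) (eval z w ∘ₗ toLaurent 𝒯 hT)
        (eval z η ∘ₗ toLaurent 𝒯 hT) =
      eval z w p * conj (eval z η p) -
        (∑ u ∈ Finset.range (m + 2), conj (fiberCoeff z (m + 1 - u) p) * w ^ u) *
          conj (∑ u ∈ Finset.range (m + 2), conj (fiberCoeff z (m + 1 - u) p) * η ^ u) := by
  set κ := fiberKernel 𝒯 hT (F2 𝒯 hT n m) z with hκdef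
  have hp : ∀ w, eval z w p = ∑ u ∈ Finset.range (m + 2), fiberCoeff z u p * w ^ u := fun w => by
    refine eval_eq_sum_fiberCoeff (j := n) ?_ z w
    rw [polySpace_eq_box] at hpm ⊢
    exact box_mono le_rfl le_rfl le_rfl (by push_cast; omega) hpm
  have e1 : subspaceKernel (F2 𝒯 hT n m) (eval z w ∘ₗ toLaurent 𝒯 hT)
      (eval z η ∘ₗ toLaurent 𝒯 hT) = ∑ u ∈ Finset.range (m + 2), ∑ k ∈ Finset.range (m + 2),
        κ u k * (w ^ u * conj η ^ k) := by
    rw [subspaceKernel_eval, ← hκdef, Finset.sum_range_succ _ (m + 1)]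
    have h1 : ∀ k : ℕ, κ ((m + 1 : ℕ) : ℤ) k = 0 := fun k => fiberKernel_eq_zero (by omega) z
    have h2 : ∀ u : ℕ, κ u ((m + 1 : ℕ) : ℤ) = 0 := fun k => fiberKernel_eq_zero (by omega) z
    simp only [h1, zero_mul, Finset.sum_const_zero, add_zero, Finset.sum_range_succ _ (m + 1), h2]
  have e2 : w * conj η * subspaceKernel (F2 𝒯 hT n m) (eval z w ∘ₗ toLaurent 𝒯 hT)
      (eval z η ∘ₗ toLaurent 𝒯 hT) = ∑ u ∈ Finset.range (m + 2), ∑ k ∈ Finset.range (m + 2),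
        κ (u - 1) (k - 1) * (w ^ u * conj η ^ k) := by
    rw [subspaceKernel_eval, ← hκdef, Finset.sum_range_succ' _ (m + 1)]
    have h1 : ∀ k : ℤ, κ (((0 : ℕ) : ℤ) - 1) k = 0 := fun k => fiberKernel_eq_zero (by omega) z
    have h2 : ∀ u : ℤ, κ u (((0 : ℕ) : ℤ) - 1) = 0 := fun k => fiberKernel_eq_zero (by omega) z
    simp only [h1, zero_mul, Finset.sum_const_zero, add_zero, Finset.sum_range_succ' _ (m + 1), h2,
      Finset.mul_sum]
    refine Finset.sum_congr rfl fun u _ => Finset.sum_congr rfl fun k _ => ?_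
    push_cast
    rw [add_sub_cancel_right, add_sub_cancel_right]
    ring
  rw [sub_mul, one_mul, e2, e1, hp, hp, map_sum, map_sum, Finset.sum_mul_sum, Finset.sum_mul_sum,
    ← Finset.sum_sub_distrib, ← Finset.sum_sub_distrib]
  refine Finset.sum_congr rfl fun u _ => ?_
  rw [← Finset.sum_sub_distrib, ← Finset.sum_sub_distrib]
  refine Finset.sum_congr rfl fun k _ => ?_
  rw [hκ u k, map_mul, map_mul, map_pow, Complex.conj_conj]
  ring

include hpm hz hκ in
/-- By the Christoffel–Darboux formula, a zero of `p` at `(z, w)` with `|z| = 1` and `|w| ≤ 1` would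
be a common zero of `ℱ²_{n,m}`, and then also of the constant polynomial `1`. -/
theorem eval_ne_zero_of_fiberKernel_recurrence {w : ℂ} (hw : ‖w‖ ≤ 1) : eval z w p ≠ 0 := by
  intro h0
  have hz0 : z ≠ 0 := norm_ne_zero_iff.1 (by simp [hz])
  set b := stdOrthonormalBasis ℂ (F2 𝒯 hT n m)
  have hcd := one_sub_mul_subspaceKernel_F2 hpm hκ
  set r : ℂ → ℂ := fun w => ∑ u ∈ Finset.range (m + 2), conj (fiberCoeff z (m + 1 - u) p) * w ^ u
    with hr
  have hS : ∀ w η, subspaceKernel (F2 𝒯 hT n m) (eval z w ∘ₗ toLaurent 𝒯 hT)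
      (eval z η ∘ₗ toLaurent 𝒯 hT) =
        ∑ i, eval z w (toLaurent 𝒯 hT (b i)) * conj (eval z η (toLaurent 𝒯 hT (b i))) :=
    fun w η => subspaceKernel_eq_sum b _ _
  simp only [hS] at hcd
  have hdiag : ∀ c : ℂ, c * conj c = ((‖c‖ ^ 2 : ℝ) : ℂ) := fun c => by
    rw [Complex.mul_conj']; push_cast; rfl
  -- the diagonal of the kernel vanishes at `w`
  have hsum : ∑ i, eval z w (toLaurent 𝒯 hT (b i)) * conj (eval z w (toLaurent 𝒯 hT (b i))) =
      0 := by
    have hww := hcd w w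
    change _ = _ - r w * conj (r w) at hww
    rw [h0, zero_mul, zero_sub] at hww
    rcases hw.lt_or_eq with hw | hw
    · simp only [hdiag] at hww ⊢
      have h1 : (1 - ‖w‖ ^ 2) * ∑ i, ‖eval z w (toLaurent 𝒯 hT (b i))‖ ^ 2 = -‖r w‖ ^ 2 := by
        exact_mod_cast hww
      have h2 : 0 < 1 - ‖w‖ ^ 2 := by nlinarith [norm_nonneg w]
      have h3 : 0 ≤ ∑ i, ‖eval z w (toLaurent 𝒯 hT (b i))‖ ^ 2 := by positivity
      have h4 : ∑ i, ‖eval z w (toLaurent 𝒯 hT (b i))‖ ^ 2 = 0 := by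
        nlinarith [sq_nonneg ‖r w‖]
      exact_mod_cast h4
    · rw [hdiag w, hw, hdiag (r w)] at hww
      have hrw : r w = 0 := by simpa using hww
      -- on the circle, the formula gives the values at `(w', w)` for `w' ≠ w`
      have hcont : Continuous fun w' => ∑ i, eval z w' (toLaurent 𝒯 hT (b i)) *
          conj (eval z w (toLaurent 𝒯 hT (b i))) :=
        continuous_finsetSum _ fun i _ =>
          (continuous_eval (toLaurent_mem 𝒯 hT _) z).mul continuous_const
      refine congrFun (hcont.ext_on (dense_compl_singleton w) continuous_const
        (g := fun _ => 0) fun w' hw' => ?_) w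
      have h := hcd w' w
      change _ = _ - r w' * conj (r w) at h
      rw [h0, hrw, map_zero, mul_zero, mul_zero, sub_zero] at h
      refine (mul_eq_zero.1 h).resolve_left fun h1 => hw' ?_
      have h2 : w' * conj w * w = w := by rw [← sub_eq_zero.1 h1, one_mul]
      rwa [mul_assoc, Complex.conj_mul', hw, Complex.ofReal_one, one_pow, mul_one] at h2
  have hb : ∀ i, eval z w (toLaurent 𝒯 hT (b i)) = 0 := by
    simp only [hdiag] at hsum
    have h1 : ∑ i, ‖eval z w (toLaurent 𝒯 hT (b i))‖ ^ 2 = 0 := by exact_mod_cast hsum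
    intro i
    have := (Finset.sum_eq_zero_iff_of_nonneg fun i _ => sq_nonneg _).1 h1 i (Finset.mem_univ i)
    simpa using this
  have hF2 : ∀ f ∈ F2 𝒯 hT n m, eval z w (toLaurent 𝒯 hT f) = 0 := by
    intro f hf
    have := congrArg (fun x : F2 𝒯 hT n m => eval z w (toLaurent 𝒯 hT x)) (b.sum_repr ⟨f, hf⟩)
    simp only [Submodule.coe_sum, Submodule.coe_smul, map_sum, map_smul, hb, smul_zero,
      Finset.sum_const_zero] at this
    exact this.symm
  obtain ⟨f, hf⟩ := exists_toLaurent_eq (𝒯 := 𝒯) hT (mono_mem_polySpace (j := n) (k := m)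
    (s := 0) (t := 0) (by omega) (by omega))
  have := eq_zero_of_forall_F2 hz (eval_mono_mul hz0 w) hF2 f
  rw [hf] at this
  simp at this

end TruncatedShift


/-! ### The moments of `1 / |p| ^ 2` -/

lemma avg_sum_mul_conj_div {M : ℕ} {q : ℂ → ℂ} (hq : CircleContinuous q)
    (hq0 : ∀ w, ‖w‖ = 1 → q w ≠ 0) (a b : ℕ → ℂ) :
    avg (fun w => (∑ t ∈ Finset.range M, a t * w ^ t) *
        conj (∑ u ∈ Finset.range M, b u * w ^ u) / (‖q w‖ : ℂ) ^ 2) =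
      ∑ t ∈ Finset.range M, ∑ u ∈ Finset.range M, a t * conj (b u) * fiberMoment q (t - u) := by
  have hc : ∀ k : ℤ, CircleContinuous fun w => w ^ k / (‖q w‖ : ℂ) ^ 2 := fun k => by
    refine (circleContinuous_zpow k).div
      ((Complex.continuous_ofReal.comp_continuousOn hq.norm).pow 2) fun w hw => ?_
    have := hq0 w (by simpa using hw)
    simpa using this
  have hc' : ∀ (c : ℂ) (k : ℤ), CircleContinuous fun w => c * (w ^ k / (‖q w‖ : ℂ) ^ 2) :=
    fun c k => continuousOn_const.mul (hc k)
  simp only [fiberMoment, ← avg_const_mul]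
  have h1 : ∀ t ∈ Finset.range M, CircleContinuous fun w => ∑ u ∈ Finset.range M,
      a t * conj (b u) * (w ^ ((t : ℤ) - u) / (‖q w‖ : ℂ) ^ 2) := fun t _ =>
    continuousOn_finsetSum _ fun u _ => hc' _ _
  have h2 : ∀ t, ∑ u ∈ Finset.range M, avg (fun w =>
      a t * conj (b u) * (w ^ ((t : ℤ) - u) / (‖q w‖ : ℂ) ^ 2)) =
      avg (fun w => ∑ u ∈ Finset.range M,
        a t * conj (b u) * (w ^ ((t : ℤ) - u) / (‖q w‖ : ℂ) ^ 2)) := fun t =>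
    (avg_sum fun u _ => hc' _ _).symm
  simp only [h2]
  rw [← avg_sum h1]
  refine avg_congr fun w hw => ?_
  have hw0 : w ≠ 0 := norm_ne_zero_iff.1 (by simp [hw])
  rw [map_sum, Finset.sum_mul_sum, Finset.sum_div]
  refine Finset.sum_congr rfl fun t _ => ?_
  rw [Finset.sum_div]
  refine Finset.sum_congr rfl fun u _ => ?_
  have := conj_zpow_of_norm_eq_one hw u
  rw [zpow_natCast] at this
  rw [map_mul, this, sub_eq_add_neg, zpow_add₀ hw0, zpow_natCast]
  ring

section Moments

variable {n m : ℕ} {𝒯 : laurentSpace n m →ₗ[ℂ] ℂ} {hT : IsPositive 𝒯}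
  {p : Laurent} (hpm : p ∈ polySpace (n : ℤ) m)
  (hκ : ∀ z : ℂ, ‖z‖ = 1 → ∀ u k : ℤ, fiberKernel 𝒯 hT (F2 𝒯 hT n m) z u k =
    fiberKernel 𝒯 hT (F2 𝒯 hT n m) z (u - 1) (k - 1) +
      fiberCoeff z u p * conj (fiberCoeff z k p) -
      conj (fiberCoeff z (m + 1 - u) p) * fiberCoeff z (m + 1 - k) p)

include hpm hκ in
/-- On each fibre over `|z| = 1`, an orthonormal basis of `ℱ²_{n,m}` is orthonormal with respect to
`1 / |p(z, ·)| ^ 2`: by the Gohberg–Semencul formula, the kernel of `ℱ²_{n,m}` inverts the Toeplitz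
matrix of the moments of `1 / |p(z, ·)| ^ 2`. -/
lemma avg_mul_conj_div_of_basis (b : OrthonormalBasis (Fin (m + 1)) ℂ (F2 𝒯 hT n m)) {z : ℂ}
    (hz : ‖z‖ = 1) (i l : Fin (m + 1)) :
    avg (fun w => eval z w (toLaurent 𝒯 hT (b i)) * conj (eval z w (toLaurent 𝒯 hT (b l))) /
      (‖eval z w p‖ : ℂ) ^ 2) = if i = l then 1 else 0 := by
  have hp0 : ∀ w, ‖w‖ ≤ 1 → eval z w p ≠ 0 := fun w hw =>
    eval_ne_zero_of_fiberKernel_recurrence hpm hz (hκ z hz) hw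
  set Φ : Matrix (Fin (m + 1)) (Fin (m + 1)) ℂ :=
    Matrix.of fun u i => fiberCoeff z (u : ℕ) (toLaurent 𝒯 hT (b i)) with hΦ
  set Θ : Matrix (Fin (m + 1)) (Fin (m + 1)) ℂ :=
    Matrix.of fun t u => fiberMoment (fun w => eval z w p) ((t : ℕ) - (u : ℕ)) with hΘ
  have hp : ∀ w, eval z w p = ∑ u ∈ Finset.range (m + 1 + 1), fiberCoeff z u p * w ^ u :=
    fun w => by
      refine eval_eq_sum_fiberCoeff (j := n) ?_ z w
      rw [polySpace_eq_box] at hpm ⊢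
      exact box_mono le_rfl le_rfl le_rfl (by push_cast; omega) hpm
  have hinv : Θ * (Φ.map conj * Φ.transpose) = 1 := by
    ext t k
    have := sum_fiberMoment_mul_kernel (c := fun u => fiberCoeff z u p) hp hp0
      (κ := fiberKernel 𝒯 hT (F2 𝒯 hT n m) z)
      (fun k => fiberKernel_eq_zero (by omega) z) (fun k => fiberKernel_eq_zero (by omega) z)
      (fun k => fiberKernel_eq_zero (by omega) z)
      (fun {u k} _ _ _ _ => by
        have := hκ z hz u k
        push_cast
        exact this) t.2 k.2
    rw [Matrix.mul_apply, Matrix.one_apply]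
    simp only [Fin.ext_iff]
    rw [← this, ← Fin.sum_univ_eq_sum_range (fun u : ℕ =>
      fiberMoment (fun w => eval z w p) (t - u) *
        conj (fiberKernel 𝒯 hT (F2 𝒯 hT n m) z u k))]
    refine Finset.sum_congr rfl fun u _ => ?_
    rw [Matrix.mul_apply, fiberKernel, subspaceKernel_eq_sum b, map_sum]
    simp [hΦ, hΘ]
  -- a right inverse of a square matrix is a left inverse
  rw [← mul_assoc] at hinv
  have hinv' := mul_eq_one_comm.1 hinv
  have hev : ∀ (w : ℂ) (f : HSpace 𝒯 hT), eval z w (toLaurent 𝒯 hT f) =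
      ∑ u ∈ Finset.range (m + 1), fiberCoeff z u (toLaurent 𝒯 hT f) * w ^ u := fun w f =>
    eval_eq_sum_fiberCoeff (j := n) (by simpa using toLaurent_mem 𝒯 hT f) z w
  simp only [hev]
  rw [avg_sum_mul_conj_div (continuous_eval hpm z).continuousOn fun w hw => hp0 w hw.le]
  have := congrFun (congrFun hinv' i) l
  rw [Matrix.one_apply, Matrix.mul_apply] at this
  rw [← this, ← Fin.sum_univ_eq_sum_range (fun t : ℕ => ∑ u ∈ Finset.range (m + 1),
    fiberCoeff z t (toLaurent 𝒯 hT (b i)) * conj (fiberCoeff z u (toLaurent 𝒯 hT (b l))) *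
      fiberMoment (fun w => eval z w p) (t - u))]
  refine Finset.sum_congr rfl fun t _ => ?_
  rw [Matrix.mul_apply, Finset.mul_sum, ← Fin.sum_univ_eq_sum_range (fun u : ℕ =>
    fiberCoeff z t (toLaurent 𝒯 hT (b i)) * conj (fiberCoeff z u (toLaurent 𝒯 hT (b l))) *
      fiberMoment (fun w => eval z w p) (t - u))]
  refine Finset.sum_congr rfl fun u _ => ?_
  simp only [hΦ, hΘ, Matrix.transpose_apply, Matrix.of_apply, Matrix.map_apply]
  ring

lemma map_mul_refl_eq_sum_basis {S : Submodule ℂ (HSpace 𝒯 hT)} {ι : Type*} [Fintype ι]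
    (b : OrthonormalBasis ι ℂ S) (φ : Laurent →ₗ[ℂ] ℂ) (f g : S) :
    φ (toLaurent 𝒯 hT f * refl (toLaurent 𝒯 hT g)) = ∑ i, ∑ l, ⟪b i, f⟫_ℂ * ⟪g, b l⟫_ℂ *
      φ (toLaurent 𝒯 hT (b i) * refl (toLaurent 𝒯 hT (b l))) := by
  have e : ∀ f : S, toLaurent 𝒯 hT f = ∑ i, ⟪b i, f⟫_ℂ • toLaurent 𝒯 hT (b i) := fun f => by
    conv_lhs => rw [← b.sum_repr' f]
    simp only [Submodule.coe_sum, Submodule.coe_smul, map_sum, map_smul]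
  rw [e f, e g, map_sum, Finset.sum_mul_sum, map_sum]
  refine Finset.sum_congr rfl fun i _ => ?_
  rw [map_sum]
  refine Finset.sum_congr rfl fun l _ => ?_
  have h : conj ⟪b l, g⟫_ℂ = ⟪g, b l⟫_ℂ := inner_conj_symm (𝕜 := ℂ) g (b l)
  rw [refl_smul, smul_mul_smul_comm, map_smul, smul_eq_mul, h]

include hpm hκ in
/-- Averaging the fibrewise orthonormality over `z`: the spaces `z ^ j * ℱ²_{n,m}` are pairwise
orthogonal with respect to `1 / |p| ^ 2`, which induces the given inner product on `ℱ²_{n,m}`. -/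
lemma weightForm_mono_mul_F2 (j : ℤ) (f g : F2 𝒯 hT n m) :
    weightForm p (mono j 0 * (toLaurent 𝒯 hT f * refl (toLaurent 𝒯 hT g))) =
      if j = 0 then ⟪g, f⟫_ℂ else 0 := by
  have hp1 : ∀ z w, ‖z‖ = 1 → ‖w‖ = 1 → eval z w p ≠ 0 := fun z w hz hw =>
    eval_ne_zero_of_fiberKernel_recurrence hpm hz (hκ z hz) hw.le
  set b := (stdOrthonormalBasis ℂ (F2 𝒯 hT n m)).reindex (finCongr finrank_F2)
  have hb : ∀ i l,
      weightForm p (mono j 0 * (toLaurent 𝒯 hT (b i) * refl (toLaurent 𝒯 hT (b l)))) =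
      if j = 0 then (if i = l then 1 else 0) else 0 := fun i l => by
    have h1 : ∀ z : ℂ, ‖z‖ = 1 → avg (fun w => eval z w (mono j 0 * (toLaurent 𝒯 hT (b i) *
        refl (toLaurent 𝒯 hT (b l)))) / (‖eval z w p‖ : ℂ) ^ 2) =
          (if i = l then 1 else 0) * z ^ j := fun z hz => by
      rw [← avg_mul_conj_div_of_basis hpm hκ b hz i l, mul_comm (avg _), ← avg_const_mul]
      refine avg_congr fun w hw => ?_
      have hz0 : z ≠ 0 := norm_ne_zero_iff.1 (by simp [hz])
      have hw0 : w ≠ 0 := norm_ne_zero_iff.1 (by simp [hw])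
      rw [eval_mul hz0 hw0, eval_mul hz0 hw0, eval_refl hz hw, eval_mono, zpow_zero, mul_one,
        mul_div_assoc]
    rw [weightForm_eq hp1, torusAvg, avg_congr h1, avg_const_mul, avg_zpow]
    split_ifs <;> simp
  have := map_mul_refl_eq_sum_basis b (weightForm p ∘ₗ LinearMap.mulLeft ℂ (mono j 0)) f g
  simp only [LinearMap.comp_apply, LinearMap.mulLeft_apply, hb] at this
  rw [this]
  split_ifs with hj
  · rw [← b.sum_inner_mul_inner]
    refine Finset.sum_congr rfl fun i _ => ?_
    simp only [mul_ite, mul_one, mul_zero, Finset.sum_ite_eq, Finset.mem_univ, if_true]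
    exact mul_comm _ _
  · simp only [mul_zero, Finset.sum_const_zero]

lemma tendsto_map_mul_refl_truncatedShift_pow (φ : Laurent →ₗ[ℂ] ℂ)
    (g g' : hbox 𝒯 hT 0 (n - 1) 0 m) :
    Filter.Tendsto (fun N : ℕ => φ (toLaurent 𝒯 hT ((truncatedShift 𝒯 hT ^ N) g) *
      refl (toLaurent 𝒯 hT ((truncatedShift 𝒯 hT ^ N) g')))) Filter.atTop (nhds 0) := by
  set b := stdOrthonormalBasis ℂ (hbox 𝒯 hT 0 (n - 1) 0 m)
  refine Filter.Tendsto.congr (fun N => (map_mul_refl_eq_sum_basis b φ _ _).symm) ?_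
  have h : ∀ i l, Filter.Tendsto (fun N : ℕ => ⟪b i, (truncatedShift 𝒯 hT ^ N) g⟫_ℂ *
      ⟪(truncatedShift 𝒯 hT ^ N) g', b l⟫_ℂ *
        φ (toLaurent 𝒯 hT (b i) * refl (toLaurent 𝒯 hT (b l)))) Filter.atTop (nhds 0) := by
    intro i l
    have h1 := (tendsto_const_nhds (x := b i)).inner (𝕜 := ℂ) (tendsto_truncatedShift_pow g)
    have h2 := (tendsto_truncatedShift_pow g').inner (𝕜 := ℂ) (tendsto_const_nhds (x := b l))
    have h3 := (h1.mul h2).mul_const (φ (toLaurent 𝒯 hT (b i) * refl (toLaurent 𝒯 hT (b l))))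
    rwa [inner_zero_left, mul_zero, zero_mul] at h3
  have := tendsto_finsetSum Finset.univ fun i _ =>
    tendsto_finsetSum Finset.univ fun l _ => h i l
  simp only [Finset.sum_const_zero] at this
  exact this

include hpm hκ in
/-- `ℱ²_{n,m}` is orthogonal to `z ^ j * P_{n-1,m}` for all `j ≤ 0`, with respect to
`1 / |p| ^ 2`: up to powers of `z`, the pairing does not change if `g` is replaced by its image
under a power of the truncated shift. -/
lemma weightForm_mono_mul_eq_zero {j : ℤ} (hj : j ≤ 0) (g : hbox 𝒯 hT 0 (n - 1) 0 m)
    (f : F2 𝒯 hT n m) :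
    weightForm p (mono j 0 * (toLaurent 𝒯 hT g * refl (toLaurent 𝒯 hT f))) = 0 := by
  have hp1 : ∀ z w, ‖z‖ = 1 → ‖w‖ = 1 → eval z w p ≠ 0 := fun z w hz hw =>
    eval_ne_zero_of_fiberKernel_recurrence hpm hz (hκ z hz) hw.le
  have step : ∀ j : ℤ, j ≤ 0 → ∀ g : hbox 𝒯 hT 0 (n - 1) 0 m,
      weightForm p (mono j 0 * (toLaurent 𝒯 hT g * refl (toLaurent 𝒯 hT f))) =
        weightForm p (mono (j - 1) 0 *
          (toLaurent 𝒯 hT (truncatedShift 𝒯 hT g) * refl (toLaurent 𝒯 hT f))) := by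
    intro j hj g
    obtain ⟨f', hf', e⟩ := exists_eq_add_truncatedShift g
    have h1 := weightForm_mono_mul_F2 hpm hκ (j - 1) ⟨f', hf'⟩ f
    rw [if_neg (by omega)] at h1
    have h2 : mono j 0 = mono (j - 1) 0 * mono 1 0 := by
      rw [mono_mul_mono, sub_add_cancel, add_zero]
    rw [h2, mul_assoc, ← mul_assoc (mono 1 0), e, add_mul, mul_add, map_add, h1, zero_add]
  have iter : ∀ N : ℕ, weightForm p (mono j 0 * (toLaurent 𝒯 hT g * refl (toLaurent 𝒯 hT f))) =
      weightForm p (mono (j - N) 0 *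
        (toLaurent 𝒯 hT ((truncatedShift 𝒯 hT ^ N) g) * refl (toLaurent 𝒯 hT f))) := by
    intro N
    induction N with
    | zero => simp
    | succ N ih =>
      rw [ih, step _ (by omega), pow_succ']
      push_cast
      rw [sub_sub]
      rfl
  have hbound : ∀ N : ℕ,
      ‖weightForm p (mono j 0 * (toLaurent 𝒯 hT g * refl (toLaurent 𝒯 hT f)))‖ ^ 2 ≤
        (weightForm p (toLaurent 𝒯 hT ((truncatedShift 𝒯 hT ^ N) g) *
            refl (toLaurent 𝒯 hT ((truncatedShift 𝒯 hT ^ N) g)))).re *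
          (weightForm p (toLaurent 𝒯 hT f * refl (toLaurent 𝒯 hT f))).re := by
    intro N
    have := norm_weightForm_sq_le hp1
      (mono (j - N) 0 * toLaurent 𝒯 hT ((truncatedShift 𝒯 hT ^ N) g)) (toLaurent 𝒯 hT f)
    rwa [map_mul refl, refl_mono, mul_mul_mul_comm, mono_mul_mono, add_neg_cancel, neg_zero,
      add_zero, mono_zero_zero, one_mul, mul_assoc, ← iter N] at this
  have hlim := ((Complex.continuous_re.tendsto 0).comp
    (tendsto_map_mul_refl_truncatedShift_pow (weightForm p) g g)).mul_const
      (weightForm p (toLaurent 𝒯 hT f * refl (toLaurent 𝒯 hT f))).re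
  rw [Complex.zero_re, zero_mul] at hlim
  have h0 := ge_of_tendsto' hlim hbound
  exact norm_eq_zero.1 (pow_eq_zero_iff two_ne_zero |>.1 (le_antisymm h0 (sq_nonneg _)))

include hpm hκ in
lemma weightForm_mul_refl_F2_eq_zero (g : hbox 𝒯 hT 0 (n - 1) 0 m) (f : F2 𝒯 hT n m) :
    weightForm p (toLaurent 𝒯 hT g * refl (toLaurent 𝒯 hT f)) = 0 ∧
      weightForm p (toLaurent 𝒯 hT f * refl (toLaurent 𝒯 hT g)) = 0 := by
  have hp1 : ∀ z w, ‖z‖ = 1 → ‖w‖ = 1 → eval z w p ≠ 0 := fun z w hz hw =>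
    eval_ne_zero_of_fiberKernel_recurrence hpm hz (hκ z hz) hw.le
  have h1 := weightForm_mono_mul_eq_zero hpm hκ le_rfl g f
  rw [mono_zero_zero, one_mul] at h1
  refine ⟨h1, ?_⟩
  have h2 := weightForm_refl hp1 (toLaurent 𝒯 hT g * refl (toLaurent 𝒯 hT f))
  rwa [h1, map_zero, map_mul, refl_refl, mul_comm] at h2

include hpm hκ in
lemma weightForm_mul_refl_F2 (f f' : F2 𝒯 hT n m) :
    weightForm p (toLaurent 𝒯 hT f * refl (toLaurent 𝒯 hT f')) = ⟪f', f⟫_ℂ := by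
  have := weightForm_mono_mul_F2 hpm hκ 0 f f'
  rwa [if_pos rfl, mono_zero_zero, one_mul] at this

lemma inner_add_add_of_F2 (g g' : hbox 𝒯 hT 0 (n - 1) 0 m) (f f' : F2 𝒯 hT n m) :
    ⟪(f' + g' : HSpace 𝒯 hT), (f + g : HSpace 𝒯 hT)⟫_ℂ = ⟪f', f⟫_ℂ + ⟪g', g⟫_ℂ := by
  have h1 : ⟪(f' : HSpace 𝒯 hT), (g : HSpace 𝒯 hT)⟫_ℂ = 0 :=
    Submodule.inner_left_of_mem_orthogonal g.2 (F2_top_eq (𝒯 := 𝒯) (hT := hT) ▸ f'.2)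
  have h2 : ⟪(g' : HSpace 𝒯 hT), (f : HSpace 𝒯 hT)⟫_ℂ = 0 :=
    Submodule.inner_right_of_mem_orthogonal g'.2 (F2_top_eq (𝒯 := 𝒯) (hT := hT) ▸ f.2)
  rw [inner_add_left, inner_add_right, inner_add_right, h1, h2, add_zero, zero_add]
  rfl

include hpm hκ in
lemma weightForm_add_add_of_F2 (g g' : hbox 𝒯 hT 0 (n - 1) 0 m) (f f' : F2 𝒯 hT n m) :
    weightForm p ((toLaurent 𝒯 hT f + toLaurent 𝒯 hT g) *
        refl (toLaurent 𝒯 hT f' + toLaurent 𝒯 hT g')) =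
      ⟪f', f⟫_ℂ + weightForm p (toLaurent 𝒯 hT g * refl (toLaurent 𝒯 hT g')) := by
  rw [map_add, add_mul, mul_add, mul_add, map_add, map_add, map_add,
    weightForm_mul_refl_F2 hpm hκ, (weightForm_mul_refl_F2_eq_zero hpm hκ g' f).2,
    (weightForm_mul_refl_F2_eq_zero hpm hκ g f').1, add_zero, zero_add]

include hpm hκ in
/-- The difference of the two inner products on `P_{n-1,m}` is invariant under the truncated shift,
hence zero. -/
lemma weightForm_mul_refl_hbox (g g' : hbox 𝒯 hT 0 (n - 1) 0 m) :
    weightForm p (toLaurent 𝒯 hT g * refl (toLaurent 𝒯 hT g')) = ⟪g', g⟫_ℂ := by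
  have step : ∀ g g' : hbox 𝒯 hT 0 (n - 1) 0 m,
      weightForm p (toLaurent 𝒯 hT g * refl (toLaurent 𝒯 hT g')) - ⟪g', g⟫_ℂ =
        weightForm p (toLaurent 𝒯 hT (truncatedShift 𝒯 hT g) *
          refl (toLaurent 𝒯 hT (truncatedShift 𝒯 hT g'))) -
            ⟪truncatedShift 𝒯 hT g', truncatedShift 𝒯 hT g⟫_ℂ := by
    intro g g'
    obtain ⟨f, hf, e⟩ := exists_eq_add_truncatedShift g
    obtain ⟨f', hf', e'⟩ := exists_eq_add_truncatedShift g'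
    have h1 : weightForm p (toLaurent 𝒯 hT g * refl (toLaurent 𝒯 hT g')) =
        weightForm p ((mono 1 0 * toLaurent 𝒯 hT g) * refl (mono 1 0 * toLaurent 𝒯 hT g')) := by
      rw [map_mul refl, refl_mono, mul_mul_mul_comm, mono_mul_mono, add_neg_cancel, neg_zero,
        add_zero, mono_zero_zero, one_mul]
    have h2 : ⟪(g' : HSpace 𝒯 hT), (g : HSpace 𝒯 hT)⟫_ℂ =
        ⟪f' + (truncatedShift 𝒯 hT g' : HSpace 𝒯 hT),
          f + (truncatedShift 𝒯 hT g : HSpace 𝒯 hT)⟫_ℂ :=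
      (inner_shift (s := 1) (t := 0) (by rw [map_add, e]) (by rw [map_add, e'])).symm
    have h3 := inner_add_add_of_F2 (truncatedShift 𝒯 hT g) (truncatedShift 𝒯 hT g')
      ⟨f, hf⟩ ⟨f', hf'⟩
    have h4 := weightForm_add_add_of_F2 hpm hκ (truncatedShift 𝒯 hT g) (truncatedShift 𝒯 hT g')
      ⟨f, hf⟩ ⟨f', hf'⟩
    rw [h1, e, e', h4, show ⟪g', g⟫_ℂ = _ from h2.trans h3]
    ring
  have iter : ∀ N : ℕ,
      weightForm p (toLaurent 𝒯 hT g * refl (toLaurent 𝒯 hT g')) - ⟪g', g⟫_ℂ =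
        weightForm p (toLaurent 𝒯 hT ((truncatedShift 𝒯 hT ^ N) g) *
          refl (toLaurent 𝒯 hT ((truncatedShift 𝒯 hT ^ N) g'))) -
            ⟪(truncatedShift 𝒯 hT ^ N) g', (truncatedShift 𝒯 hT ^ N) g⟫_ℂ := by
    intro N
    induction N with
    | zero => rfl
    | succ N ih =>
      rw [ih, step, pow_succ']
      rfl
  have hlim := (tendsto_map_mul_refl_truncatedShift_pow (weightForm p) g g').sub
    ((tendsto_truncatedShift_pow g').inner (𝕜 := ℂ) (tendsto_truncatedShift_pow g))
  simp only [← iter, inner_zero_left, sub_zero] at hlim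
  exact sub_eq_zero.1 (tendsto_nhds_unique tendsto_const_nhds hlim)

include hpm hκ in
lemma weightForm_mul_refl_eq_inner (f f' : HSpace 𝒯 hT) :
    weightForm p (toLaurent 𝒯 hT f * refl (toLaurent 𝒯 hT f')) = ⟪f', f⟫_ℂ := by
  obtain ⟨g, f, hf, rfl⟩ := exists_eq_add_of_hbox f
  obtain ⟨g', f', hf', rfl⟩ := exists_eq_add_of_hbox f'
  rw [add_comm _ f, add_comm _ f', map_add, map_add]
  refine (weightForm_add_add_of_F2 hpm hκ g g' ⟨f, hf⟩ ⟨f', hf'⟩).trans ?_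
  rw [weightForm_mul_refl_hbox hpm hκ]
  exact (inner_add_add_of_F2 g g' ⟨f, hf⟩ ⟨f', hf'⟩).symm

end Moments

/-- The monomials `z ^ j * w ^ k` of `L_{n,m}` are of the form `f * refl g` with monomials `f` and
`g` of `P_{n,m}`, so that the inner product determines `𝒯`. -/
theorem bernsteinSzegoCondition_of_splitShift {n m : ℕ} {𝒯 : laurentSpace n m →ₗ[ℂ] ℂ}
    {hT : IsPositive 𝒯} (h : SplitShift 𝒯 hT) : BernsteinSzegoCondition 𝒯 := by
  obtain ⟨p, hpm, hκ⟩ := exists_fiberKernel_F2_recurrence h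
  refine bernsteinSzegoCondition_iff.2 ⟨p, hpm, fun z w hz hw =>
    eval_ne_zero_of_fiberKernel_recurrence hpm hz (hκ z hz) hw,
    eq_weightForm_iff.2 fun j k hj hk => ?_⟩
  rw [abs_le] at hj hk
  obtain ⟨f, hf⟩ := exists_toLaurent_eq (𝒯 := 𝒯) hT (mono_mem_polySpace (j := n) (k := m)
    (s := max j 0) (t := max k 0) (by omega) (by omega))
  obtain ⟨g, hg⟩ := exists_toLaurent_eq (𝒯 := 𝒯) hT (mono_mem_polySpace (j := n) (k := m)
    (s := max (-j) 0) (t := max (-k) 0) (by omega) (by omega))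
  have e : toLaurent 𝒯 hT f * refl (toLaurent 𝒯 hT g) = mono j k := by
    rw [hf, hg, refl_mono, mono_mul_mono]
    congr 1 <;> omega
  have := weightForm_mul_refl_eq_inner hpm hκ f g
  rw [e, weightForm_mono, inner_eq] at this
  rw [this]
  exact congrArg 𝒯 (Subtype.ext e.symm)

end BernsteinSzego

end

theorem mainTheorem1 (n m : ℕ)
    (𝒯 : BernsteinSzego.laurentSpace (n : ℤ) (m : ℤ) →ₗ[ℂ] ℂ)
    (hT : BernsteinSzego.IsPositive 𝒯) :
    List.TFAE
      [BernsteinSzego.BernsteinSzegoCondition 𝒯,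
       BernsteinSzego.SplitShift 𝒯 hT,
       BernsteinSzego.invariantSpan 𝒯 hT ≤ LinearMap.ker (BernsteinSzego.opA 𝒯 hT),
       ∀ j : ℕ, j < n →
         BernsteinSzego.opA 𝒯 hT ∘ₗ (BernsteinSzego.opT 𝒯 hT ^ j) ∘ₗ BernsteinSzego.opB 𝒯 hT = 0] := by
  tfae_have 1 → 3 := fun h => by
    obtain ⟨p, hpm, hp, h𝒯⟩ := BernsteinSzego.bernsteinSzegoCondition_iff.1 h
    exact BernsteinSzego.invariantSpan_le_ker_of_weight hpm hp h𝒯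
  tfae_have 3 → 2 := BernsteinSzego.splitShift_of_invariantSpan_le_ker
  tfae_have 2 → 1 := BernsteinSzego.bernsteinSzegoCondition_of_splitShift
  tfae_have 3 ↔ 4 := BernsteinSzego.invariantSpan_le_ker_iff
  tfae_finish
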